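/- Let $K$ be a number field of degree $d=[K:\mathbb Q]\ge 2$ with ring of integers $\mathcal O_K$, discriminant $\Delta_K$, regulator $R_K$, $r$ real places and $s$ complex places, and put $q:=r+s-1$. Write $\mathfrak N\mathfrak a$ for the absolute norm of a fractional ideal $\mathfrak a$ of $K$. For an infinite place $w$ of $K$ let $|\cdot|_w$ be the absolute value on $K$ induced by the usual absolute value of $\mathbb C$ through an embedding belonging to $w$, and let $d_w\in\{1,2\}$ be the local degree at $w$. Let $V:=\{1,2,3,12,21,23,32,31,13\}$. In what follows $(j,k,l)$ runs through $\{(1,2,3),(2,3,1),(3,1,2)\}$. Fix a system of fundamental units of $\mathcal O_K$, and let $\mathcal F\subseteq K^\times$ be the group that it generates. The group $\mathcal F^7$ acts on $(K^\times)^9=(K^\times)^V$ by $$(\zeta,\zeta_1,\zeta_2,\zeta_3,\zeta_{21},\zeta_{32},\zeta_{13})\odot (y_v)_{v\in V}=(z_v)_{v\in V},$$ where $z_v=\zeta_vy_v$ for $v\in\{1,2,3,21,32,13\}$ and $z_{jk}=\zeta\,\zeta_k^{-2}\zeta_{lk}^{-1}\zeta_j^{-1}\zeta_{kj}^{-1}\,y_{jk}$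 for $jk\in\{12,23,31\}$. Let $\mathcal R\subseteq (K^\times)^9$ be any system of representatives for the orbits of this action and, for $B>0$, put $$\mathcal R(B):=\Big\{\mathbf y\in\mathcal R\ \Big|\ \prod_{w\mid\infty}\ \max_{1\le j\le 3}\big|y_j^3\,y_{jk}\,y_{jl}\,y_{kj}^2\,y_{lj}^2\big|_w^{d_w}\le B\Big\}.$$ Let $c>0$. Then there is a constant $C$, depending only on $K$ and $c$, such that for all fractional ideals $\mathfrak a_v$ $(v\in V)$ of $K$ with $\mathfrak N\mathfrak a_v\ge c$ for all $v$, and all real $B\ge e$, the set $\{\mathbf y\in\mathcal R(B)\mid y_v\in\mathfrak a_v\text{ for all }v\in V\}$ is finite and its cardinality differs from $$\frac{9^q}{4\cdot 6!}\left(\frac{2^r(2\pi)^s}{\sqrt{|\Delta_K|}}\right)^9\frac{R_K^7}{\prod_{v\in V}\mathfrak N\mathfrak a_v}\,B(\log B)^6$$ by at most $$C\cdot\frac{\max_{1\le j\le 3}\{\mathfrak N\mathfrak a_j\}^{1/d}}{\prod_{j=1}^{3}\mathfrak N\mathfrak a_j\ \prod_{i\ne j}\mathfrak N\mathfrak a_{ij}^{\,1-2/(3d)}}\,B(\log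 B)^5 .$$ In particular, $C$ depends neither on the choice of the fundamental units nor on that of $\mathcal R$. -/

import Mathlib

open NumberField nonZeroDivisors

/-- The nine indices `V = {1, 2, 3, 12, 21, 23, 32, 31, 13}` of the torsor variables. -/
inductive TorsorIndex where
  | v1 | v2 | v3 | v12 | v21 | v23 | v32 | v31 | v13
  deriving DecidableEq

instance : Fintype TorsorIndex where
  elems := {.v1, .v2, .v3, .v12, .v21, .v23, .v32, .v31, .v13}
  complete v := by cases v <;> decide

/-- The seven indices of the acting units `(ζ, ζ₁, ζ₂, ζ₃, ζ₂₁, ζ₃₂, ζ₁₃)`. -/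
inductive UnitIndex where
  | z | z1 | z2 | z3 | z21 | z32 | z13

namespace CubicTorsor

variable {K : Type*} [Field K]

/-- The action `⊙` on `(Kˣ)⁹`: the variables `1, 2, 3, 21, 32, 13` are multiplied by the unit with
the same index and, for `(j, k, l)` a cyclic permutation of `(1, 2, 3)`, the variable `jk` is
multiplied by `ζ ζₖ⁻² ζₗₖ⁻¹ ζⱼ⁻¹ ζₖⱼ⁻¹`. -/
def act (ζ : UnitIndex → Kˣ) (y : TorsorIndex → Kˣ) : TorsorIndex → Kˣ
  | .v1 => ζ .z1 * y .v1
  | .v2 => ζ .z2 * y .v2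
  | .v3 => ζ .z3 * y .v3
  | .v21 => ζ .z21 * y .v21
  | .v32 => ζ .z32 * y .v32
  | .v13 => ζ .z13 * y .v13
  | .v12 => ζ .z * (ζ .z2 ^ 2)⁻¹ * (ζ .z32)⁻¹ * (ζ .z1)⁻¹ * (ζ .z21)⁻¹ * y .v12
  | .v23 => ζ .z * (ζ .z3 ^ 2)⁻¹ * (ζ .z13)⁻¹ * (ζ .z2)⁻¹ * (ζ .z32)⁻¹ * y .v23
  | .v31 => ζ .z * (ζ .z1 ^ 2)⁻¹ * (ζ .z21)⁻¹ * (ζ .z3)⁻¹ * (ζ .z13)⁻¹ * y .v31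

/-- `R` is a system of representatives for the orbits of `(Kˣ)⁹` under the action `⊙` of `F⁷`:
every orbit `{ζ ⊙ y | ζ ∈ F⁷}` contains exactly one element of `R`. -/
def IsOrbitRepresentatives (F : Subgroup Kˣ) (R : Set (TorsorIndex → Kˣ)) : Prop :=
  ∀ y : TorsorIndex → Kˣ,
    ∃! x : TorsorIndex → Kˣ, x ∈ R ∧ ∃ ζ : UnitIndex → Kˣ, (∀ i, ζ i ∈ F) ∧ x = act ζ y

/-- The three monomials `ψⱼ(y) = yⱼ³ yⱼₖ yⱼₗ yₖⱼ² yₗⱼ²`, where `{j, k, l} = {1, 2, 3}`. -/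
def psi (y : TorsorIndex → Kˣ) : Fin 3 → K :=
  ![y .v1 ^ 3 * y .v12 * y .v13 * y .v21 ^ 2 * y .v31 ^ 2,
    y .v2 ^ 3 * y .v23 * y .v21 * y .v32 ^ 2 * y .v12 ^ 2,
    y .v3 ^ 3 * y .v31 * y .v32 * y .v13 ^ 2 * y .v23 ^ 2]

variable [NumberField K]

/-- `u` is a system of fundamental units: every unit of the ring of integers is, in exactly one
way, the product of a root of unity and integral powers of the `u i`. -/
def IsFundamentalSystem (u : Fin (Units.rank K) → (𝓞 K)ˣ) : Prop :=
  ∀ x : (𝓞 K)ˣ, ∃! ζe : Units.torsion K × (Fin (Units.rank K) → ℤ),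
    x = ζe.1 * ∏ i, u i ^ ζe.2 i

/-- The subgroup of `Kˣ` generated by a family of units of the ring of integers. -/
def generated (u : Fin (Units.rank K) → (𝓞 K)ˣ) : Subgroup Kˣ :=
  Subgroup.closure (Set.range fun i => Units.map (algebraMap (𝓞 K) K : 𝓞 K →* K) (u i))

/-- The height `∏_{w ∣ ∞} max_j |ψⱼ(y)|_w ^ d_w`, with `d_w` the local degree. -/
noncomputable def height (y : TorsorIndex → Kˣ) : ℝ :=
  ∏ w : InfinitePlace K,
    (Finset.univ.sup' Finset.univ_nonempty fun j : Fin 3 => w (psi y j)) ^ w.mult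

/-- The points of `R` of height at most `B`. -/
def bounded (R : Set (TorsorIndex → Kˣ)) (B : ℝ) : Set (TorsorIndex → Kˣ) :=
  {y ∈ R | height y ≤ B}

/-- The points `y` of `R` of height at most `B` with `y_v ∈ 𝔞_v` for all nine indices `v`. -/
def points (R : Set (TorsorIndex → Kˣ)) (𝔞 : TorsorIndex → FractionalIdeal (𝓞 K)⁰ K) (B : ℝ) :
    Set (TorsorIndex → Kˣ) :=
  {y ∈ bounded R B | ∀ v, (y v : K) ∈ 𝔞 v}

/-- The absolute norm of a fractional ideal, as a real number. -/
noncomputable def idealNorm (I : FractionalIdeal (𝓞 K)⁰ K) : ℝ :=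
  ((FractionalIdeal.absNorm I : ℚ) : ℝ)

/-- The main term of the counting function. -/
noncomputable def mainTerm (𝔞 : TorsorIndex → FractionalIdeal (𝓞 K)⁰ K) (B : ℝ) : ℝ :=
  (9 : ℝ) ^ (InfinitePlace.nrRealPlaces K + InfinitePlace.nrComplexPlaces K - 1)
      / (4 * (Nat.factorial 6 : ℝ))
    * ((2 : ℝ) ^ InfinitePlace.nrRealPlaces K
        * (2 * Real.pi) ^ InfinitePlace.nrComplexPlaces K / Real.sqrt |(discr K : ℝ)|) ^ 9
    * (Units.regulator K ^ 7 / ∏ v, idealNorm (𝔞 v))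
    * (B * Real.log B ^ 6)

/-- The function inside the `O` of the error term. -/
noncomputable def errorTerm (𝔞 : TorsorIndex → FractionalIdeal (𝓞 K)⁰ K) (B : ℝ) : ℝ :=
  (max (idealNorm (𝔞 .v1)) (max (idealNorm (𝔞 .v2)) (idealNorm (𝔞 .v3))))
        ^ (1 / (Module.finrank ℚ K : ℝ))
      / ((idealNorm (𝔞 .v1) * idealNorm (𝔞 .v2) * idealNorm (𝔞 .v3))
        * (idealNorm (𝔞 .v12) * idealNorm (𝔞 .v21) * idealNorm (𝔞 .v23)
            * idealNorm (𝔞 .v32) * idealNorm (𝔞 .v31) * idealNorm (𝔞 .v13))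
          ^ (1 - 2 / (3 * (Module.finrank ℚ K : ℝ))))
    * (B * Real.log B ^ 5)

end CubicTorsor

/-! Fix the six coordinates `z` with two indices and let `t = (y₁, y₂, y₃)` vary. Since `ψⱼ = tⱼ³ ·
cofactor z j`, the height is the cube of a weighted height of `t`, with weights `|cofactor z
j|_w^(1/3)`. So `t` is counted below `X = B^(1/3)`, and the counts are summed over `z`.

Units. Height and membership in ideals are invariant under `⊙`, so all systems of representatives
give the same count (`encard_points_eq`). In a convenient system `y₁` and five of the `zᵢ` lie in a
transversal `D` of `F` in `Kˣ`, while `y₂` and `y₃` are free. One unit is then left over and acts on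
`y₃₁` through its cube, so `y₃₁` runs through representatives modulo cubes, that is, through `3^q`
translates of `D`. Over each `z` the triple `t` is counted modulo diagonal units.

Fibres (`exists_weightedPoints_estimate`). Let `v = boxConst K`, and let `ρ` be the norm size of a
box divided by the norm of an ideal. Minkowski's theorem shows that every point of space is within
`O(ρ^(-1/d))` times the box of some element of the ideal; hence the box contains `vρ + O(ρ^(1-1/d))`
elements, uniformly in its shape. For `n`-tuples modulo units, the logarithmic sizes at all infinite
places but one are confined to a cube of side `δ` at `-ξ`, and `ξ` is averaged over a fundamental
domain of the unit lattice. Unfolding counts each orbit of height at most `X` with weight about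
`δ^q`. The cube is an alternating sum of boxes with main term `(1 - e^(-nδ))^q v^n ∏ ρⱼ`; division
by `δ^q` leaves `n^q R v^n ∏ ρⱼ`, with a power saving in the smallest `ρⱼ`.

Sum over `z`. Let `xᵢ` be the logarithm of the norm of `zᵢ` relative to its ideal. For `n = 3` the
product of the densities is `G e^(-∑ xᵢ)` with `G = B / ∏ 𝔑𝔞_v`, supported on a polytope cut out by
three linear forms in `x`. For `n = 1` the same estimate says that each `xᵢ` is distributed like `κ
e^x dx`, where `κ = R v`. So the sum is `κ⁶` times the volume of the polytope, up to a fifth power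
of its size. The fibre errors decay exponentially with the distance to a facet and thereby lose one
of the six dimensions (`sum_cyclicPolytope_exp_le`). With all bounds equal to `t` the volume is `t⁶
/ (4 · 6!)` (`volume_cyclicPolytope_const`). Replacing the true bounds by `log B` costs powers of
logarithms of the norms, which the powers of norms in the error term absorb (`exists_log_absorb`).

Altogether `9^q = 3^q · 3^q`, `R⁷ = R · R⁶` and `v⁹ = v³ · v⁶`, one factor from the fibres and the
other from the sum over `z` and the cube classes. -/

namespace CubicTorsor

/-! ### Lattice points and volumes. -/

section Translates

open MeasureTheory

variable {V : Type*} [AddCommGroup V] [MeasurableSpace V] [MeasurableAdd V]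

/-- Cut `S` along the lattice translates of `D` and move the pieces back to `D`: a point of `D` is
covered once for each of its translates that lies in `S`. -/
theorem measure_eq_lintegral_encard {μ : Measure V} [μ.IsAddLeftInvariant] (L : AddSubgroup V)
    [Countable L] {D : Set V} (hD : IsAddFundamentalDomain L D μ) {S : Set V}
    (hS : MeasurableSet S) :
    μ S = ∫⁻ x in D, (({g : L | (g : V) + x ∈ S}.encard : ENat) : ENNReal) ∂μ := by
  rw [← lintegral_indicator_one hS, hD.lintegral_eq_tsum'', ← lintegral_tsum]
  · refine lintegral_congr fun x => ?_
    rw [← ENNReal.tsum_set_one, tsum_subtype {g : L | (g : V) + x ∈ S} (fun _ => (1 : ENNReal))]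
    refine tsum_congr fun g => ?_
    by_cases h : (g : V) + x ∈ S
    · simp [Set.indicator, AddSubgroup.vadd_def, h]
    · simp [Set.indicator, AddSubgroup.vadd_def, h]
  · intro g
    refine Measurable.aemeasurable ?_
    exact (measurable_one.indicator hS).comp (measurable_const_add (g : V))

/-- Write `x = l + p` with `l ∈ L` and `p ∈ P`. Then `g ↦ g - l` injects the lattice points of `S`
into the translates of `x` that lie in `T`; integrate over `D`. -/
theorem measure_mul_encard_le {μ : Measure V} [μ.IsAddLeftInvariant] (L : AddSubgroup V)
    [Countable L] {D : Set V} (hD : IsAddFundamentalDomain L D μ) {S T P : Set V}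
    (hT : MeasurableSet T) (hP : ∀ x, ∃ l ∈ L, x - l ∈ P) (h : ∀ s ∈ S, ∀ p ∈ P, s + p ∈ T) :
    μ D * (({g : L | (g : V) ∈ S}.encard : ENat) : ENNReal) ≤ μ T := by
  rw [measure_eq_lintegral_encard L hD hT, mul_comm, ← setLIntegral_const]
  refine lintegral_mono fun x => ?_
  obtain ⟨l, hl, hx⟩ := hP x
  rw [ENat.toENNReal_le]
  refine Set.encard_le_encard_of_injOn (f := fun g => g - ⟨l, hl⟩) ?_ ?_
  · intro g hg
    have := h _ hg _ hx
    simp only [Set.mem_ofPred_eq, AddSubgroup.coe_sub]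
    convert! this using 1
    abel
  · intro a _ b _ hab
    simpa using hab

theorem measure_le_measure_mul_encard {μ : Measure V} [μ.IsAddLeftInvariant] (L : AddSubgroup V)
    [Countable L] {D : Set V} (hD : IsAddFundamentalDomain L D μ) {S T P : Set V}
    (hT : MeasurableSet T) (hP : ∀ x, ∃ l ∈ L, x - l ∈ P) (h : ∀ s ∈ T, ∀ p ∈ P, s - p ∈ S) :
    μ T ≤ μ D * (({g : L | (g : V) ∈ S}.encard : ENat) : ENNReal) := by
  rw [measure_eq_lintegral_encard L hD hT, mul_comm, ← setLIntegral_const]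
  refine lintegral_mono fun x => ?_
  obtain ⟨l, hl, hx⟩ := hP x
  rw [ENat.toENNReal_le]
  refine Set.encard_le_encard_of_injOn (f := fun g => g + ⟨l, hl⟩) ?_ ?_
  · intro g hg
    have := h _ hg _ hx
    simp only [Set.mem_ofPred_eq, AddSubgroup.coe_add]
    convert! this using 1
    abel
  · intro a _ b _ hab
    simpa using hab

end Translates

/-! ### Elements of fractional ideals in boxes. -/

section IdealBox

open InfinitePlace Module

variable {K : Type*} [Field K] [NumberField K]

theorem idealNorm_pos (I : (FractionalIdeal (𝓞 K)⁰ K)ˣ) : 0 < idealNorm (I : FractionalIdeal (𝓞 K)⁰ K) := by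
  have h : FractionalIdeal.absNorm (I : FractionalIdeal (𝓞 K)⁰ K) ≠ 0 := by
    rw [Ne, FractionalIdeal.absNorm_eq_zero_iff]
    exact I.ne_zero
  have := (FractionalIdeal.absNorm_nonneg (I : FractionalIdeal (𝓞 K)⁰ K)).lt_of_ne' h
  unfold idealNorm
  exact_mod_cast this

/-- The ideal `x I⁻¹` is integral and nonzero, so its norm is at least one. -/
theorem idealNorm_le_abs_norm (I : (FractionalIdeal (𝓞 K)⁰ K)ˣ) {x : K}
    (hx : x ∈ (I : FractionalIdeal (𝓞 K)⁰ K)) (h0 : x ≠ 0) :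
    idealNorm (I : FractionalIdeal (𝓞 K)⁰ K) ≤ |Algebra.norm ℚ x| := by
  set J : FractionalIdeal (𝓞 K)⁰ K :=
    FractionalIdeal.spanSingleton (𝓞 K)⁰ x * ((I⁻¹ : (FractionalIdeal (𝓞 K)⁰ K)ˣ) : FractionalIdeal (𝓞 K)⁰ K)
    with hJ
  have hJI : J * I = FractionalIdeal.spanSingleton (𝓞 K)⁰ x := by
    rw [hJ, mul_assoc, Units.inv_mul, mul_one]
  have hJ1 : J ≤ 1 := by
    have : FractionalIdeal.spanSingleton (𝓞 K)⁰ x ≤ (I : FractionalIdeal (𝓞 K)⁰ K) :=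
      FractionalIdeal.spanSingleton_le_iff_mem.2 hx
    calc J ≤ (I : FractionalIdeal (𝓞 K)⁰ K) * ((I⁻¹ : (FractionalIdeal (𝓞 K)⁰ K)ˣ) : FractionalIdeal (𝓞 K)⁰ K) := by
          rw [hJ]; gcongr
      _ = 1 := Units.mul_inv I
  obtain ⟨A, hA⟩ := FractionalIdeal.le_one_iff_exists_coeIdeal.1 hJ1
  have hne : FractionalIdeal.absNorm (FractionalIdeal.spanSingleton (𝓞 K)⁰ x) ≠ 0 := by
    rw [Ne, FractionalIdeal.absNorm_eq_zero_iff, FractionalIdeal.spanSingleton_eq_zero_iff]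
    exact h0
  have hmul : FractionalIdeal.absNorm J * FractionalIdeal.absNorm (I : FractionalIdeal (𝓞 K)⁰ K)
      = |Algebra.norm ℚ x| := by
    rw [← map_mul, hJI, FractionalIdeal.absNorm_span_singleton]
  have hone : 1 ≤ FractionalIdeal.absNorm J := by
    rw [← hA, FractionalIdeal.coeIdeal_absNorm]
    have : Ideal.absNorm A ≠ 0 := by
      intro h
      rw [← hJI, map_mul, ← hA, FractionalIdeal.coeIdeal_absNorm, h] at hne
      simp at hne
    exact_mod_cast Nat.one_le_iff_ne_zero.2 this
  have : FractionalIdeal.absNorm (I : FractionalIdeal (𝓞 K)⁰ K) ≤ |Algebra.norm ℚ x| := by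
    rw [← hmul]
    exact le_mul_of_one_le_left (FractionalIdeal.absNorm_nonneg _) hone
  unfold idealNorm
  exact_mod_cast this

/-- The nonzero elements of a fractional ideal in a box. -/
def idealBox (I : (FractionalIdeal (𝓞 K)⁰ K)ˣ) (b : InfinitePlace K → ℝ) : Set K :=
  {x | x ∈ (I : FractionalIdeal (𝓞 K)⁰ K) ∧ x ≠ 0 ∧ ∀ w, w x ≤ b w}

theorem idealBox_eq_empty (I : (FractionalIdeal (𝓞 K)⁰ K)ˣ) {b : InfinitePlace K → ℝ}
    (h : ∏ w, b w ^ mult w < idealNorm (I : FractionalIdeal (𝓞 K)⁰ K)) : idealBox I b = ∅ := by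
  refine Set.eq_empty_of_forall_notMem fun x ⟨hx, h0, hb⟩ => ?_
  have h1 := idealNorm_le_abs_norm I hx h0
  rw [← prod_eq_abs_norm] at h1
  have : ∏ w : InfinitePlace K, w x ^ mult w ≤ ∏ w, b w ^ mult w := by
    gcongr with w _
    exact hb w
  linarith

open MeasureTheory in
open scoped Classical in
theorem exists_bound_fundamentalDomain_latticeBasis : ∃ r : ℝ, 0 < r ∧ ∀ x : mixedEmbedding.mixedSpace K,
    ∃ o : 𝓞 K, ∀ w, mixedEmbedding.normAtPlace w (x - mixedEmbedding K o) ≤ r := by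
  obtain ⟨r, hr0, hr⟩ := (ZSpan.fundamentalDomain_isBounded
    (mixedEmbedding.latticeBasis K)).exists_pos_norm_le
  refine ⟨r, hr0, fun x => ?_⟩
  have hm := (ZSpan.floor (mixedEmbedding.latticeBasis K) x).2
  rw [mixedEmbedding.mem_span_latticeBasis] at hm
  obtain ⟨o, ho⟩ := hm
  refine ⟨o, fun w => ?_⟩
  have h1 := hr _ (ZSpan.fract_mem_fundamentalDomain (mixedEmbedding.latticeBasis K) x)
  have h2 : ZSpan.fract (mixedEmbedding.latticeBasis K) x = x - mixedEmbedding K o := by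
    rw [ZSpan.fract_apply, ← ho]; rfl
  rw [← h2]
  refine le_trans ?_ h1
  rw [mixedEmbedding.norm_eq_sup'_normAtPlace]
  exact Finset.le_sup' (fun w => mixedEmbedding.normAtPlace w _) (Finset.mem_univ w)

/-- Minkowski's theorem provides a nonzero `α ∈ I` with `w α < t * b w`. As `α 𝓞_K ⊆ I`, rounding
`α⁻¹ x` to `𝓞_K` and multiplying back by `α` turns the covering radius `r` of `𝓞_K` into bounds
proportional to `b`. This is what makes the later counts uniform in the shape of the box. -/
theorem exists_translate_small :
    ∃ C : ℝ, 0 < C ∧ ∀ (I : (FractionalIdeal (𝓞 K)⁰ K)ˣ) (b : InfinitePlace K → ℝ),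
      (∀ w, 0 < b w) → ∀ x : mixedEmbedding.mixedSpace K,
      ∃ a ∈ (I : FractionalIdeal (𝓞 K)⁰ K), ∀ w, mixedEmbedding.normAtPlace w (x - mixedEmbedding K a) <
        C * ((∏ w, b w ^ mult w) / idealNorm (I : FractionalIdeal (𝓞 K)⁰ K)) ^
          (-(1 / (finrank ℚ K : ℝ))) * b w := by
  classical
  obtain ⟨r, hr0, hr⟩ := exists_bound_fundamentalDomain_latticeBasis (K := K)
  set d := finrank ℚ K with hd
  have hd0 : d ≠ 0 := finrank_pos.ne'
  set M : ℝ := (MeasureTheory.volume (ZSpan.fundamentalDomain (mixedEmbedding.latticeBasis K))).toReal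
    * 2 ^ (finrank ℝ (mixedEmbedding.mixedSpace K)) with hM
  have hM0 : 0 ≤ M := by positivity
  refine ⟨(M + 1) * r, by positivity, fun I b hb x => ?_⟩
  have hN := idealNorm_pos I
  set N := idealNorm (I : FractionalIdeal (𝓞 K)⁰ K) with hNdef
  set X := ∏ w, b w ^ mult w with hX
  have hX0 : 0 < X := Finset.prod_pos fun w _ => pow_pos (hb w) _
  -- Chosen so that `t ^ d * X = (M + 1) ^ d * N`, which exceeds the Minkowski bound `M * N`.
  set t := (M + 1) * (X / N) ^ (-(1 / (d : ℝ))) with ht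
  have ht0 : 0 < t := by positivity
  have htd : t ^ d * X = (M + 1) ^ d * N := by
    rw [ht, mul_pow, ← Real.rpow_natCast ((X / N) ^ (-(1 / (d : ℝ)))), ← Real.rpow_mul (by positivity)]
    have : -(1 / (d : ℝ)) * d = -1 := by field_simp
    rw [this, Real.rpow_neg_one]
    field_simp
  have hlt : mixedEmbedding.minkowskiBound K I <
      MeasureTheory.volume (mixedEmbedding.convexBodyLT K fun w => Real.toNNReal (t * b w)) := by
    rw [mixedEmbedding.convexBodyLT_volume]
    have hprod : ((∏ w, Real.toNNReal (t * b w) ^ mult w : NNReal) : ENNReal)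
        = ENNReal.ofReal (t ^ d * X) := by
      rw [ENNReal.ofReal, ENNReal.coe_inj]
      ext
      rw [Real.coe_toNNReal _ (by positivity)]
      have hc : ∀ w, ((Real.toNNReal (t * b w) : NNReal) : ℝ) = t * b w := fun w =>
        Real.coe_toNNReal _ (mul_pos ht0 (hb w)).le
      simp only [NNReal.coe_prod, NNReal.coe_pow, hc]
      simp_rw [mul_pow]
      rw [Finset.prod_mul_distrib, Finset.prod_pow_eq_pow_sum, sum_mult_eq]
    rw [hprod, htd]
    calc mixedEmbedding.minkowskiBound K I = ENNReal.ofReal (M * N) := by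
          rw [mixedEmbedding.minkowskiBound,
            mixedEmbedding.volume_fundamentalDomain_fractionalIdealLatticeBasis, hM,
            ENNReal.ofReal_mul (by positivity), ENNReal.ofReal_mul (by positivity),
            ENNReal.ofReal_toReal (ZSpan.fundamentalDomain_isBounded _).measure_lt_top.ne,
            ENNReal.ofReal_pow (by norm_num), hNdef, idealNorm]
          simp only [ENNReal.ofReal_ofNat]
          ring_nf
      _ < ENNReal.ofReal ((M + 1) ^ d * N) := by
          rw [ENNReal.ofReal_lt_ofReal_iff (by positivity)]
          gcongr
          calc M < M + 1 := by linarith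
            _ ≤ (M + 1) ^ d := le_self_pow₀ (by linarith) hd0
      _ ≤ _ := by
          refine le_mul_of_one_le_left (zero_le) ?_
          exact_mod_cast mixedEmbedding.one_le_convexBodyLTFactor K
  obtain ⟨α, hα, hα0, hαb⟩ := mixedEmbedding.exists_ne_zero_mem_ideal_lt K I hlt
  obtain ⟨o, ho⟩ := hr (mixedEmbedding K α⁻¹ * x)
  refine ⟨o • α, ?_, fun w => ?_⟩
  · exact (I : FractionalIdeal (𝓞 K)⁰ K).1.smul_mem o hα
  · have h1 : x - mixedEmbedding K (o • α) =
        mixedEmbedding K α * (mixedEmbedding K α⁻¹ * x - mixedEmbedding K o) := by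
      rw [mul_sub, ← mul_assoc, ← map_mul, mul_inv_cancel₀ hα0, map_one, one_mul, ← map_mul,
        Algebra.smul_def, mul_comm α]
    rw [h1, map_mul, mixedEmbedding.normAtPlace_apply]
    have h2 := ho w
    have h3 : w α < t * b w := by
      have := hαb w
      rwa [Real.coe_toNNReal _ (mul_pos ht0 (hb w)).le] at this
    have h4 := mixedEmbedding.normAtPlace_nonneg w (mixedEmbedding K α⁻¹ * x - mixedEmbedding K o)
    calc w α * _ ≤ w α * r := by gcongr
      _ < t * b w * r := by gcongr
      _ = _ := by rw [ht]; ring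

open MeasureTheory in
-- The summand `1` is the zero vector, which `idealBox` leaves out.
theorem encard_lattice_box (I : (FractionalIdeal (𝓞 K)⁰ K)ˣ) {b : InfinitePlace K → ℝ}
    (hb : ∀ w, 0 ≤ b w) :
    ({g : (mixedEmbedding.idealLattice K I).toAddSubgroup |
      (g : mixedEmbedding.mixedSpace K) ∈ {x | ∀ w, mixedEmbedding.normAtPlace w x ≤ b w}}).encard
      = (idealBox I b).encard + 1 := by
  have h0 : (0 : K) ∉ idealBox I b := fun h => h.2.1 rfl
  rw [← Set.encard_insert_of_notMem h0]
  symm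
  refine Set.encard_congr ⟨fun x => ⟨⟨mixedEmbedding K x, ?_⟩, ?_⟩, fun g => ⟨(
    (mixedEmbedding.mem_idealLattice K I).1 g.1.2).choose, ?_⟩, ?_, ?_⟩
  · refine (mixedEmbedding.mem_idealLattice K I).2 ⟨x, ?_, rfl⟩
    rcases x.2 with h | h
    · rw [h]; exact (I : FractionalIdeal (𝓞 K)⁰ K).1.zero_mem
    · exact h.1
  · intro w
    rcases x.2 with h | h
    · simpa [h] using hb w
    · simpa using h.2.2 w
  · have := ((mixedEmbedding.mem_idealLattice K I).1 g.1.2).choose_spec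
    set y := ((mixedEmbedding.mem_idealLattice K I).1 g.1.2).choose
    by_cases hy : y = 0
    · exact Or.inl hy
    · refine Or.inr ⟨this.1, hy, fun w => ?_⟩
      have h2 := g.2 w
      rwa [← this.2, mixedEmbedding.normAtPlace_apply] at h2
  · intro x
    ext
    apply mixedEmbedding_injective K
    exact (Exists.choose_spec (p := fun y => y ∈ (I : Set K) ∧ mixedEmbedding K y = mixedEmbedding K x) _).2
  · intro g
    ext1; ext1
    exact ((mixedEmbedding.mem_idealLattice K I).1 g.1.2).choose_spec.2

/-- The ratio of the volume of the unit box and the covolume of the ring of integers. -/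
noncomputable def boxConst (K : Type*) [Field K] [NumberField K] : ℝ :=
  (2 : ℝ) ^ nrRealPlaces K * (2 * Real.pi) ^ nrComplexPlaces K / Real.sqrt |(discr K : ℝ)|

theorem boxConst_pos : 0 < boxConst K := by
  have : (discr K : ℝ) ≠ 0 := by exact_mod_cast discr_ne_zero K
  unfold boxConst
  positivity

theorem mem_convexBodyLT_iff {f : InfinitePlace K → NNReal} {x : mixedEmbedding.mixedSpace K} :
    x ∈ mixedEmbedding.convexBodyLT K f ↔ ∀ w, mixedEmbedding.normAtPlace w x < f w := by
  simp only [Set.mem_prod, Set.mem_pi, Set.mem_univ, mem_ball_zero_iff, forall_true_left]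
  constructor
  · rintro ⟨h1, h2⟩ w
    rcases w.isReal_or_isComplex with hw | hw
    · rw [mixedEmbedding.normAtPlace_apply_of_isReal hw]; exact h1 ⟨w, hw⟩
    · rw [mixedEmbedding.normAtPlace_apply_of_isComplex hw]; exact h2 ⟨w, hw⟩
  · intro h
    refine ⟨fun w => ?_, fun w => ?_⟩
    · rw [← mixedEmbedding.normAtPlace_apply_of_isReal w.2]; exact h w
    · rw [← mixedEmbedding.normAtPlace_apply_of_isComplex w.2]; exact h w

open scoped Classical in
open MeasureTheory in
theorem volume_convexBodyLT_smul {b : InfinitePlace K → ℝ} (hb : ∀ w, 0 < b w) {t : ℝ} (ht : 0 ≤ t) :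
    volume (mixedEmbedding.convexBodyLT K fun w => Real.toNNReal (t * b w)) =
      ENNReal.ofReal ((2 : ℝ) ^ nrRealPlaces K * Real.pi ^ nrComplexPlaces K *
        (t ^ finrank ℚ K * ∏ w, b w ^ mult w)) := by
  rw [mixedEmbedding.convexBodyLT_volume, ENNReal.ofReal, ← ENNReal.coe_mul, ENNReal.coe_inj]
  have hX0 : 0 < ∏ w, b w ^ mult w := Finset.prod_pos fun w _ => pow_pos (hb w) _
  ext
  have hpos : 0 ≤ (2 : ℝ) ^ nrRealPlaces K * Real.pi ^ nrComplexPlaces K *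
      (t ^ finrank ℚ K * ∏ w, b w ^ mult w) :=
    mul_nonneg (by positivity) (mul_nonneg (by positivity) hX0.le)
  rw [Real.coe_toNNReal _ hpos]
  have hc : ∀ w, ((Real.toNNReal (t * b w) : NNReal) : ℝ) = t * b w := fun w =>
    Real.coe_toNNReal _ (mul_nonneg ht (hb w).le)
  simp only [NNReal.coe_mul, NNReal.coe_prod, NNReal.coe_pow, hc, NNReal.coe_real_pi, NNReal.coe_ofNat]
  simp_rw [mul_pow]
  rw [Finset.prod_mul_distrib, Finset.prod_pow_eq_pow_sum, sum_mult_eq]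

theorem one_add_pow_sub_one_le {e c : ℝ} (he : 0 ≤ e) (hc : e ≤ c) (d : ℕ) :
    (1 + e) ^ d - 1 ≤ e * (d * (1 + c) ^ d) := by
  have hc0 : 0 ≤ 1 + c := by linarith
  induction d with
  | zero => simp
  | succ n ih =>
    have h1 : (1 + e) ^ n ≤ (1 + c) ^ n := by gcongr
    have h2 : (1 + c) ^ n ≤ (1 + c) ^ (n + 1) := pow_le_pow_right₀ (by linarith) (by omega)
    have h3 : 0 ≤ (1 + c) ^ n := by positivity
    calc (1 + e) ^ (n + 1) - 1 = ((1 + e) ^ n - 1) + e * (1 + e) ^ n := by ring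
      _ ≤ e * (n * (1 + c) ^ n) + e * (1 + c) ^ (n + 1) := by gcongr; linarith
      _ ≤ e * (n * (1 + c) ^ (n + 1)) + e * (1 + c) ^ (n + 1) := by gcongr
      _ = _ := by push_cast; ring

open scoped Classical in
open MeasureTheory in
-- By the covering hypothesis the number of lattice points in the box `b`, times the covolume, lies
-- between the volumes of the boxes `(1 - e) b` and `(1 + e) b`.
theorem idealBox_bounds (I : (FractionalIdeal (𝓞 K)⁰ K)ˣ) {b : InfinitePlace K → ℝ}
    (hb : ∀ w, 0 < b w) {e : ℝ} (he : 0 ≤ e)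
    (h : ∀ x : mixedEmbedding.mixedSpace K, ∃ a ∈ (I : FractionalIdeal (𝓞 K)⁰ K),
      ∀ w, mixedEmbedding.normAtPlace w (x - mixedEmbedding K a) < e * b w) :
    (idealBox I b).Finite ∧
    ((idealBox I b).ncard : ℝ) + 1 ≤ boxConst K * (1 + e) ^ finrank ℚ K *
      ((∏ w, b w ^ mult w) / idealNorm (I : FractionalIdeal (𝓞 K)⁰ K)) ∧
    (e ≤ 1 → boxConst K * (1 - e) ^ finrank ℚ K *
      ((∏ w, b w ^ mult w) / idealNorm (I : FractionalIdeal (𝓞 K)⁰ K)) ≤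
      ((idealBox I b).ncard : ℝ) + 1) := by
  have hN := idealNorm_pos I
  set N := idealNorm (I : FractionalIdeal (𝓞 K)⁰ K) with hNdef
  set X := ∏ w, b w ^ mult w with hX
  have hX0 : 0 < X := Finset.prod_pos fun w _ => pow_pos (hb w) _
  set L := (mixedEmbedding.idealLattice K I).toAddSubgroup with hL
  have : Countable L := inferInstanceAs (Countable (mixedEmbedding.idealLattice K I))
  have hDfund : IsAddFundamentalDomain L
      (ZSpan.fundamentalDomain (mixedEmbedding.fractionalIdealLatticeBasis K I)) volume :=
    mixedEmbedding.fundamentalDomain_idealLattice K I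
  set D := ZSpan.fundamentalDomain (mixedEmbedding.fractionalIdealLatticeBasis K I) with hD
  set c0 : ℝ := (2⁻¹) ^ nrComplexPlaces K * √|discr K| with hc0
  have hdisc : (discr K : ℝ) ≠ 0 := by exact_mod_cast discr_ne_zero K
  have hc0pos : 0 < c0 := by positivity
  have hvolD : volume D = ENNReal.ofReal (N * c0) := by
    have h1 := mixedEmbedding.covolume_idealLattice K I
    rw [ZLattice.covolume_eq_measure_fundamentalDomain _ _
      (mixedEmbedding.fundamentalDomain_idealLattice K I), measureReal_def, mul_assoc] at h1
    rw [← ENNReal.ofReal_toReal (ZSpan.fundamentalDomain_isBounded _).measure_lt_top.ne, h1]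
    rfl
  set P : Set (mixedEmbedding.mixedSpace K) := {p | ∀ w, mixedEmbedding.normAtPlace w p < e * b w} with hP
  have hPcov : ∀ x, ∃ l ∈ L, x - l ∈ P := by
    intro x
    obtain ⟨a, ha, hx⟩ := h x
    exact ⟨_, (mixedEmbedding.mem_idealLattice K I).2 ⟨a, ha, rfl⟩, hx⟩
  have hmeas : ∀ f : InfinitePlace K → NNReal, MeasurableSet (mixedEmbedding.convexBodyLT K f) := by
    intro f
    refine MeasurableSet.prod ?_ ?_ <;>
    exact MeasurableSet.univ_pi fun w => measurableSet_ball
  set v0 : ℝ := (2 : ℝ) ^ nrRealPlaces K * Real.pi ^ nrComplexPlaces K with hv0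
  have hv0pos : 0 < v0 := by positivity
  have hvc : boxConst K = v0 / c0 := by
    rw [boxConst, hv0, hc0, mul_pow, inv_pow]
    field_simp
  have upper := measure_mul_encard_le L hDfund (S := {x | ∀ w, mixedEmbedding.normAtPlace w x ≤ b w})
    (hmeas fun w => Real.toNNReal ((1 + e) * b w)) hPcov (by
      intro s hs p hp
      rw [mem_convexBodyLT_iff]
      intro w
      rw [Real.coe_toNNReal _ (by have := hb w; positivity)]
      have h1 := mixedEmbedding.normAtPlace_add_le w s p
      have h2 := hs w
      have h3 := hp w
      linarith)
  rw [encard_lattice_box I fun w => (hb w).le, hvolD, volume_convexBodyLT_smul hb (by positivity)] at upper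
  have hfin : (idealBox I b).Finite := by
    rw [← Set.encard_ne_top_iff]
    intro htop
    rw [htop, top_add, ENat.toENNReal_top, ENNReal.mul_top (by positivity)] at upper
    exact absurd upper (by simp)
  have hcast : (((idealBox I b).encard + 1 : ENat) : ENNReal) =
      ENNReal.ofReal (((idealBox I b).ncard : ℝ) + 1) := by
    rw [← hfin.cast_ncard_eq, ENNReal.ofReal_add (by positivity) (by positivity)]
    simp
  rw [hcast, ← ENNReal.ofReal_mul (by positivity), ENNReal.ofReal_le_ofReal_iff (by positivity)] at upper
  refine ⟨hfin, ?_, fun he1 => ?_⟩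
  · rw [hvc]
    calc ((idealBox I b).ncard : ℝ) + 1 = (N * c0 * (((idealBox I b).ncard : ℝ) + 1)) / (N * c0) := by
          field_simp
      _ ≤ v0 * ((1 + e) ^ finrank ℚ K * X) / (N * c0) := by gcongr
      _ = _ := by field_simp
  · have lower := measure_le_measure_mul_encard L hDfund
      (S := {x | ∀ w, mixedEmbedding.normAtPlace w x ≤ b w})
      (hmeas fun w => Real.toNNReal ((1 - e) * b w)) hPcov (by
        intro s hs p hp w
        rw [mem_convexBodyLT_iff] at hs
        have h2 := hs w
        rw [Real.coe_toNNReal _ (mul_nonneg (by linarith) (hb w).le)] at h2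
        have h1 := mixedEmbedding.normAtPlace_add_le w s (-p)
        rw [mixedEmbedding.normAtPlace_neg, ← sub_eq_add_neg] at h1
        have h3 := hp w
        linarith)
    rw [encard_lattice_box I fun w => (hb w).le, hvolD, volume_convexBodyLT_smul hb (by linarith), hcast,
      ← ENNReal.ofReal_mul (by positivity), ENNReal.ofReal_le_ofReal_iff (by positivity)] at lower
    rw [hvc]
    calc _ = v0 * ((1 - e) ^ finrank ℚ K * X) / (N * c0) := by field_simp
      _ ≤ (N * c0 * (((idealBox I b).ncard : ℝ) + 1)) / (N * c0) := by gcongr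
      _ = _ := by field_simp

theorem idealBox_finite (I : (FractionalIdeal (𝓞 K)⁰ K)ˣ) {b : InfinitePlace K → ℝ}
    (hb : ∀ w, 0 < b w) : (idealBox I b).Finite := by
  classical
  obtain ⟨C, hC, h⟩ := exists_translate_small (K := K)
  have hX0 : 0 < ∏ w, b w ^ mult w := Finset.prod_pos fun w _ => pow_pos (hb w) _
  have hN := idealNorm_pos I
  exact (idealBox_bounds I hb (by positivity) (h I b hb)).1

variable (K) in
-- Here `e = C ρ^(-1/d)` in `idealBox_bounds`. If `ρ < 1`, the box is empty and `ρ` itself is below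
-- the error; if `ρ ≥ 1`, then `e` is bounded and `(1 ± e)^d = 1 + O(e)`.
theorem exists_idealBox_estimate :
    ∃ C : ℝ, 0 < C ∧ ∀ (I : (FractionalIdeal (𝓞 K)⁰ K)ˣ) (b : InfinitePlace K → ℝ),
      (∀ w, 0 < b w) →
      |((idealBox I b).ncard : ℝ) -
        boxConst K * ((∏ w, b w ^ mult w) / idealNorm (I : FractionalIdeal (𝓞 K)⁰ K))| ≤
      C * ((∏ w, b w ^ mult w) / idealNorm (I : FractionalIdeal (𝓞 K)⁰ K)) ^
        (1 - 1 / (finrank ℚ K : ℝ)) := by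
  classical
  obtain ⟨C, hC, h⟩ := exists_translate_small (K := K)
  set d := finrank ℚ K with hd
  have hd0 : 0 < d := finrank_pos
  have hd1 : (1 : ℝ) ≤ d := by exact_mod_cast hd0
  have hv := boxConst_pos (K := K)
  refine ⟨boxConst K * (C * (d * (1 + C) ^ d)) + 1 + boxConst K * (d * C) + boxConst K, by positivity, fun I b hb => ?_⟩
  have hX0 : 0 < ∏ w, b w ^ mult w := Finset.prod_pos fun w _ => pow_pos (hb w) _
  have hN := idealNorm_pos I
  have hbd := idealBox_bounds I hb (e := C * ((∏ w, b w ^ mult w) / idealNorm (I : FractionalIdeal (𝓞 K)⁰ K)) ^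
          (-(1 / (finrank ℚ K : ℝ)))) (by positivity) (h I b hb)
  have hemp := idealBox_eq_empty I (b := b)
  set ρ := (∏ w, b w ^ mult w) / idealNorm (I : FractionalIdeal (𝓞 K)⁰ K) with hρ
  have hρ0 : 0 < ρ := by positivity
  rw [← hd] at hbd
  obtain ⟨-, h1, h2⟩ := hbd
  set n : ℝ := ((idealBox I b).ncard : ℝ) with hn
  have hn0 : 0 ≤ n := by positivity
  have hexp : 0 ≤ 1 - 1 / (d : ℝ) := by
    rw [sub_nonneg, div_le_one (by linarith)]; exact hd1
  have hp0 : 0 < ρ ^ (1 - 1 / (d : ℝ)) := by positivity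
  have hsplit : ρ ^ (1 - 1 / (d : ℝ)) = ρ ^ (-(1 / (d : ℝ))) * ρ := by
    rw [← Real.rpow_add_one hρ0.ne']; ring_nf
  rcases lt_or_ge ρ 1 with hlt | hge
  · have h0 : n = 0 := by
      rw [hn, hemp, Set.ncard_empty, Nat.cast_zero]
      rwa [hρ, div_lt_one hN] at hlt
    rw [h0, zero_sub, abs_neg, abs_of_pos (by positivity)]
    have : ρ ≤ ρ ^ (1 - 1 / (d : ℝ)) := by
      conv_lhs => rw [← Real.rpow_one ρ]
      exact Real.rpow_le_rpow_of_exponent_ge hρ0 hlt.le (by simp)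
    have h3 : boxConst K * ρ ≤ boxConst K * ρ ^ (1 - 1 / (d : ℝ)) := by gcongr
    have h4 : 0 ≤ (boxConst K * (C * (d * (1 + C) ^ d)) + 1 + boxConst K * (d * C)) * ρ ^ (1 - 1 / (d : ℝ)) := by
      positivity
    linarith
  · set η := ρ ^ (-(1 / (d : ℝ))) with hη
    have hη0 : 0 < η := by positivity
    have hη1 : η ≤ 1 := Real.rpow_le_one_of_one_le_of_nonpos hge (by
      rw [neg_nonpos]; positivity)
    have hone : 1 ≤ ρ ^ (1 - 1 / (d : ℝ)) := Real.one_le_rpow hge hexp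
    have hCη : C * η ≤ C := by nlinarith
    have h5 := one_add_pow_sub_one_le (e := C * η) (by positivity) hCη d
    have hlow : boxConst K * ρ - n ≤ (1 + boxConst K * (d * C)) * (η * ρ) := by
      rcases le_or_gt (C * η) 1 with hle | hgt
      · have h6 := h2 hle
        have h7 := one_add_mul_le_pow (a := -(C * η)) (by linarith) d
        have h8 : boxConst K * (1 + d * -(C * η)) * ρ ≤ boxConst K * (1 - C * η) ^ d * ρ := by
          have : 1 - C * η = 1 + -(C * η) := by ring
          rw [this]; gcongr
        rw [hsplit] at hone
        linarith
      -- When `C * η` exceeds one, the main term is itself no larger than the error, and no lower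
      -- bound is needed.
      · have : 1 ≤ d * (C * η) := by nlinarith
        have : boxConst K * ρ ≤ boxConst K * (d * C) * (η * ρ) := by
          calc boxConst K * ρ = boxConst K * ρ * 1 := by ring
            _ ≤ boxConst K * ρ * (d * (C * η)) := by gcongr
            _ = _ := by ring
        have : 0 ≤ η * ρ := by positivity
        nlinarith
    have hup : n - boxConst K * ρ ≤ boxConst K * (C * (d * (1 + C) ^ d)) * (η * ρ) := by
      have : boxConst K * ρ * ((1 + C * η) ^ d - 1) ≤ boxConst K * ρ * (C * η * (d * (1 + C) ^ d)) := by
        gcongr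
      nlinarith
    rw [hsplit, abs_le]
    have e1 : 0 ≤ boxConst K * (C * (d * (1 + C) ^ d)) * (η * ρ) := by positivity
    have e2 : 0 ≤ (1 + boxConst K * (d * C)) * (η * ρ) := by positivity
    have e3 : 0 ≤ boxConst K * (η * ρ) := by positivity
    constructor <;> nlinarith

end IdealBox
end CubicTorsor

namespace CubicTorsor

/-! ### Fundamental units and the logarithmic lattice. -/

section UnitGroup

open scoped Classical

open InfinitePlace Module Units dirichletUnitTheorem

variable {K : Type*} [Field K] [NumberField K]

/-- The logarithmic embedding of `Kˣ`. -/
noncomputable def logAt (y : Kˣ) : logSpace K := fun w => mult w.1 * Real.log (w.1 (y : K))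

theorem place_pos (w : InfinitePlace K) (y : Kˣ) : 0 < w (y : K) :=
  pos_iff.2 y.ne_zero

/-- The unit of a number field defined by a unit of the ring of integers. -/
noncomputable def toFieldUnit : (𝓞 K)ˣ →* Kˣ := Units.map (algebraMap (𝓞 K) K : 𝓞 K →* K)

theorem coe_toFieldUnit (x : (𝓞 K)ˣ) : ((toFieldUnit x : Kˣ) : K) = (x : K) := rfl

theorem toFieldUnit_injective : Function.Injective (toFieldUnit (K := K)) := by
  intro x y h
  ext
  have := congrArg (fun z : Kˣ => (z : K)) h
  simpa [coe_toFieldUnit] using this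

theorem logAt_toFieldUnit (x : (𝓞 K)ˣ) : logAt (toFieldUnit x) = logEmbedding K (Additive.ofMul x) := by
  ext w
  simp [logAt, logEmbedding_component, coe_toFieldUnit]

/-- A group of units that the logarithmic embedding maps isomorphically to the unit lattice. -/
structure IsUnitComplement (F : Subgroup Kˣ) : Prop where
  exists_unit : ∀ ζ ∈ F, ∃ x : (𝓞 K)ˣ, ζ = toFieldUnit x
  existsUnique_log : ∀ l ∈ unitLattice K, ∃! ζ : Kˣ, ζ ∈ F ∧ logAt ζ = l

theorem IsUnitComplement.prod_eq_one {F : Subgroup Kˣ} (hF : IsUnitComplement F) {ζ : Kˣ}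
    (hζ : ζ ∈ F) : ∏ w : InfinitePlace K, w (ζ : K) ^ mult w = 1 := by
  obtain ⟨x, rfl⟩ := hF.exists_unit ζ hζ
  rw [coe_toFieldUnit, prod_eq_abs_norm, Units.norm]
  simp

theorem IsUnitComplement.logAt_mem {F : Subgroup Kˣ} (hF : IsUnitComplement F) {ζ : Kˣ}
    (hζ : ζ ∈ F) : logAt ζ ∈ unitLattice K := by
  obtain ⟨x, rfl⟩ := hF.exists_unit ζ hζ
  rw [logAt_toFieldUnit]
  exact Submodule.mem_map.2 ⟨_, Submodule.mem_top, rfl⟩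

theorem IsUnitComplement.sum_logAt {F : Subgroup Kˣ} (hF : IsUnitComplement F) {ζ : Kˣ}
    (hζ : ζ ∈ F) : ∑ w, logAt ζ w = - (mult (w₀ : InfinitePlace K) * Real.log (w₀ (ζ : K))) := by
  obtain ⟨x, rfl⟩ := hF.exists_unit ζ hζ
  rw [logAt_toFieldUnit, sum_logEmbedding_component]
  simp [coe_toFieldUnit]

/-- The bijection of the group with the unit lattice. -/
noncomputable def IsUnitComplement.equiv {F : Subgroup Kˣ} (hF : IsUnitComplement F) :
    F ≃ unitLattice K :=
  Equiv.ofBijective (fun ζ => ⟨logAt ζ.1, hF.logAt_mem ζ.2⟩) <| by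
    constructor
    · intro a b hab
      have h : logAt a.1 = logAt b.1 := congrArg Subtype.val hab
      exact Subtype.ext ((hF.existsUnique_log _ (hF.logAt_mem b.2)).unique ⟨a.2, h⟩ ⟨b.2, rfl⟩)
    · intro l
      obtain ⟨ζ, ⟨hζ, h⟩, -⟩ := hF.existsUnique_log l.1 l.2
      exact ⟨⟨ζ, hζ⟩, Subtype.ext h⟩

/-- Monomials in a system of units. -/
noncomputable def unitMonomial (u : Fin (rank K) → (𝓞 K)ˣ) (e : Fin (rank K) → ℤ) : Kˣ :=
  toFieldUnit (∏ i, u i ^ e i)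

theorem unitMonomial_add (u : Fin (rank K) → (𝓞 K)ˣ) (e f : Fin (rank K) → ℤ) :
    unitMonomial u (e + f) = unitMonomial u e * unitMonomial u f := by
  simp only [unitMonomial, ← map_mul, ← Finset.prod_mul_distrib, Pi.add_apply, zpow_add]

theorem unitMonomial_zero (u : Fin (rank K) → (𝓞 K)ˣ) : unitMonomial u 0 = 1 := by
  simp [unitMonomial]

theorem unitMonomial_neg (u : Fin (rank K) → (𝓞 K)ˣ) (e : Fin (rank K) → ℤ) :
    unitMonomial u (-e) = (unitMonomial u e)⁻¹ := by
  rw [eq_inv_iff_mul_eq_one, ← unitMonomial_add, neg_add_cancel, unitMonomial_zero]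

theorem mem_generated_iff (u : Fin (rank K) → (𝓞 K)ˣ) {ζ : Kˣ} :
    ζ ∈ generated u ↔ ∃ e, ζ = unitMonomial u e := by
  constructor
  · intro h
    refine Subgroup.closure_induction (p := fun ζ _ => ∃ e, ζ = unitMonomial u e) ?_ ?_ ?_ ?_ h
    · rintro _ ⟨i, rfl⟩
      refine ⟨Pi.single i 1, ?_⟩
      rw [unitMonomial, Finset.prod_eq_single i]
      · simp [toFieldUnit]
      · intro j _ hj; simp [hj]
      · simp
    · exact ⟨0, (unitMonomial_zero u).symm⟩
    · rintro _ _ _ _ ⟨e, rfl⟩ ⟨f, rfl⟩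
      exact ⟨e + f, (unitMonomial_add u e f).symm⟩
    · rintro _ _ ⟨e, rfl⟩
      exact ⟨-e, (unitMonomial_neg u e).symm⟩
  · rintro ⟨e, rfl⟩
    rw [unitMonomial, map_prod]
    refine Subgroup.prod_mem _ fun i _ => ?_
    rw [map_zpow]
    exact Subgroup.zpow_mem _ (Subgroup.subset_closure (Set.mem_range_self i)) _

theorem IsFundamentalSystem.eq_of_torsion {u : Fin (rank K) → (𝓞 K)ˣ} (hu : IsFundamentalSystem u)
    {e f : Fin (rank K) → ℤ} {t : (𝓞 K)ˣ} (ht : t ∈ torsion K)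
    (h : ∏ i, u i ^ e i = t * ∏ i, u i ^ f i) : e = f := by
  have := (hu (∏ i, u i ^ e i)).unique (y₁ := (1, e)) (y₂ := (⟨t, ht⟩, f)) (by simp) h
  exact congrArg Prod.snd this

theorem IsFundamentalSystem.unitMonomial_injective {u : Fin (rank K) → (𝓞 K)ˣ}
    (hu : IsFundamentalSystem u) : Function.Injective (unitMonomial u) := by
  intro e f h
  refine hu.eq_of_torsion (one_mem _) ?_
  rw [one_mul]
  exact toFieldUnit_injective h

/-- Unique decomposition makes `generated u` a complement of the torsion, and the torsion is the
kernel of the logarithmic embedding. -/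
theorem IsFundamentalSystem.isUnitComplement {u : Fin (rank K) → (𝓞 K)ˣ}
    (hu : IsFundamentalSystem u) : IsUnitComplement (generated u) where
  exists_unit ζ hζ := by
    obtain ⟨e, rfl⟩ := (mem_generated_iff u).1 hζ
    exact ⟨_, rfl⟩
  existsUnique_log l hl := by
    obtain ⟨x, -, rfl⟩ := Submodule.mem_map.1 hl
    obtain ⟨⟨t, e⟩, hx, -⟩ := hu x.toMul
    have ht : logEmbedding K (Additive.ofMul (t : (𝓞 K)ˣ)) = 0 :=
      logEmbedding_eq_zero_iff.2 t.2
    have hlog : logEmbedding K x = logEmbedding K (Additive.ofMul (∏ i, u i ^ e i)) := by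
      have : x = Additive.ofMul (t : (𝓞 K)ˣ) + Additive.ofMul (∏ i, u i ^ e i) := by
        rw [← ofMul_mul]; exact congrArg Additive.ofMul hx
      rw [this, map_add, ht, zero_add]
    refine ⟨unitMonomial u e, ⟨(mem_generated_iff u).2 ⟨e, rfl⟩, ?_⟩, ?_⟩
    · rw [unitMonomial, logAt_toFieldUnit]; exact hlog.symm
    · rintro ζ ⟨hζ, h⟩
      obtain ⟨f, rfl⟩ := (mem_generated_iff u).1 hζ
      congr 1
      rw [unitMonomial, logAt_toFieldUnit] at h
      have h2 : (∏ i, u i ^ f i) * (∏ i, u i ^ e i)⁻¹ ∈ torsion K := by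
        rw [← logEmbedding_eq_zero_iff, ofMul_mul, map_add, ofMul_inv, map_neg, ← hlog]
        rw [h]; exact add_neg_cancel _
      exact hu.eq_of_torsion h2 (by simp)

end UnitGroup
end CubicTorsor

namespace CubicTorsor

/-! ### Inclusion-exclusion and perturbation of products. -/

section Combinatorics

/-- Expand the product of `1 - 1_{P i}` over `i` at each element of `T`. -/
theorem card_filter_forall_not_eq_sum {α ι : Type*} [Fintype ι] [DecidableEq ι] (T : Finset α)
    (P : ι → α → Prop) [∀ i, DecidablePred (P i)] :
    ((T.filter fun y => ∀ i, ¬ P i y).card : ℝ) =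
      ∑ I : Finset ι, (-1) ^ I.card * ((T.filter fun y => ∀ i ∈ I, P i y).card : ℝ) := by
  simp_rw [Finset.card_filter, Nat.cast_sum, Finset.mul_sum]
  rw [Finset.sum_comm]
  refine Finset.sum_congr rfl fun y _ => ?_
  have h1 : (((if ∀ i, ¬ P i y then 1 else 0 : ℕ)) : ℝ) = ∏ i : ι, (1 + -(if P i y then (1 : ℝ) else 0)) := by
    by_cases h : ∀ i, ¬ P i y
    · rw [if_pos h, Finset.prod_congr rfl (g := fun _ => (1 : ℝ))]
      · simp
      · intro i _; simp [h i]
    · rw [if_neg h]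
      push Not at h
      obtain ⟨i, hi⟩ := h
      rw [Finset.prod_eq_zero (Finset.mem_univ i)]
      · simp
      · simp [hi]
  rw [h1, Finset.prod_one_add, Finset.powerset_univ]
  refine Finset.sum_congr rfl fun I _ => ?_
  rw [Finset.prod_neg]
  congr 1
  by_cases h : ∀ i ∈ I, P i y
  · rw [if_pos h, Finset.prod_congr rfl (g := fun _ => (1 : ℝ))]
    · simp
    · intro i hi; simp [h i hi]
  · rw [if_neg h]
    push Not at h
    obtain ⟨i, hi, hP⟩ := h
    rw [Finset.prod_eq_zero hi]
    · simp
    · simp [hP]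

theorem abs_prod_sub_prod_le {ι : Type*} (s : Finset ι) {a b A : ι → ℝ} {η : ℝ}
    (hη : 0 ≤ η) (hA : ∀ i ∈ s, 0 ≤ A i)
    (ha : ∀ i ∈ s, |a i| ≤ A i) (hb : ∀ i ∈ s, |b i| ≤ A i) (h : ∀ i ∈ s, |a i - b i| ≤ η * A i) :
    |∏ i ∈ s, a i - ∏ i ∈ s, b i| ≤ s.card * η * ∏ i ∈ s, A i := by
  classical
  induction s using Finset.induction_on with
  | empty => simp
  | insert i s hi ih =>
    rw [Finset.prod_insert hi, Finset.prod_insert hi, Finset.prod_insert hi, Finset.card_insert_of_notMem hi]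
    have ih' := ih (fun j hj => hA j (Finset.mem_insert_of_mem hj))
      (fun j hj => ha j (Finset.mem_insert_of_mem hj)) (fun j hj => hb j (Finset.mem_insert_of_mem hj))
      (fun j hj => h j (Finset.mem_insert_of_mem hj))
    have hmem := Finset.mem_insert_self i s
    have hP : 0 ≤ ∏ j ∈ s, A j := Finset.prod_nonneg fun j hj => hA j (Finset.mem_insert_of_mem hj)
    have hbP : |∏ j ∈ s, b j| ≤ ∏ j ∈ s, A j := by
      rw [Finset.abs_prod]
      exact Finset.prod_le_prod (fun _ _ => abs_nonneg _) fun j hj => hb j (Finset.mem_insert_of_mem hj)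
    have e : a i * ∏ j ∈ s, a j - b i * ∏ j ∈ s, b j
        = a i * (∏ j ∈ s, a j - ∏ j ∈ s, b j) + (a i - b i) * ∏ j ∈ s, b j := by ring
    rw [e]
    calc _ ≤ |a i * (∏ j ∈ s, a j - ∏ j ∈ s, b j)| + |(a i - b i) * ∏ j ∈ s, b j| := abs_add_le _ _
      _ = |a i| * |∏ j ∈ s, a j - ∏ j ∈ s, b j| + |a i - b i| * |∏ j ∈ s, b j| := by
          rw [abs_mul, abs_mul]
      _ ≤ A i * (s.card * η * ∏ j ∈ s, A j) + (η * A i) * ∏ j ∈ s, A j := by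
          have := hA i hmem
          gcongr
          · exact ha i hmem
          · exact h i hmem
      _ = _ := by push_cast; ring

end Combinatorics

/-! ### Tuples in weighted boxes. -/

section Shell

open InfinitePlace Module Units dirichletUnitTheorem
open scoped Classical

variable {K : Type*} [Field K] [NumberField K]
variable {J : Type*} [Fintype J] [Nonempty J]

/-- The weighted maximum of the coordinates at a place. -/
noncomputable def gauge (c : J → InfinitePlace K → ℝ) (y : J → Kˣ) (w : InfinitePlace K) : ℝ :=
  Finset.univ.sup' Finset.univ_nonempty fun j => c j w * w (y j : K)

theorem gauge_le_iff {c : J → InfinitePlace K → ℝ} {y : J → Kˣ} {w : InfinitePlace K} {b : ℝ} :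
    gauge c y w ≤ b ↔ ∀ j, c j w * w (y j : K) ≤ b := by
  simp [gauge]

theorem gauge_pos {c : J → InfinitePlace K → ℝ} (hc : ∀ j w, 0 < c j w) (y : J → Kˣ)
    (w : InfinitePlace K) : 0 < gauge c y w := by
  obtain ⟨j⟩ := ‹Nonempty J›
  exact (mul_pos (hc j w) (place_pos w (y j))).trans_le (gauge_le_iff.1 le_rfl j)

theorem gauge_smul {c : J → InfinitePlace K → ℝ} (y : J → Kˣ) (ζ : Kˣ) (w : InfinitePlace K) :
    gauge c (fun j => ζ * y j) w = w (ζ : K) * gauge c y w := by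
  have h := (place_pos w ζ).le
  unfold gauge
  rw [Finset.mul₀_sup' h]
  congr 1
  ext j
  simp only [Units.val_mul, map_mul]
  ring

/-- The weighted height. -/
noncomputable def weightedHeight (c : J → InfinitePlace K → ℝ) (y : J → Kˣ) : ℝ :=
  ∏ w, gauge c y w ^ mult w

/-- The tuples in a product of boxes. -/
def tupleBox (I : J → (FractionalIdeal (𝓞 K)⁰ K)ˣ) (c : J → InfinitePlace K → ℝ)
    (b : InfinitePlace K → ℝ) : Set (J → Kˣ) :=
  {y | (∀ j, (y j : K) ∈ (I j : FractionalIdeal (𝓞 K)⁰ K)) ∧ ∀ w, gauge c y w ≤ b w}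

theorem tupleBox_finite_and_ncard (I : J → (FractionalIdeal (𝓞 K)⁰ K)ˣ)
    {c : J → InfinitePlace K → ℝ} (hc : ∀ j w, 0 < c j w)
    {b : InfinitePlace K → ℝ} (hb : ∀ w, 0 < b w) :
    (tupleBox I c b).Finite ∧
      (tupleBox I c b).ncard = ∏ j, (idealBox (I j) fun w => b w / c j w).ncard := by
  have hfin : ∀ j, (idealBox (I j) fun w => b w / c j w).Finite := fun j =>
    idealBox_finite _ fun w => div_pos (hb w) (hc j w)
  have hU : ∀ j, {x : Kˣ | (x : K) ∈ idealBox (I j) fun w => b w / c j w}.Finite := fun j =>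
    (hfin j).preimage Units.val_injective.injOn
  have hUcard : ∀ j, {x : Kˣ | (x : K) ∈ idealBox (I j) fun w => b w / c j w}.ncard
      = (idealBox (I j) fun w => b w / c j w).ncard := by
    intro j
    rw [← Set.ncard_image_of_injective _ Units.val_injective]
    congr 1
    ext x
    constructor
    · rintro ⟨y, hy, rfl⟩; exact hy
    · intro hx; exact ⟨Units.mk0 x hx.2.1, hx, rfl⟩
  have heq : tupleBox I c b = ↑(Fintype.piFinset fun j => (hU j).toFinset) := by
    ext y
    simp only [tupleBox, gauge_le_iff, Set.mem_ofPred_eq, Fintype.coe_piFinset, Set.Finite.coe_toFinset,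
      Set.mem_pi, Set.mem_univ, forall_true_left, idealBox]
    constructor
    · rintro ⟨h1, h2⟩ j
      exact ⟨h1 j, (y j).ne_zero, fun w => by rw [le_div_iff₀' (hc j w)]; exact h2 w j⟩
    · intro h
      exact ⟨fun j => (h j).1, fun w j => (le_div_iff₀' (hc j w)).1 ((h j).2.2 w)⟩
  refine ⟨heq ▸ Finset.finite_toSet _, ?_⟩
  rw [heq, Set.ncard_coe_finset, Fintype.card_piFinset]
  refine Finset.prod_congr rfl fun j _ => ?_
  rw [← hUcard j, Set.ncard_eq_toFinset_card _ (hU j)]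

/-- The density of a tuple of ideals in a weighted box. -/
noncomputable def density (I : J → (FractionalIdeal (𝓞 K)⁰ K)ˣ) (c : J → InfinitePlace K → ℝ)
    (X : ℝ) (j : J) : ℝ :=
  X / ((∏ w, c j w ^ mult w) * idealNorm (I j : FractionalIdeal (𝓞 K)⁰ K))

theorem density_pos (I : J → (FractionalIdeal (𝓞 K)⁰ K)ˣ) {c : J → InfinitePlace K → ℝ}
    (hc : ∀ j w, 0 < c j w) {X : ℝ} (hX : 0 < X) (j : J) : 0 < density I c X j :=
  div_pos hX (mul_pos (Finset.prod_pos fun w _ => pow_pos (hc j w) _) (idealNorm_pos _))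

theorem density_mul (I : J → (FractionalIdeal (𝓞 K)⁰ K)ˣ) (c : J → InfinitePlace K → ℝ)
    (X t : ℝ) (j : J) : density I c (t * X) j = t * density I c X j := by
  rw [density, density, mul_div_assoc]

variable (K J) in
-- The count is a product of `idealBox` counts. Errors are measured against the densities at `X`
-- rather than at `t * X`, because boxes with several values of `t` are later combined with signs;
-- this is legitimate since `1 - 1/d ≥ 0` and `t ≤ 1`, even where `t` times a density drops below
-- one.
theorem exists_tupleBox_estimate :
    ∃ C : ℝ, 0 < C ∧ ∀ (I : J → (FractionalIdeal (𝓞 K)⁰ K)ˣ) (c : J → InfinitePlace K → ℝ),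
      (∀ j w, 0 < c j w) → ∀ X : ℝ, 0 < X → ∀ μ : ℝ, 1 ≤ μ → (∀ j, μ ≤ density I c X j) →
      ∀ t : ℝ, 0 < t → t ≤ 1 → ∀ b : InfinitePlace K → ℝ, (∀ w, 0 < b w) →
      ∏ w, b w ^ mult w = t * X →
      |((tupleBox I c b).ncard : ℝ) - t ^ Fintype.card J * (boxConst K ^ Fintype.card J * ∏ j, density I c X j)| ≤
        C * (μ ^ (-(1 / (finrank ℚ K : ℝ))) * ∏ j, density I c X j) := by
  obtain ⟨C, hC, h⟩ := exists_idealBox_estimate K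
  have hv := boxConst_pos (K := K)
  refine ⟨Fintype.card J * (boxConst K + C) ^ Fintype.card J, by positivity, ?_⟩
  intro I c hc X hX μ hμ hdens t ht ht1 b hb hprod
  rw [(tupleBox_finite_and_ncard I hc hb).2, Nat.cast_prod]
  have hρ := density_pos I hc hX
  have hd1 : (1 : ℝ) ≤ finrank ℚ K := by exact_mod_cast finrank_pos
  have hd0 : (0 : ℝ) < finrank ℚ K := by linarith
  have hexp : 0 ≤ 1 - 1 / (finrank ℚ K : ℝ) := by
    rw [sub_nonneg, div_le_one hd0]; exact hd1
  have hμ0 : 0 < μ := by linarith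
  set η := μ ^ (-(1 / (finrank ℚ K : ℝ))) with hη
  have hη0 : 0 < η := by positivity
  have hmain : t ^ Fintype.card J * (boxConst K ^ Fintype.card J * ∏ j, density I c X j) =
      ∏ j, (boxConst K * (t * density I c X j)) := by
    rw [Finset.prod_mul_distrib, Finset.prod_mul_distrib, Finset.prod_const, Finset.prod_const,
      Finset.card_univ]
    ring
  rw [hmain]
  have hest : ∀ j, |((idealBox (I j) fun w => b w / c j w).ncard : ℝ) - boxConst K * (t * density I c X j)| ≤
      C * (η * density I c X j) ∧ η ≤ 1 := by
    intro j
    have h1 := h (I j) (fun w => b w / c j w) fun w => div_pos (hb w) (hc j w)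
    have h2 : (∏ w, (b w / c j w) ^ mult w) / idealNorm (I j : FractionalIdeal (𝓞 K)⁰ K)
        = t * density I c X j := by
      simp_rw [div_pow]
      rw [Finset.prod_div_distrib, hprod, density, div_div, mul_div_assoc]
    rw [h2] at h1
    have hηle : (density I c X j) ^ (-(1 / (finrank ℚ K : ℝ))) ≤ η :=
      Real.rpow_le_rpow_of_nonpos hμ0 (hdens j) (by rw [neg_nonpos]; positivity)
    constructor
    · refine h1.trans ?_
      gcongr
      calc (t * density I c X j) ^ (1 - 1 / (finrank ℚ K : ℝ))
          ≤ (density I c X j) ^ (1 - 1 / (finrank ℚ K : ℝ)) := by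
            have := hρ j
            refine Real.rpow_le_rpow (by positivity) ?_ hexp
            exact mul_le_of_le_one_left this.le ht1
        _ = (density I c X j) ^ (-(1 / (finrank ℚ K : ℝ))) * density I c X j := by
            rw [← Real.rpow_add_one (hρ j).ne']; ring_nf
        _ ≤ _ := by have := hρ j; gcongr
    · exact Real.rpow_le_one_of_one_le_of_nonpos hμ (by rw [neg_nonpos]; positivity)
  have key := abs_prod_sub_prod_le (Finset.univ : Finset J)
    (a := fun j => ((idealBox (I j) fun w => b w / c j w).ncard : ℝ))
    (b := fun j => boxConst K * (t * density I c X j)) (A := fun j => (boxConst K + C) * density I c X j)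
    (η := η) hη0.le (fun j _ => by have := hρ j; positivity) (fun j _ => ?_) (fun j _ => ?_) (fun j _ => ?_)
  · refine key.trans (le_of_eq ?_)
    rw [Finset.prod_mul_distrib, Finset.prod_const, Finset.card_univ]
    ring
  · obtain ⟨h1, h2⟩ := hest j
    have := hρ j
    rw [abs_le] at h1 ⊢
    have e1 : boxConst K * (t * density I c X j) ≤ boxConst K * density I c X j := by
      gcongr; exact mul_le_of_le_one_left this.le ht1
    have e2 : C * (η * density I c X j) ≤ C * density I c X j := by
      gcongr; exact mul_le_of_le_one_left this.le h2
    have e3 : (0 : ℝ) ≤ ((idealBox (I j) fun w => b w / c j w).ncard : ℝ) := by positivity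
    have e4 : 0 ≤ (boxConst K + C) * density I c X j := by positivity
    constructor <;> nlinarith [h1.2]
  · have := hρ j
    rw [abs_of_pos (by positivity)]
    have e1 : boxConst K * (t * density I c X j) ≤ boxConst K * density I c X j := by
      gcongr; exact mul_le_of_le_one_left this.le ht1
    nlinarith [mul_pos hC this]
  · obtain ⟨h1, h2⟩ := hest j
    have := hρ j
    refine h1.trans ?_
    nlinarith [mul_pos hη0 (mul_pos hv this)]

end Shell
end CubicTorsor

namespace CubicTorsor

/-! ### Shells as alternating sums of boxes. -/

section Shell

open InfinitePlace Module Units dirichletUnitTheorem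
open scoped Classical

variable {K : Type*} [Field K] [NumberField K]
variable {J : Type*} [Fintype J] [Nonempty J]

/-- The tuples whose gauge at all places but one is pinned by `ξ` up to a factor given by `δ`. -/
def shell (I : J → (FractionalIdeal (𝓞 K)⁰ K)ˣ) (c : J → InfinitePlace K → ℝ) (δ X : ℝ)
    (ξ : logSpace K) : Set (J → Kˣ) :=
  {y | (∀ j, (y j : K) ∈ (I j : FractionalIdeal (𝓞 K)⁰ K)) ∧
    (∀ w : {w : InfinitePlace K // w ≠ w₀},
      mult w.1 * Real.log (gauge c y w.1) ∈ Set.Ioc (-δ - ξ w) (-ξ w)) ∧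
    mult (w₀ : InfinitePlace K) * Real.log (gauge c y w₀) ≤ Real.log X + ∑ w, ξ w}

/-- The boxes whose inclusion-exclusion gives the shell. -/
noncomputable def shellBox (δ X : ℝ) (ξ : logSpace K) (A : Finset {w : InfinitePlace K // w ≠ w₀})
    (w : InfinitePlace K) : ℝ :=
  if h : w ≠ w₀ then Real.exp (-(ξ ⟨w, h⟩ + if ⟨w, h⟩ ∈ A then δ else 0) / mult w)
  else Real.exp ((Real.log X + ∑ w, ξ w) / mult w)

theorem shellBox_pos (δ X : ℝ) (ξ : logSpace K) (A : Finset {w : InfinitePlace K // w ≠ w₀})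
    (w : InfinitePlace K) : 0 < shellBox δ X ξ A w := by
  unfold shellBox
  split_ifs <;> exact Real.exp_pos _

theorem mult_pos' (w : InfinitePlace K) : (0 : ℝ) < mult w := by
  exact_mod_cast mult_pos

/-- The place `w₀` compensates the shift by `ξ`, so only the number of shrunken sides matters. This
gives estimates uniform in `ξ`. -/
theorem prod_shellBox {δ X : ℝ} (hX : 0 < X) (ξ : logSpace K)
    (A : Finset {w : InfinitePlace K // w ≠ w₀}) :
    ∏ w, shellBox δ X ξ A w ^ mult w = Real.exp (-δ) ^ A.card * X := by
  rw [Fintype.prod_eq_mul_prod_subtype_ne _ (w₀ : InfinitePlace K)]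
  have h0 : shellBox δ X ξ A w₀ ^ mult (w₀ : InfinitePlace K) = X * Real.exp (∑ w, ξ w) := by
    rw [shellBox, dif_neg (by simp), ← Real.exp_nat_mul, mul_div_cancel₀ _ (mult_pos' _).ne',
      Real.exp_add, Real.exp_log hX]
  have h1 : ∀ w : {w : InfinitePlace K // w ≠ w₀}, shellBox δ X ξ A w.1 ^ mult w.1 =
      Real.exp (-ξ w) * (if w ∈ A then Real.exp (-δ) else 1) := by
    intro w
    rw [shellBox, dif_pos w.2, ← Real.exp_nat_mul, mul_div_cancel₀ _ (mult_pos' _).ne']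
    split_ifs
    · rw [← Real.exp_add]; congr 1; simp; ring
    · simp
  rw [h0, Finset.prod_congr rfl fun w _ => h1 w, Finset.prod_mul_distrib, ← Real.exp_sum,
    Finset.sum_neg_distrib, Finset.prod_ite_mem, Finset.univ_inter, Finset.prod_const, Real.exp_neg]
  field_simp

theorem mult_log_le_iff {w : InfinitePlace K} {g t : ℝ} (hg : 0 < g) :
    mult w * Real.log g ≤ t ↔ g ≤ Real.exp (t / mult w) := by
  rw [← Real.log_le_iff_le_exp hg, le_div_iff₀' (mult_pos' w)]

theorem mem_tupleBox_shellBox_iff {I : J → (FractionalIdeal (𝓞 K)⁰ K)ˣ}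
    {c : J → InfinitePlace K → ℝ} (hc : ∀ j w, 0 < c j w) {δ X : ℝ} (hδ : 0 ≤ δ) {ξ : logSpace K}
    {A : Finset {w : InfinitePlace K // w ≠ w₀}} {y : J → Kˣ} :
    y ∈ tupleBox I c (shellBox δ X ξ A) ↔ y ∈ tupleBox I c (shellBox δ X ξ ∅) ∧
      ∀ w ∈ A, mult w.1 * Real.log (gauge c y w.1) ≤ -δ - ξ w := by
  have hg := gauge_pos hc y
  have hne : ∀ (A : Finset {w : InfinitePlace K // w ≠ w₀}) (w : InfinitePlace K) (h : w ≠ w₀),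
      gauge c y w ≤ shellBox δ X ξ A w ↔
        mult w * Real.log (gauge c y w) ≤ -(ξ ⟨w, h⟩ + if ⟨w, h⟩ ∈ A then δ else 0) := by
    intro A w h
    rw [shellBox, dif_pos h, mult_log_le_iff (hg _)]
  have hbase : ∀ A : Finset {w : InfinitePlace K // w ≠ w₀},
      shellBox δ X ξ A w₀ = shellBox δ X ξ ∅ w₀ := by
    intro A
    simp [shellBox]
  constructor
  · rintro ⟨h1, h2⟩
    refine ⟨⟨h1, fun w => ?_⟩, fun w hw => ?_⟩
    · by_cases h : w = w₀
      · subst h; rw [← hbase A]; exact h2 _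
      · have h3 := h2 w
        rw [hne _ _ h] at h3 ⊢
        refine h3.trans ?_
        rw [if_neg (Finset.notMem_empty _)]
        split_ifs <;> linarith
    · have := h2 w.1
      rw [hne _ _ w.2, if_pos hw] at this
      linarith
  · rintro ⟨⟨h1, h2⟩, h3⟩
    refine ⟨h1, fun w => ?_⟩
    by_cases h : w = w₀
    · subst h; rw [hbase A]; exact h2 _
    · have h4 := h2 w
      rw [hne _ _ h] at h4 ⊢
      rw [if_neg (Finset.notMem_empty _)] at h4
      split_ifs with h5
      · have := h3 ⟨w, h⟩ h5
        simp only at this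
        linarith
      · exact h4

theorem shell_eq {I : J → (FractionalIdeal (𝓞 K)⁰ K)ˣ} {c : J → InfinitePlace K → ℝ}
    (hc : ∀ j w, 0 < c j w) {δ X : ℝ} {ξ : logSpace K} :
    shell I c δ X ξ = {y | y ∈ tupleBox I c (shellBox δ X ξ ∅) ∧
      ∀ w : {w : InfinitePlace K // w ≠ w₀}, ¬ mult w.1 * Real.log (gauge c y w.1) ≤ -δ - ξ w} := by
  ext y
  have hg := gauge_pos hc y
  constructor
  · rintro ⟨h1, h2, h3⟩
    refine ⟨⟨h1, fun w => ?_⟩, fun w => not_le.2 (h2 w).1⟩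
    unfold shellBox
    split_ifs with h h4
    · simp at h4
    · rw [← mult_log_le_iff (hg _), add_zero]; exact (h2 ⟨w, h⟩).2
    · rw [← mult_log_le_iff (hg _)]
      rw [not_ne_iff] at h
      subst h; exact h3
  · rintro ⟨⟨h1, h2⟩, h3⟩
    refine ⟨h1, fun w => ⟨not_le.1 (h3 w), ?_⟩, ?_⟩
    · have := h2 w.1
      rw [shellBox, dif_pos w.2, ← mult_log_le_iff (hg _)] at this
      simpa using this
    · have := h2 w₀
      rwa [shellBox, dif_neg (by simp), ← mult_log_le_iff (hg _)] at this

theorem shell_finite (I : J → (FractionalIdeal (𝓞 K)⁰ K)ˣ) {c : J → InfinitePlace K → ℝ}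
    (hc : ∀ j w, 0 < c j w) (δ X : ℝ) (ξ : logSpace K) : (shell I c δ X ξ).Finite := by
  rw [shell_eq hc]
  exact (tupleBox_finite_and_ncard I hc (shellBox_pos δ X ξ ∅)).1.subset fun y hy => hy.1

theorem card_ne_base : Fintype.card {w : InfinitePlace K // w ≠ w₀} = rank K := by
  rw [Fintype.card_subtype_compl, Fintype.card_subtype_eq, rank]

variable (K J) in
-- Inclusion-exclusion over the set `A` of places where the lower bound fails. With `n` coordinates
-- the box of `A` has the relative main term `exp (-n δ |A|)`, and the signed sum of these over `A`
-- is a binomial expansion.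
theorem exists_shell_estimate :
    ∃ C : ℝ, 0 < C ∧ ∀ (I : J → (FractionalIdeal (𝓞 K)⁰ K)ˣ) (c : J → InfinitePlace K → ℝ),
      (∀ j w, 0 < c j w) → ∀ X : ℝ, 0 < X → ∀ μ : ℝ, 1 ≤ μ → (∀ j, μ ≤ density I c X j) →
      ∀ δ : ℝ, 0 ≤ δ → ∀ ξ : logSpace K,
      |((shell I c δ X ξ).ncard : ℝ) - (1 - Real.exp (-δ) ^ Fintype.card J) ^ rank K *
        (boxConst K ^ Fintype.card J * ∏ j, density I c X j)| ≤
        C * (μ ^ (-(1 / (finrank ℚ K : ℝ))) * ∏ j, density I c X j) := by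
  obtain ⟨C, hC, h⟩ := exists_tupleBox_estimate K J
  refine ⟨2 ^ rank K * C, by positivity, fun I c hc X hX μ hμ hdens δ hδ ξ => ?_⟩
  set M := boxConst K ^ Fintype.card J * ∏ j, density I c X j with hM
  set E := μ ^ (-(1 / (finrank ℚ K : ℝ))) * ∏ j, density I c X j with hE
  have hfin := (tupleBox_finite_and_ncard I hc (shellBox_pos δ X ξ ∅)).1
  have hcount : ((shell I c δ X ξ).ncard : ℝ) = ∑ A : Finset {w : InfinitePlace K // w ≠ w₀},
      (-1) ^ A.card * ((tupleBox I c (shellBox δ X ξ A)).ncard : ℝ) := by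
    have := card_filter_forall_not_eq_sum hfin.toFinset
      (fun (w : {w : InfinitePlace K // w ≠ w₀}) y => mult w.1 * Real.log (gauge c y w.1) ≤ -δ - ξ w)
    rw [← Set.ncard_coe_finset] at this
    rw [shell_eq hc]
    convert! this using 2
    · simp
    · rename_i A
      congr 2
      rw [← Set.ncard_coe_finset]
      congr 1
      ext y
      rw [mem_tupleBox_shellBox_iff hc hδ]
      simp
  have hmain : (1 - Real.exp (-δ) ^ Fintype.card J) ^ rank K * M =
      ∑ A : Finset {w : InfinitePlace K // w ≠ w₀}, (-1) ^ A.card *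
        ((Real.exp (-δ) ^ A.card) ^ Fintype.card J * M) := by
    have := Finset.prod_one_add (f := fun _ : {w : InfinitePlace K // w ≠ w₀} =>
      -(Real.exp (-δ) ^ Fintype.card J)) Finset.univ
    rw [Finset.prod_const, Finset.card_univ, card_ne_base, ← sub_eq_add_neg, Finset.powerset_univ] at this
    rw [this, Finset.sum_mul]
    refine Finset.sum_congr rfl fun A _ => ?_
    rw [Finset.prod_const, neg_pow, ← pow_mul, ← pow_mul, mul_comm A.card, mul_assoc]
  rw [hcount, hmain, ← Finset.sum_sub_distrib]
  calc _ ≤ ∑ A : Finset {w : InfinitePlace K // w ≠ w₀}, |(-1 : ℝ) ^ A.card * ((tupleBox I c (shellBox δ X ξ A)).ncard : ℝ)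
        - (-1) ^ A.card * ((Real.exp (-δ) ^ A.card) ^ Fintype.card J * M)| := Finset.abs_sum_le_sum_abs _ _
    _ ≤ ∑ A : Finset {w : InfinitePlace K // w ≠ w₀}, C * E := by
        refine Finset.sum_le_sum fun A _ => ?_
        rw [← mul_sub, abs_mul, abs_pow, abs_neg, abs_one, one_pow, one_mul]
        refine h I c hc X hX μ hμ hdens _ (by positivity) ?_ _ (shellBox_pos δ X ξ A) (prod_shellBox hX ξ A)
        exact pow_le_one₀ (Real.exp_pos _).le (Real.exp_le_one_iff.2 (by linarith))
    _ = _ := by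
        rw [Finset.sum_const, Finset.card_univ, Fintype.card_finset, card_ne_base, nsmul_eq_mul]
        push_cast
        ring

end Shell
end CubicTorsor

namespace CubicTorsor

/-! ### Unfolding along the unit lattice. -/

section Unfolding

open InfinitePlace Module Units dirichletUnitTheorem MeasureTheory
open scoped Classical

variable {K : Type*} [Field K] [NumberField K]
variable {J : Type*} [Fintype J] [Nonempty J]

instance countable_units : Countable Kˣ := by
  have : Countable K := by
    let b := Module.finBasis ℚ K
    exact b.equivFun.toEquiv.countable_iff.2 inferInstance
  exact Units.val_injective.countable

/-- Systems of representatives of tuples modulo diagonal multiplication by a group of units. -/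
def IsTransversal (F : Subgroup Kˣ) (Y : Set (J → Kˣ)) : Prop :=
  ∀ y : J → Kˣ, ∃! ζ : Kˣ, ζ ∈ F ∧ (fun j => ζ * y j) ∈ Y

/-- The tuples of representatives in given ideals and of bounded weighted height. -/
def weightedPoints (I : J → (FractionalIdeal (𝓞 K)⁰ K)ˣ) (c : J → InfinitePlace K → ℝ)
    (Y : Set (J → Kˣ)) (X : ℝ) : Set (J → Kˣ) :=
  {y | y ∈ Y ∧ (∀ j, (y j : K) ∈ (I j : FractionalIdeal (𝓞 K)⁰ K)) ∧ weightedHeight c y ≤ X}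

theorem IsUnitComplement.mul_mem_iff {F : Subgroup Kˣ} (hF : IsUnitComplement F) {ζ : Kˣ}
    (hζ : ζ ∈ F) (A : FractionalIdeal (𝓞 K)⁰ K) (y : Kˣ) :
    ((ζ * y : Kˣ) : K) ∈ A ↔ (y : K) ∈ A := by
  have key : ∀ ζ ∈ F, ∀ y : Kˣ, (y : K) ∈ A → ((ζ * y : Kˣ) : K) ∈ A := by
    intro ζ hζ y hy
    obtain ⟨x, rfl⟩ := hF.exists_unit ζ hζ
    have := A.1.smul_mem (x : 𝓞 K) hy
    rw [Algebra.smul_def] at this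
    exact this
  refine ⟨fun h => ?_, key ζ hζ y⟩
  have := key ζ⁻¹ (inv_mem hζ) _ h
  rwa [_root_.inv_mul_cancel_left] at this

/-- A unit shifts all logarithmic gauges by its own logarithms. At `w₀` this agrees with the shift
of `∑ w, ξ w`, because the logarithms of a unit sum to zero. -/
theorem IsUnitComplement.smul_mem_shell_iff {F : Subgroup Kˣ} (hF : IsUnitComplement F) {ζ : Kˣ}
    (hζ : ζ ∈ F) {I : J → (FractionalIdeal (𝓞 K)⁰ K)ˣ} {c : J → InfinitePlace K → ℝ}
    (hc : ∀ j w, 0 < c j w) {δ X : ℝ} {ξ : logSpace K} {y : J → Kˣ} :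
    (fun j => ζ * y j) ∈ shell I c δ X ξ ↔ y ∈ shell I c δ X (logAt ζ + ξ) := by
  have hg := gauge_pos hc y
  have hlog : ∀ w : InfinitePlace K, mult w * Real.log (gauge c (fun j => ζ * y j) w) =
      mult w * Real.log (w (ζ : K)) + mult w * Real.log (gauge c y w) := by
    intro w
    rw [gauge_smul, Real.log_mul (place_pos w ζ).ne' (hg w).ne', mul_add]
  have hsum := hF.sum_logAt hζ
  unfold shell
  simp only [Set.mem_ofPred_eq, hF.mul_mem_iff hζ, hlog, Pi.add_apply, Finset.sum_add_distrib, hsum,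
    Set.mem_Ioc]
  refine and_congr_right fun _ => and_congr (forall_congr' fun w => ?_) ?_
  · have : logAt ζ w = mult w.1 * Real.log (w.1 (ζ : K)) := rfl
    rw [this]
    constructor <;> rintro ⟨h1, h2⟩ <;> constructor <;> linarith
  · constructor <;> intro h <;> linarith

/-- Every tuple is `ζ y` for exactly one `ζ ∈ F` and `y ∈ Y`, and `F` is identified with the unit
lattice by `logAt`. -/
theorem IsTransversal.encard_shell {F : Subgroup Kˣ} (hF : IsUnitComplement F) {Y : Set (J → Kˣ)}
    (hY : IsTransversal F Y) (I : J → (FractionalIdeal (𝓞 K)⁰ K)ˣ) {c : J → InfinitePlace K → ℝ}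
    (hc : ∀ j w, 0 < c j w) (δ X : ℝ) (ξ : logSpace K) :
    (((shell I c δ X ξ).encard : ENat) : ENNReal) =
      ∑' y : Y, (({l : (unitLattice K).toAddSubgroup | (l : logSpace K) + ξ ∈
        {ξ | (y : J → Kˣ) ∈ shell I c δ X ξ}}.encard : ENat) : ENNReal) := by
  let e : Y × F ≃ (J → Kˣ) := Equiv.ofBijective (fun p j => (p.2 : Kˣ) * p.1.1 j) <| by
    constructor
    · rintro ⟨y, ζ⟩ ⟨y', ζ'⟩ h
      have hj : ∀ j, (ζ : Kˣ) * y.1 j = ζ' * y'.1 j := fun j => congrFun h j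
      have h1 : (fun j => (1 : Kˣ) * y.1 j) ∈ Y := by simp
      have h2 : (fun j => ((ζ' : Kˣ)⁻¹ * ζ) * y.1 j) ∈ Y := by
        simp_rw [mul_assoc, hj, _root_.inv_mul_cancel_left]
        exact y'.2
      have h3 := (hY y.1).unique ⟨one_mem F, h1⟩ ⟨mul_mem (inv_mem ζ'.2) ζ.2, h2⟩
      have h4 : ζ = ζ' := by
        ext1
        exact (inv_mul_eq_one.1 h3.symm).symm
      subst h4
      refine Prod.ext (Subtype.ext (funext fun j => ?_)) rfl
      exact mul_left_cancel (hj j)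
    · intro z
      obtain ⟨ζ, ⟨hζ, hz⟩, -⟩ := hY z
      exact ⟨⟨⟨_, hz⟩, ⟨ζ⁻¹, inv_mem hζ⟩⟩, by ext j; simp⟩
  rw [← ENNReal.tsum_set_one, tsum_subtype (shell I c δ X ξ) (fun _ => (1 : ENNReal)), ← e.tsum_eq,
    ENNReal.tsum_prod (f := fun y ζ => (shell I c δ X ξ).indicator (fun _ => (1 : ENNReal)) (e (y, ζ)))]
  refine tsum_congr fun y => ?_
  rw [← ENNReal.tsum_set_one, tsum_subtype _ (fun _ => (1 : ENNReal))]
  refine Eq.trans ?_ (Equiv.tsum_eq (γ := F) (β := (unitLattice K).toAddSubgroup) hF.equiv _)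
  refine tsum_congr fun ζ => ?_
  have h : e (y, ζ) ∈ shell I c δ X ξ ↔ (y : J → Kˣ) ∈ shell I c δ X (logAt (ζ : Kˣ) + ξ) :=
    hF.smul_mem_shell_iff ζ.2 hc
  have h2 : hF.equiv ζ ∈ {l : (unitLattice K).toAddSubgroup | (l : logSpace K) + ξ ∈
        {ξ | (y : J → Kˣ) ∈ shell I c δ X ξ}} ↔ (y : J → Kˣ) ∈ shell I c δ X (logAt (ζ : Kˣ) + ξ) := Iff.rfl
  by_cases h3 : (y : J → Kˣ) ∈ shell I c δ X (logAt (ζ : Kˣ) + ξ)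
  · rw [Set.indicator_of_mem (h.2 h3), Set.indicator_of_mem (h2.2 h3)]
  · rw [Set.indicator_of_notMem (mt h.1 h3), Set.indicator_of_notMem (mt h2.1 h3)]

theorem measurableSet_shell_fiber (I : J → (FractionalIdeal (𝓞 K)⁰ K)ˣ) (c : J → InfinitePlace K → ℝ)
    (δ X : ℝ) (y : J → Kˣ) : MeasurableSet {ξ : logSpace K | y ∈ shell I c δ X ξ} := by
  refine MeasurableSet.inter (MeasurableSet.const _) (MeasurableSet.inter ?_ ?_)
  · have : {ξ : logSpace K | ∀ w : {w : InfinitePlace K // w ≠ w₀},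
      mult w.1 * Real.log (gauge c y w.1) ∈ Set.Ioc (-δ - ξ w) (-ξ w)} = ⋂ w : {w : InfinitePlace K // w ≠ w₀},
      {ξ | -δ - ξ w < mult w.1 * Real.log (gauge c y w.1)} ∩ {ξ | mult w.1 * Real.log (gauge c y w.1) ≤ - ξ w} := by
      ext ξ; simp
    change MeasurableSet {ξ : logSpace K | ∀ w : {w : InfinitePlace K // w ≠ w₀},
      mult w.1 * Real.log (gauge c y w.1) ∈ Set.Ioc (-δ - ξ w) (-ξ w)}
    rw [this]
    refine MeasurableSet.iInter fun w => MeasurableSet.inter ?_ ?_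
    · exact measurableSet_lt (by fun_prop) (by fun_prop)
    · exact measurableSet_le (by fun_prop) (by fun_prop)
  · change MeasurableSet {ξ : logSpace K |
      mult (w₀ : InfinitePlace K) * Real.log (gauge c y w₀) ≤ Real.log X + ∑ w, ξ w}
    exact measurableSet_le (by fun_prop) (by fun_prop)

theorem measurable_encard_translates {V : Type*} [AddCommGroup V] [MeasurableSpace V] [MeasurableAdd V]
    (L : AddSubgroup V) [Countable L] {S : Set V} (hS : MeasurableSet S) :
    Measurable fun x => (({g : L | (g : V) + x ∈ S}.encard : ENat) : ENNReal) := by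
  have : (fun x => (({g : L | (g : V) + x ∈ S}.encard : ENat) : ENNReal)) =
      fun x => ∑' g : L, S.indicator (fun _ => (1 : ENNReal)) ((g : V) + x) := by
    ext x
    rw [← ENNReal.tsum_set_one, tsum_subtype {g : L | (g : V) + x ∈ S} (fun _ => (1 : ENNReal))]
    refine tsum_congr fun g => ?_
    by_cases h : (g : V) + x ∈ S <;> simp [Set.indicator, h]
  rw [this]
  refine Measurable.tsum fun g => ?_
  exact (measurable_const.indicator hS).comp (measurable_const_add (g : V))

variable (K) in
theorem exists_unitLattice_domain : ∃ D : Set (logSpace K),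
    IsAddFundamentalDomain (unitLattice K).toAddSubgroup D volume ∧
      volume D = ENNReal.ofReal (regulator K) := by
  have hD := ZLattice.isAddFundamentalDomain (Module.Free.chooseBasis ℤ (unitLattice K)) volume
  refine ⟨_, hD, ?_⟩
  rw [regulator, ZLattice.covolume_eq_measure_fundamentalDomain _ _ hD, measureReal_def,
    ENNReal.ofReal_toReal]
  exact (ZSpan.fundamentalDomain_isBounded _).measure_lt_top.ne

/-- Unfolding: integrating a sum over lattice translates over a fundamental domain is integrating
over the whole of `logSpace K`. -/
theorem IsTransversal.lintegral_encard_shell {F : Subgroup Kˣ} (hF : IsUnitComplement F) {Y : Set (J → Kˣ)}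
    (hY : IsTransversal F Y) (I : J → (FractionalIdeal (𝓞 K)⁰ K)ˣ) {c : J → InfinitePlace K → ℝ}
    (hc : ∀ j w, 0 < c j w) (δ X : ℝ) {D : Set (logSpace K)}
    (hD : IsAddFundamentalDomain (unitLattice K).toAddSubgroup D volume) :
    ∫⁻ ξ in D, (((shell I c δ X ξ).encard : ENat) : ENNReal) =
      ∑' y : Y, volume {ξ : logSpace K | (y : J → Kˣ) ∈ shell I c δ X ξ} := by
  have : Countable (unitLattice K).toAddSubgroup := inferInstanceAs (Countable (unitLattice K))
  simp_rw [hY.encard_shell hF I hc]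
  rw [lintegral_tsum]
  · refine tsum_congr fun y => ?_
    rw [measure_eq_lintegral_encard _ hD (measurableSet_shell_fiber I c δ X _)]
  · intro y
    exact (measurable_encard_translates _ (measurableSet_shell_fiber I c δ X _)).aemeasurable

theorem log_weightedHeight {c : J → InfinitePlace K → ℝ} (hc : ∀ j w, 0 < c j w) (y : J → Kˣ) :
    Real.log (weightedHeight c y) = mult (w₀ : InfinitePlace K) * Real.log (gauge c y w₀) +
      ∑ w : {w : InfinitePlace K // w ≠ w₀}, mult w.1 * Real.log (gauge c y w.1) := by
  rw [weightedHeight, Real.log_prod fun w _ => (pow_pos (gauge_pos hc y w) _).ne']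
  rw [Fintype.sum_eq_add_sum_subtype_ne _ (w₀ : InfinitePlace K)]
  simp only [Real.log_pow]

theorem weightedHeight_pos {c : J → InfinitePlace K → ℝ} (hc : ∀ j w, 0 < c j w) (y : J → Kˣ) :
    0 < weightedHeight c y :=
  Finset.prod_pos fun w _ => pow_pos (gauge_pos hc y w) _

theorem volume_pinned (δ : ℝ) (a : logSpace K) :
    volume {ξ : logSpace K | ∀ w, a w ∈ Set.Ioc (-δ - ξ w) (-ξ w)} = ENNReal.ofReal δ ^ rank K := by
  have : {ξ : logSpace K | ∀ w, a w ∈ Set.Ioc (-δ - ξ w) (-ξ w)} =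
      Set.univ.pi fun w => Set.Ioc (-δ - a w) (-a w) := by
    ext ξ
    simp only [Set.mem_ofPred_eq, Set.mem_pi, Set.mem_univ, forall_true_left, Set.mem_Ioc]
    refine forall_congr' fun w => ?_
    constructor <;> rintro ⟨h1, h2⟩ <;> constructor <;> linarith
  have h2 : ∀ w, -a w - (-δ - a w) = δ := fun w => by ring
  rw [this, Real.volume_pi_Ioc]
  simp_rw [h2]
  rw [Finset.prod_const, Finset.card_univ, card_ne_base]

/-- Pinning confines `ξ` to a cube of side `δ`. When the pinned logarithms are added to the bound at
`w₀`, the `ξ w` cancel and the height bound remains. -/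
theorem volume_shell_fiber_le (I : J → (FractionalIdeal (𝓞 K)⁰ K)ˣ) {c : J → InfinitePlace K → ℝ}
    (hc : ∀ j w, 0 < c j w) {δ X : ℝ} (hX : 0 < X) (y : J → Kˣ) :
    volume {ξ : logSpace K | y ∈ shell I c δ X ξ} ≤
      {y | (∀ j, (y j : K) ∈ (I j : FractionalIdeal (𝓞 K)⁰ K)) ∧ weightedHeight c y ≤ X}.indicator
        (fun _ => ENNReal.ofReal δ ^ rank K) y := by
  by_cases h : y ∈ {y : J → Kˣ | (∀ j, (y j : K) ∈ (I j : FractionalIdeal (𝓞 K)⁰ K)) ∧ weightedHeight c y ≤ X}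
  · rw [Set.indicator_of_mem h, ← volume_pinned δ fun w => mult w.1 * Real.log (gauge c y w.1)]
    exact measure_mono fun ξ hξ => hξ.2.1
  · rw [Set.indicator_of_notMem h, nonpos_iff_eq_zero]
    convert measure_empty (μ := (volume : Measure (logSpace K)))
    refine Set.eq_empty_of_forall_notMem fun ξ hξ => h ⟨hξ.1, ?_⟩
    rw [← Real.log_le_log_iff (weightedHeight_pos hc y) hX, log_weightedHeight hc]
    have h1 : ∑ w : {w : InfinitePlace K // w ≠ w₀}, mult w.1 * Real.log (gauge c y w.1) ≤ ∑ w, -ξ w :=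
      Finset.sum_le_sum fun w _ => (hξ.2.1 w).2
    rw [Finset.sum_neg_distrib] at h1
    have h2 := hξ.2.2
    linarith

/-- Each pinned logarithm may lie up to `δ` below `-ξ w`. The factor `exp (-(rank K * δ))` pays for
all of these losses, so that the whole cube of `ξ` belongs to the fibre. -/
theorem le_volume_shell_fiber (I : J → (FractionalIdeal (𝓞 K)⁰ K)ˣ) {c : J → InfinitePlace K → ℝ}
    (hc : ∀ j w, 0 < c j w) {δ X : ℝ} (hX : 0 < X) (y : J → Kˣ) :
    {y | (∀ j, (y j : K) ∈ (I j : FractionalIdeal (𝓞 K)⁰ K)) ∧ weightedHeight c y ≤ Real.exp (-(rank K * δ)) * X}.indicator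
        (fun _ => ENNReal.ofReal δ ^ rank K) y ≤ volume {ξ : logSpace K | y ∈ shell I c δ X ξ} := by
  refine Set.indicator_le' (g := fun y => volume {ξ : logSpace K | y ∈ shell I c δ X ξ}) (fun y hy => ?_)
    (fun _ _ => zero_le) y
  rw [← volume_pinned δ fun w => mult w.1 * Real.log (gauge c y w.1)]
  refine measure_mono fun ξ hξ => ⟨hy.1, hξ, ?_⟩
  have h0 := hy.2
  rw [← Real.log_le_log_iff (weightedHeight_pos hc y) (by positivity), log_weightedHeight hc,
    Real.log_mul (Real.exp_pos _).ne' hX.ne', Real.log_exp] at h0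
  have h1 : ∑ w : {w : InfinitePlace K // w ≠ w₀}, (-δ -ξ w) ≤
      ∑ w : {w : InfinitePlace K // w ≠ w₀}, mult w.1 * Real.log (gauge c y w.1) :=
      Finset.sum_le_sum fun w _ => (hξ w).1.le
  rw [Finset.sum_sub_distrib, Finset.sum_const, Finset.card_univ, card_ne_base, nsmul_eq_mul] at h1
  linarith

theorem tsum_indicator_inter {α : Type*} (Y S : Set α) (r : ENNReal) :
    ∑' y : Y, S.indicator (fun _ => r) (y : α) = (((Y ∩ S).encard : ENat) : ENNReal) * r := by
  rw [← ENNReal.tsum_set_const, tsum_subtype Y, tsum_subtype (Y ∩ S) (fun _ => r)]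
  simp_rw [Set.indicator_indicator]

theorem IsTransversal.lintegral_encard_shell_le {F : Subgroup Kˣ} (hF : IsUnitComplement F) {Y : Set (J → Kˣ)}
    (hY : IsTransversal F Y) (I : J → (FractionalIdeal (𝓞 K)⁰ K)ˣ) {c : J → InfinitePlace K → ℝ}
    (hc : ∀ j w, 0 < c j w) (δ : ℝ) {X : ℝ} (hX : 0 < X) {D : Set (logSpace K)}
    (hD : IsAddFundamentalDomain (unitLattice K).toAddSubgroup D volume) :
    ∫⁻ ξ in D, (((shell I c δ X ξ).encard : ENat) : ENNReal) ≤
      (((weightedPoints I c Y X).encard : ENat) : ENNReal) * ENNReal.ofReal δ ^ rank K := by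
  rw [hY.lintegral_encard_shell hF I hc δ X hD]
  calc _ ≤ _ := ENNReal.tsum_le_tsum fun y : Y => volume_shell_fiber_le I hc hX y.1
    _ = _ := tsum_indicator_inter _ _ _

theorem IsTransversal.le_lintegral_encard_shell {F : Subgroup Kˣ} (hF : IsUnitComplement F) {Y : Set (J → Kˣ)}
    (hY : IsTransversal F Y) (I : J → (FractionalIdeal (𝓞 K)⁰ K)ˣ) {c : J → InfinitePlace K → ℝ}
    (hc : ∀ j w, 0 < c j w) (δ : ℝ) {X : ℝ} (hX : 0 < X) {D : Set (logSpace K)}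
    (hD : IsAddFundamentalDomain (unitLattice K).toAddSubgroup D volume) :
    (((weightedPoints I c Y (Real.exp (-(rank K * δ)) * X)).encard : ENat) : ENNReal) *
      ENNReal.ofReal δ ^ rank K ≤ ∫⁻ ξ in D, (((shell I c δ X ξ).encard : ENat) : ENNReal) := by
  rw [hY.lintegral_encard_shell hF I hc δ X hD]
  calc _ = _ := (tsum_indicator_inter _ _ _).symm
    _ ≤ _ := ENNReal.tsum_le_tsum fun y : Y => le_volume_shell_fiber I hc hX y.1

/-- The `j`-th coordinate alone forces the height to be at least the product of its weights times
the norm of its ideal. -/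
theorem weightedPoints_eq_empty {I : J → (FractionalIdeal (𝓞 K)⁰ K)ˣ} {c : J → InfinitePlace K → ℝ}
    (hc : ∀ j w, 0 < c j w) {Y : Set (J → Kˣ)} {X : ℝ} {j : J} (h : density I c X j < 1) :
    weightedPoints I c Y X = ∅ := by
  refine Set.eq_empty_of_forall_notMem fun y ⟨_, h1, h2⟩ => ?_
  have hC : 0 < ∏ w, c j w ^ mult w := Finset.prod_pos fun w _ => pow_pos (hc j w) _
  have hN := idealNorm_pos (I j)
  rw [density, div_lt_one (by positivity)] at h
  have h3 : ∏ w, (c j w * w (y j : K)) ^ mult w ≤ weightedHeight c y := by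
    unfold weightedHeight
    refine Finset.prod_le_prod (fun w _ => ?_) (fun w _ => ?_)
    · exact pow_nonneg (mul_pos (hc j w) (place_pos w (y j))).le _
    · exact pow_le_pow_left₀ (mul_pos (hc j w) (place_pos w (y j))).le (gauge_le_iff.1 le_rfl j) _
  simp_rw [mul_pow] at h3
  rw [Finset.prod_mul_distrib, prod_eq_abs_norm] at h3
  have h4 := idealNorm_le_abs_norm (I j) (h1 j) (y j).ne_zero
  have h5 : (∏ w, c j w ^ mult w) * idealNorm (I j : FractionalIdeal (𝓞 K)⁰ K) ≤
    (∏ w, c j w ^ mult w) * |Algebra.norm ℚ (y j : K)| := by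
    gcongr
  linarith

end Unfolding
end CubicTorsor

namespace CubicTorsor

/-! ### Counting tuples of bounded height modulo units. -/

section Estimate

open InfinitePlace Module Units dirichletUnitTheorem MeasureTheory
open scoped Classical

variable {K : Type*} [Field K] [NumberField K]
variable {J : Type*} [Fintype J] [Nonempty J]

theorem exp_sub_one_le {t : ℝ} (ht : 0 ≤ t) : Real.exp t - 1 ≤ t * Real.exp t := by
  have h1 := Real.add_one_le_exp (-t)
  have h2 : Real.exp (-t) * Real.exp t = 1 := by rw [← Real.exp_add]; simp
  have h3 := Real.exp_pos t
  nlinarith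

theorem mul_one_sub_le {t : ℝ} (ht : 0 ≤ t) : t * (1 - t) ≤ 1 - Real.exp (-t) := by
  have h1 := Real.add_one_le_exp t
  have h2 : Real.exp (-t) * Real.exp t = 1 := by rw [← Real.exp_add]; simp
  have h3 := Real.exp_pos (-t)
  have h4 : Real.exp (-t) * (1 + t) ≤ 1 := by nlinarith
  have h5 : Real.exp (-t) ≤ 1 / (1 + t) := by rwa [le_div_iff₀ (by linarith)]
  have h6 : 1 / (1 + t) ≤ 1 - t + t ^ 2 := by
    rw [div_le_iff₀ (by linarith)]
    nlinarith [pow_nonneg ht 3]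
  nlinarith

theorem pow_mul_one_sub_le {n δ : ℝ} (hn : 0 ≤ n) (hδ : 0 ≤ δ) (q : ℕ) :
    (n * δ) ^ q * (1 - q * (n * δ)) ≤ (1 - Real.exp (-(n * δ))) ^ q := by
  have ht : 0 ≤ n * δ := by positivity
  have hpos : 0 ≤ 1 - Real.exp (-(n * δ)) := by
    have : Real.exp (-(n * δ)) ≤ 1 := Real.exp_le_one_iff.2 (by linarith)
    linarith
  rcases le_or_gt (n * δ) 1 with h | h
  · have h1 := one_add_mul_le_pow (a := -(n * δ)) (by linarith) q
    calc (n * δ) ^ q * (1 - q * (n * δ)) ≤ (n * δ) ^ q * (1 + -(n * δ)) ^ q := by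
          gcongr; linarith
      _ = (n * δ * (1 - n * δ)) ^ q := by rw [mul_pow (n * δ) (1 - n * δ), sub_eq_add_neg]
      _ ≤ _ := by
          refine pow_le_pow_left₀ (mul_nonneg ht (by linarith)) ?_ q
          exact mul_one_sub_le ht
  · rcases Nat.eq_zero_or_pos q with rfl | hq
    · simp
    · have hq1 : (1 : ℝ) ≤ q := by exact_mod_cast hq
      have : (n * δ) ^ q * (1 - q * (n * δ)) ≤ 0 :=
        mul_nonpos_of_nonneg_of_nonpos (by positivity) (by nlinarith)
      exact this.trans (by positivity)

theorem weightedPoints_le {F : Subgroup Kˣ} (hF : IsUnitComplement F) {Y : Set (J → Kˣ)}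
    (hY : IsTransversal F Y) (I : J → (FractionalIdeal (𝓞 K)⁰ K)ˣ) {c : J → InfinitePlace K → ℝ}
    (hc : ∀ j w, 0 < c j w) {δ : ℝ} (hδ : 0 < δ) {X U : ℝ} (hX : 0 < X)
    (hU : ∀ ξ, ((shell I c δ (Real.exp (rank K * δ) * X) ξ).ncard : ℝ) ≤ U) :
    (weightedPoints I c Y X).Finite ∧
      ((weightedPoints I c Y X).ncard : ℝ) * δ ^ rank K ≤ regulator K * U := by
  obtain ⟨D, hD, hvol⟩ := exists_unitLattice_domain K
  have hR := regulator_pos K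
  have hU0 : 0 ≤ U := le_trans (by positivity) (hU 0)
  -- The bound `X` is enlarged by `exp (rank K * δ)` to offset the loss in the lower bound for the
  -- fibres.
  have h1 := hY.le_lintegral_encard_shell hF I hc δ (X := Real.exp (rank K * δ) * X) (by positivity) hD
  rw [← mul_assoc, ← Real.exp_add, neg_add_cancel, Real.exp_zero, one_mul] at h1
  have h2 : ∫⁻ ξ in D, (((shell I c δ (Real.exp (rank K * δ) * X) ξ).encard : ENat) : ENNReal) ≤
      ENNReal.ofReal (regulator K * U) := by
    rw [ENNReal.ofReal_mul hR.le, mul_comm (ENNReal.ofReal _), ← hvol, ← setLIntegral_const]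
    refine lintegral_mono fun ξ => ?_
    rw [← (shell_finite I hc δ _ ξ).cast_ncard_eq]
    rw [ENat.toENNReal_coe, ← ENNReal.ofReal_natCast]
    exact ENNReal.ofReal_le_ofReal (hU ξ)
  have h3 := h1.trans h2
  rw [← ENNReal.ofReal_pow hδ.le] at h3
  have hfin : (weightedPoints I c Y X).Finite := by
    rw [← Set.encard_ne_top_iff]
    intro htop
    rw [htop, ENat.toENNReal_top, ENNReal.top_mul (by positivity)] at h3
    exact absurd h3 (by simp)
  refine ⟨hfin, ?_⟩
  rw [← hfin.cast_ncard_eq, ENat.toENNReal_coe, ← ENNReal.ofReal_natCast, ← ENNReal.ofReal_mul (by positivity),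
    ENNReal.ofReal_le_ofReal_iff (by positivity)] at h3
  exact h3

theorem le_weightedPoints {F : Subgroup Kˣ} (hF : IsUnitComplement F) {Y : Set (J → Kˣ)}
    (hY : IsTransversal F Y) (I : J → (FractionalIdeal (𝓞 K)⁰ K)ˣ) {c : J → InfinitePlace K → ℝ}
    (hc : ∀ j w, 0 < c j w) {δ : ℝ} (hδ : 0 < δ) {X U : ℝ} (hX : 0 < X)
    (hfin : (weightedPoints I c Y X).Finite)
    (hU : ∀ ξ, U ≤ ((shell I c δ X ξ).ncard : ℝ)) :
      regulator K * U ≤ ((weightedPoints I c Y X).ncard : ℝ) * δ ^ rank K := by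
  obtain ⟨D, hD, hvol⟩ := exists_unitLattice_domain K
  have hR := regulator_pos K
  have h1 := hY.lintegral_encard_shell_le hF I hc δ hX hD
  have h2 : ENNReal.ofReal (regulator K * U) ≤
      ∫⁻ ξ in D, (((shell I c δ X ξ).encard : ENat) : ENNReal) := by
    rw [ENNReal.ofReal_mul hR.le, mul_comm (ENNReal.ofReal _), ← hvol, ← setLIntegral_const]
    refine lintegral_mono fun ξ => ?_
    rw [← (shell_finite I hc δ _ ξ).cast_ncard_eq]
    rw [ENat.toENNReal_coe, ← ENNReal.ofReal_natCast]
    exact ENNReal.ofReal_le_ofReal (hU ξ)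
  have h3 := h2.trans h1
  rw [← ENNReal.ofReal_pow hδ.le, ← hfin.cast_ncard_eq, ENat.toENNReal_coe, ← ENNReal.ofReal_natCast,
    ← ENNReal.ofReal_mul (by positivity), ENNReal.ofReal_le_ofReal_iff (by positivity)] at h3
  exact h3

variable (K) in
/-- The exponent in the power saving of the lattice point count. -/
noncomputable def saving : ℝ := 1 / (finrank ℚ K * (rank K + 1))

theorem saving_pos : 0 < saving K := by
  have : (0 : ℝ) < finrank ℚ K := by exact_mod_cast finrank_pos
  unfold saving
  positivity

variable (K J) in
-- The thickness of the shells causes a relative error `O(δ)`, and the lattice error `μ^(-1/d)` gets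
-- divided by `δ^q`. Balancing means `δ^(q+1) = μ^(-1/d)`, that is, `δ = μ^(-saving K)`. The factor
-- `n^q` comes from `(1 - e^(-nδ))^q ≈ (nδ)^q`.
theorem exists_weightedPoints_estimate :
    ∃ C : ℝ, 0 < C ∧ ∀ F : Subgroup Kˣ, IsUnitComplement F → ∀ Y : Set (J → Kˣ), IsTransversal F Y →
      ∀ (I : J → (FractionalIdeal (𝓞 K)⁰ K)ˣ) (c : J → InfinitePlace K → ℝ),
      (∀ j w, 0 < c j w) → ∀ X : ℝ, 0 < X → ∀ μ : ℝ, 1 ≤ μ → (∀ j, μ ≤ density I c X j) →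
      (weightedPoints I c Y X).Finite ∧
      |((weightedPoints I c Y X).ncard : ℝ) - (Fintype.card J : ℝ) ^ rank K * regulator K *
        boxConst K ^ Fintype.card J * ∏ j, density I c X j| ≤
        C * (μ ^ (-saving K) * ∏ j, density I c X j) := by
  obtain ⟨C, hC, h⟩ := exists_shell_estimate K J
  have hR := regulator_pos K
  have hv := boxConst_pos (K := K)
  set n := Fintype.card J with hn
  set q := rank K with hq
  set R := regulator K with hRdef
  set v := boxConst K ^ n with hvdef
  have hv0 : 0 < v := by positivity
  -- `C1` serves the upper and `C2` the lower bound; `exp (n * q)` dominates `exp (n * q * δ)`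
  -- because `δ ≤ 1`.
  set C1 := R * (n ^ q * v * (n * q * Real.exp (n * q)) + C * Real.exp (n * q)) with hC1
  set C2 := R * (n ^ q * v * (q * n) + C) with hC2
  refine ⟨C1 + C2, by positivity, ?_⟩
  intro F hF Y hY I c hc X hX μ hμ hdens
  have hμ0 : 0 < μ := by linarith
  have hρ := density_pos I hc hX
  set P := ∏ j, density I c X j with hP
  have hP0 : 0 < P := Finset.prod_pos fun j _ => hρ j
  set δ := μ ^ (-saving K) with hδ
  have hδ0 : 0 < δ := by positivity
  have hθ := saving_pos (K := K)
  have hδ1 : δ ≤ 1 := Real.rpow_le_one_of_one_le_of_nonpos hμ (by linarith)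
  have hδq : μ ^ (-(1 / (finrank ℚ K : ℝ))) = δ ^ (q + 1) := by
    rw [hδ, ← Real.rpow_natCast, ← Real.rpow_mul hμ0.le]
    congr 1
    rw [saving]
    have : (finrank ℚ K : ℝ) ≠ 0 := by exact_mod_cast finrank_pos.ne'
    push_cast
    field_simp
    rw [hq]
  have hexpn : Real.exp (-δ) ^ n = Real.exp (-(n * δ)) := by
    rw [← Real.exp_nat_mul]; ring_nf
  have hnq : (0 : ℝ) ≤ n * q * δ := by positivity
  have hle1 : Real.exp (n * q * δ) ≤ Real.exp (n * q) := by
    apply Real.exp_le_exp.2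
    exact mul_le_of_le_one_right (by positivity) hδ1
  have hup : ∀ ξ, ((shell I c δ (Real.exp (q * δ) * X) ξ).ncard : ℝ) ≤
      (n * δ) ^ q * v * (Real.exp (n * q * δ) * P) + C * (δ ^ (q + 1) * (Real.exp (n * q) * P)) := by
    intro ξ
    have h1 := h I c hc (Real.exp (q * δ) * X) (by positivity) μ hμ (fun j => by
      rw [density_mul]
      refine (hdens j).trans (le_mul_of_one_le_left (hρ j).le ?_)
      exact Real.one_le_exp (by positivity)) δ hδ0.le ξ
    have h2 : ∏ j, density I c (Real.exp (q * δ) * X) j = Real.exp (n * q * δ) * P := by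
      simp_rw [density_mul]
      rw [Finset.prod_mul_distrib, Finset.prod_const, Finset.card_univ, ← Real.exp_nat_mul, ← hn,
        ← mul_assoc]
    rw [h2, hδq, hexpn] at h1
    have h3 := (abs_le.1 h1).2
    have h4 : (1 - Real.exp (-(n * δ))) ^ q ≤ (n * δ) ^ q := by
      have : Real.exp (-(n * δ)) ≤ 1 := Real.exp_le_one_iff.2 (by
        have : 0 ≤ n * δ := by positivity
        linarith)
      refine pow_le_pow_left₀ (by linarith) ?_ q
      have := Real.add_one_le_exp (-(n * δ))
      linarith
    calc _ ≤ (1 - Real.exp (-(n * δ))) ^ q * (v * (Real.exp (n * q * δ) * P)) + C * (δ ^ (q + 1) * (Real.exp (n * q * δ) * P)) := by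
          linarith
      _ ≤ (n * δ) ^ q * (v * (Real.exp (n * q * δ) * P)) + C * (δ ^ (q + 1) * (Real.exp (n * q) * P)) := by
          gcongr
      _ = _ := by ring
  obtain ⟨hfin, hA⟩ := weightedPoints_le hF hY I hc hδ0 hX hup
  refine ⟨hfin, ?_⟩
  have hlow : ∀ ξ, (n * δ) ^ q * (1 - q * (n * δ)) * (v * P) - C * (δ ^ (q + 1) * P) ≤
      ((shell I c δ X ξ).ncard : ℝ) := by
    intro ξ
    have h1 := h I c hc X hX μ hμ hdens δ hδ0.le ξ
    rw [hδq, hexpn] at h1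
    have h3 := (abs_le.1 h1).1
    have h4 := pow_mul_one_sub_le (n := n) (by positivity) hδ0.le q
    have h5 : (n * δ) ^ q * (1 - q * (n * δ)) * (v * P) ≤ (1 - Real.exp (-(n * δ))) ^ q * (v * P) := by
      gcongr
    linarith
  have hB := le_weightedPoints hF hY I hc hδ0 hX hfin hlow
  set N := ((weightedPoints I c Y X).ncard : ℝ) with hN
  have hδqpos : 0 < δ ^ q := by positivity
  have hA' : N ≤ R * (n ^ q * v * (Real.exp (n * q * δ) * P) + C * (δ * (Real.exp (n * q) * P))) := by
    refine le_of_mul_le_mul_right (hA.trans (le_of_eq ?_)) hδqpos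
    rw [mul_pow, pow_succ]; ring
  have hB' : R * (n ^ q * (1 - q * (n * δ)) * (v * P) - C * (δ * P)) ≤ N := by
    refine le_of_mul_le_mul_right ((le_of_eq ?_).trans hB) hδqpos
    rw [mul_pow, pow_succ]; ring
  have hexp2 : Real.exp (n * q * δ) ≤ 1 + (n * q * Real.exp (n * q)) * δ := by
    have h1 := exp_sub_one_le hnq
    have h2 : n * q * δ * Real.exp (n * q * δ) ≤ n * q * δ * Real.exp (n * q) := by gcongr
    linarith
  have hA'' : N ≤ n ^ q * R * v * P + C1 * (δ * P) := by
    refine hA'.trans ?_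
    calc _ ≤ R * (n ^ q * v * ((1 + (n * q * Real.exp (n * q)) * δ) * P) + C * (δ * (Real.exp (n * q) * P))) := by
          gcongr
      _ = _ := by rw [hC1]; ring
  have hB'' : n ^ q * R * v * P - C2 * (δ * P) ≤ N := by
    refine le_trans (le_of_eq ?_) hB'
    rw [hC2]; ring
  have e1 : 0 ≤ C1 * (δ * P) := by positivity
  have e2 : 0 ≤ C2 * (δ * P) := by positivity
  rw [abs_le]
  constructor <;> linarith

end Estimate
end CubicTorsor

namespace CubicTorsor

/-! ### Integrals over ordered pairs of variables. -/

section Polytope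

open MeasureTheory Set
open scoped ENNReal

/-- Lebesgue measure on the positive half-line. -/
noncomputable def posMeasure : Measure ℝ := volume.restrict (Ioi 0)

instance : SigmaFinite posMeasure := by unfold posMeasure; infer_instance

theorem lintegral_Ioi_shift (f : ℝ → ℝ≥0∞) (y : ℝ) :
    ∫⁻ z in Ioi y, f z = ∫⁻ k, f (y + k) ∂posMeasure := by
  unfold posMeasure
  rw [← lintegral_indicator measurableSet_Ioi, ← lintegral_indicator measurableSet_Ioi,
    ← lintegral_add_left_eq_self _ y]
  refine lintegral_congr fun k => ?_
  by_cases h : 0 < k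
  · rw [indicator_of_mem (by simpa using h), indicator_of_mem (by simpa using h)]
  · rw [indicator_of_notMem (by simpa using h), indicator_of_notMem (by simpa using h)]

/-- Split the plane along the diagonal; on each half the variables are the smaller coordinate and
the gap. -/
theorem lintegral_lintegral_order {f : ℝ → ℝ → ℝ≥0∞} (hf : Measurable (Function.uncurry f)) :
    ∫⁻ y, ∫⁻ z, f y z = ∫⁻ y, ∫⁻ k, (f y (y + k) + f (y + k) y) ∂posMeasure := by
  have h1 : ∀ y, ∫⁻ z, f y z = (∫⁻ z in Ioi y, f y z) + ∫⁻ z in Iio y, f y z := by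
    intro y
    rw [← lintegral_add_compl (f y) (measurableSet_Ioi (a := y)), compl_Ioi]
    congr 1
    exact setLIntegral_congr Iio_ae_eq_Iic.symm
  have hm1 : Measurable fun p : ℝ × ℝ => (Ioi p.1).indicator (f p.1) p.2 := by
    have : (fun p : ℝ × ℝ => (Ioi p.1).indicator (f p.1) p.2) =
        {p : ℝ × ℝ | p.1 < p.2}.indicator (Function.uncurry f) := by
      ext p; simp [indicator, Function.uncurry]
    rw [this]
    exact hf.indicator (measurableSet_lt measurable_fst measurable_snd)
  have hm2 : Measurable fun p : ℝ × ℝ => (Iio p.1).indicator (f p.1) p.2 := by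
    have : (fun p : ℝ × ℝ => (Iio p.1).indicator (f p.1) p.2) =
        {p : ℝ × ℝ | p.2 < p.1}.indicator (Function.uncurry f) := by
      ext p; simp [indicator, Function.uncurry]
    rw [this]
    exact hf.indicator (measurableSet_lt measurable_snd measurable_fst)
  simp_rw [h1]
  have e1 : ∀ y, ∫⁻ z in Ioi y, f y z = ∫⁻ z, (Ioi y).indicator (f y) z := fun y =>
    (lintegral_indicator measurableSet_Ioi _).symm
  have e2 : ∀ y, ∫⁻ z in Iio y, f y z = ∫⁻ z, (Iio y).indicator (f y) z := fun y =>
    (lintegral_indicator measurableSet_Iio _).symm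
  have e3 : ∫⁻ y, ∫⁻ z in Iio y, f y z = ∫⁻ y, ∫⁻ z in Ioi y, f z y := by
    simp_rw [e2]
    rw [lintegral_lintegral_swap hm2.aemeasurable]
    refine lintegral_congr fun z => ?_
    rw [← lintegral_indicator measurableSet_Ioi]
    refine lintegral_congr fun y => ?_
    simp [indicator]
  rw [lintegral_add_left, e3, ← lintegral_add_left]
  · refine lintegral_congr fun y => ?_
    rw [lintegral_Ioi_shift, lintegral_Ioi_shift, ← lintegral_add_left]
    exact hf.comp (measurable_const.prodMk (measurable_const_add y))
  · simp_rw [e1]; exact hm1.lintegral_prod_right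
  · simp_rw [e1]; exact hm1.lintegral_prod_right

theorem lintegral_lintegral_order_pos {f : ℝ → ℝ → ℝ≥0∞} (hf : Measurable (Function.uncurry f)) :
    ∫⁻ y, ∫⁻ z, f y z ∂posMeasure ∂posMeasure =
      ∫⁻ y, ∫⁻ k, (f y (y + k) + f (y + k) y) ∂posMeasure ∂posMeasure := by
  have hm : Measurable (Function.uncurry fun y z => (Ioi (0 : ℝ)).indicator (fun y => (Ioi (0 : ℝ)).indicator (f y) z) y) := by
    have : (Function.uncurry fun y z => (Ioi (0 : ℝ)).indicator (fun y => (Ioi (0 : ℝ)).indicator (f y) z) y) =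
        ((Ioi (0 : ℝ)) ×ˢ (Ioi (0 : ℝ))).indicator (Function.uncurry f) := by
      ext p
      by_cases h1 : 0 < p.1 <;> by_cases h2 : 0 < p.2 <;> simp [indicator, Function.uncurry, h1, h2]
    rw [this]
    exact hf.indicator (measurableSet_Ioi.prod measurableSet_Ioi)
  have key := lintegral_lintegral_order hm
  have hl : ∫⁻ y, ∫⁻ z, f y z ∂posMeasure ∂posMeasure =
      ∫⁻ y, ∫⁻ z, (Ioi (0 : ℝ)).indicator (fun y => (Ioi (0 : ℝ)).indicator (f y) z) y := by
    change ∫⁻ y in Ioi (0 : ℝ), (∫⁻ z, f y z ∂posMeasure) = _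
    rw [← lintegral_indicator measurableSet_Ioi]
    refine lintegral_congr fun y => ?_
    by_cases h : 0 < y
    · simp only [indicator, mem_Ioi, h, if_true]
      rw [posMeasure, ← lintegral_indicator measurableSet_Ioi]
      rfl
    · simp [indicator, h]
  have hr : ∫⁻ y, ∫⁻ k, (f y (y + k) + f (y + k) y) ∂posMeasure ∂posMeasure =
      ∫⁻ y, ∫⁻ k, ((Ioi (0 : ℝ)).indicator (fun y' => (Ioi (0 : ℝ)).indicator (f y') (y + k)) y +
        (Ioi (0 : ℝ)).indicator (fun y' => (Ioi (0 : ℝ)).indicator (f y') y) (y + k)) ∂posMeasure := by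
    change ∫⁻ y in Ioi (0 : ℝ), (∫⁻ k, (f y (y + k) + f (y + k) y) ∂posMeasure) = _
    rw [← lintegral_indicator measurableSet_Ioi]
    refine lintegral_congr fun y => ?_
    by_cases h : 0 < y
    · simp only [indicator, mem_Ioi, h, if_true]
      change ∫⁻ k in Ioi 0, _ = ∫⁻ k in Ioi 0, _
      refine setLIntegral_congr_fun measurableSet_Ioi fun k hk => ?_
      have : 0 < y + k := add_pos h hk
      simp [this]
    · simp [indicator, h]
  rw [hl, hr, key]

/-- For fixed `m = a - b` one has `a + b = |m| + 2 min a b`, and integrating over the smaller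
coordinate yields `exp (-|m|) / 2`. -/
theorem lintegral_pair {g : ℝ → ℝ≥0∞} (hg : Measurable g) :
    ∫⁻ a, ∫⁻ b, ENNReal.ofReal (Real.exp (-(a + b))) * g (a - b) ∂posMeasure ∂posMeasure =
      ENNReal.ofReal (1 / 2) * ∫⁻ m, ENNReal.ofReal (Real.exp (-|m|)) * g m := by
  have hm : Measurable (Function.uncurry fun a b : ℝ => ENNReal.ofReal (Real.exp (-(a + b))) * g (a - b)) := by
    unfold Function.uncurry; fun_prop
  rw [lintegral_lintegral_order_pos hm]
  have h1 : ∀ y k : ℝ, ENNReal.ofReal (Real.exp (-(y + (y + k)))) * g (y - (y + k)) +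
      ENNReal.ofReal (Real.exp (-((y + k) + y))) * g ((y + k) - y) =
      ENNReal.ofReal (Real.exp (-(2 * y))) * (ENNReal.ofReal (Real.exp (-k)) * (g (-k) + g k)) := by
    intro y k
    rw [← mul_assoc, ← ENNReal.ofReal_mul (Real.exp_pos _).le, ← Real.exp_add, mul_add]
    congr 3 <;> ring_nf
  simp_rw [h1]
  have hmk : Measurable fun k => ENNReal.ofReal (Real.exp (-k)) * (g (-k) + g k) := by fun_prop
  simp_rw [lintegral_const_mul _ hmk]
  rw [lintegral_mul_const _ (by fun_prop)]
  congr 1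
  · unfold posMeasure
    have : ∀ y : ℝ, Real.exp (-(2 * y)) = Real.exp (-2 * y) := fun y => by ring_nf
    simp_rw [this]
    rw [← ofReal_integral_eq_lintegral_ofReal]
    · congr 1
      rw [integral_exp_mul_Ioi (by norm_num)]
      norm_num
    · exact integrableOn_exp_mul_Ioi (by norm_num) 0
    · exact Filter.Eventually.of_forall fun _ => (Real.exp_pos _).le
  · rw [← lintegral_add_compl (fun m => ENNReal.ofReal (Real.exp (-|m|)) * g m) (measurableSet_Ioi (a := (0:ℝ))),
      compl_Ioi, setLIntegral_congr Iio_ae_eq_Iic.symm]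
    have e1 : ∫⁻ x in Iio (0 : ℝ), ENNReal.ofReal (Real.exp (-|x|)) * g x =
        ∫⁻ x in Ioi (0 : ℝ), ENNReal.ofReal (Real.exp (-|x|)) * g (-x) := by
      rw [← lintegral_indicator measurableSet_Iio, ← lintegral_indicator measurableSet_Ioi,
        ← lintegral_neg_eq_self]
      refine lintegral_congr fun x => ?_
      by_cases h : 0 < x <;> simp [indicator, h]
    rw [e1, ← lintegral_add_left (by fun_prop)]
    change ∫⁻ k in Ioi 0, _ = _
    refine setLIntegral_congr_fun measurableSet_Ioi fun k hk => ?_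
    rw [abs_of_pos hk, mul_add, add_comm]

theorem lintegral_exp_sum {ι : Type*} (s : Finset ι) (c b : ι → ℝ) (hb : ∀ i ∈ s, 0 < b i)
    {f : ℝ → ℝ} (hf : ∀ k, 0 < k → f k = ∑ i ∈ s, c i * Real.exp (-b i * k)) (hpos : ∀ k, 0 < k → 0 ≤ f k) :
    ∫⁻ k, ENNReal.ofReal (f k) ∂posMeasure = ENNReal.ofReal (∑ i ∈ s, c i / b i) := by
  have hint : ∀ i ∈ s, IntegrableOn (fun k => c i * Real.exp (-b i * k)) (Ioi 0) := fun i hi =>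
    (integrableOn_exp_mul_Ioi (by have := hb i hi; linarith) 0).const_mul _
  have h1 : ∫⁻ k, ENNReal.ofReal (f k) ∂posMeasure =
      ∫⁻ k in Ioi 0, ENNReal.ofReal (∑ i ∈ s, c i * Real.exp (-b i * k)) := by
    refine setLIntegral_congr_fun measurableSet_Ioi fun k hk => ?_
    rw [hf k hk]
  rw [h1, ← ofReal_integral_eq_lintegral_ofReal]
  · congr 1
    rw [integral_finsetSum _ hint]
    refine Finset.sum_congr rfl fun i hi => ?_
    rw [integral_const_mul, integral_exp_mul_Ioi (by have := hb i hi; linarith)]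
    simp [div_eq_mul_inv]
  · exact integrable_finsetSum _ hint
  · filter_upwards [ae_restrict_mem measurableSet_Ioi] with k hk
    have := hpos k hk
    rwa [hf k hk] at this

end Polytope
end CubicTorsor

namespace CubicTorsor

/-! ### A cyclic exponential integral in three variables. -/

section Polytope

open MeasureTheory Set
open scoped ENNReal

theorem lintegral_exp_abs_pos {g k : ℝ} (hg : 0 < g) (hk : 0 < k) :
    ∫⁻ u, ENNReal.ofReal (Real.exp (-(|u - g| + |u| + |u + k|))) ∂posMeasure =
      ENNReal.ofReal (Real.exp (-(g + k)) * (1 - 2 / 3 * Real.exp (-g))) := by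
  have h0 : Ioc 0 g ∪ Ioi g = Ioi (0 : ℝ) := Ioc_union_Ioi_eq_Ioi hg.le
  have e1 : ∫⁻ u in Ioc 0 g, ENNReal.ofReal (Real.exp (-(|u - g| + |u| + |u + k|))) =
      ENNReal.ofReal (Real.exp (-(g + k)) * (1 - Real.exp (-g))) := by
    have : ∫⁻ u in Ioc 0 g, ENNReal.ofReal (Real.exp (-(|u - g| + |u| + |u + k|))) =
        ∫⁻ u in Ioc 0 g, ENNReal.ofReal (Real.exp (-(g + k)) * Real.exp (-u)) := by
      refine setLIntegral_congr_fun measurableSet_Ioc fun u hu => ?_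
      rw [abs_of_nonpos (by linarith [hu.2]), abs_of_pos hu.1, abs_of_pos (by linarith [hu.1]), ← Real.exp_add]
      ring_nf
    rw [this, ← ofReal_integral_eq_lintegral_ofReal]
    · rw [integral_const_mul, ← intervalIntegral.integral_of_le hg.le]
      simp
    · exact (Continuous.integrableOn_Ioc (by fun_prop))
    · exact Filter.Eventually.of_forall fun u => by positivity
  have e2 : ∫⁻ u in Ioi g, ENNReal.ofReal (Real.exp (-(|u - g| + |u| + |u + k|))) =
      ENNReal.ofReal (Real.exp (-(g + k)) * (1 / 3 * Real.exp (-g))) := by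
    rw [lintegral_Ioi_shift, lintegral_exp_sum {()} (fun _ => Real.exp (-(g + k)) * Real.exp (-g)) (fun _ => 3)]
    · simp; congr 1; ring
    · simp
    · intro v hv
      rw [Finset.sum_singleton, ← Real.exp_add, ← Real.exp_add, abs_of_pos (by linarith), abs_of_pos (by linarith),
        abs_of_pos (by linarith)]
      ring_nf
    · intro v _; positivity
  rw [posMeasure, ← h0, lintegral_union measurableSet_Ioi (by
    rw [Set.disjoint_left]; intro x hx hx'; exact absurd hx' (not_lt.2 hx.2)), e1, e2, ← ENNReal.ofReal_add]
  · congr 1; ring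
  · have : Real.exp (-g) ≤ 1 := Real.exp_le_one_iff.2 (by linarith)
    have := Real.exp_pos (-(g + k))
    exact mul_nonneg this.le (by linarith)
  · positivity

/-- The integral of `exp (-(|τ| + |τ + g| + |τ + g + k|))` over `τ`. -/
noncomputable def pointKernel (g k : ℝ) : ℝ :=
  Real.exp (-(g + k)) * (2 - 2 / 3 * (Real.exp (-g) + Real.exp (-k)))

theorem pointKernel_nonneg {g k : ℝ} (hg : 0 < g) (hk : 0 < k) : 0 ≤ pointKernel g k := by
  have : Real.exp (-g) ≤ 1 := Real.exp_le_one_iff.2 (by linarith)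
  have : Real.exp (-k) ≤ 1 := Real.exp_le_one_iff.2 (by linarith)
  unfold pointKernel
  exact mul_nonneg (Real.exp_pos _).le (by linarith)

/-- Move the middle zero of the three absolute values to the origin. The two half-lines then give
the same integral with `g` and `k` exchanged. -/
theorem lintegral_exp_abs {g k : ℝ} (hg : 0 < g) (hk : 0 < k) :
    ∫⁻ τ, ENNReal.ofReal (Real.exp (-(|τ| + |τ + g| + |τ + (g + k)|))) =
      ENNReal.ofReal (pointKernel g k) := by
  rw [← lintegral_sub_right_eq_self _ g, ← lintegral_add_compl _ (measurableSet_Ioi (a := (0:ℝ))),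
      compl_Ioi, setLIntegral_congr Iio_ae_eq_Iic.symm]
  have e1 : ∫⁻ u in Ioi 0, ENNReal.ofReal (Real.exp (-(|u - g| + |u - g + g| + |u - g + (g + k)|))) =
      ENNReal.ofReal (Real.exp (-(g + k)) * (1 - 2 / 3 * Real.exp (-g))) := by
    rw [← lintegral_exp_abs_pos hg hk]
    refine lintegral_congr fun u => ?_
    ring_nf
  have e2 : ∫⁻ u in Iio 0, ENNReal.ofReal (Real.exp (-(|u - g| + |u - g + g| + |u - g + (g + k)|))) =
      ENNReal.ofReal (Real.exp (-(k + g)) * (1 - 2 / 3 * Real.exp (-k))) := by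
    rw [← lintegral_exp_abs_pos hk hg]
    rw [posMeasure, ← lintegral_indicator measurableSet_Iio, ← lintegral_indicator measurableSet_Ioi,
        ← lintegral_neg_eq_self]
    refine lintegral_congr fun x => ?_
    have h1 : |-x - g| = |x + g| := by rw [← abs_neg]; ring_nf
    have h2 : |-x - g + g| = |x| := by rw [← abs_neg]; ring_nf
    have h3 : |-x - g + (g + k)| = |x - k| := by rw [← abs_neg]; ring_nf
    by_cases h : 0 < x
    · simp only [indicator, mem_Iio, mem_Ioi, h, if_true, Left.neg_neg_iff, h1, h2, h3]
      ring_nf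
    · simp [indicator, h]
  have : ∀ g : ℝ, 0 < g → Real.exp (-g) ≤ 1 := fun g hg => Real.exp_le_one_iff.2 (by linarith)
  have h1 := this g hg
  have h2 := this k hk
  rw [e1, e2, ← ENNReal.ofReal_add, pointKernel]
  · congr 1; rw [add_comm k g]; ring
  · exact mul_nonneg (Real.exp_pos _).le (by linarith)
  · exact mul_nonneg (Real.exp_pos _).le (by linarith)

/-- The exponential of minus a piecewise linear function on `ℝ³`. -/
noncomputable def cyclicExp (x y z : ℝ) : ℝ :=
  Real.exp (-(|x| + |y| + |z| + max (x - y) (max (y - z) (z - x))))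

theorem cyclicExp_rotate (x y z : ℝ) : cyclicExp x y z = cyclicExp y z x := by
  unfold cyclicExp
  rw [max_comm (x - y), max_assoc]
  ring_nf

theorem measurable_cyclicExp {α : Type*} [MeasurableSpace α] {a b c : α → ℝ} (ha : Measurable a)
    (hb : Measurable b) (hc : Measurable c) :
    Measurable fun t => ENNReal.ofReal (cyclicExp (a t) (b t) (c t)) := by
  unfold cyclicExp
  have h1 : Measurable fun t => |a t| := by fun_prop
  have h2 : Measurable fun t => |b t| := by fun_prop
  have h3 : Measurable fun t => |c t| := by fun_prop
  have h4 : Measurable fun t => max (a t - b t) (max (b t - c t) (c t - a t)) :=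
    (ha.sub hb).max ((hb.sub hc).max (hc.sub ha))
  exact ENNReal.measurable_ofReal.comp (Real.measurable_exp.comp (((h1.add h2).add h3).add h4).neg)

/-- If the three values increase in cyclic order, the largest cyclic difference is the wrap-around
`g + k`; in the other orientation it is the larger gap. -/
theorem lintegral_cyclicExp_translate {g k : ℝ} (hg : 0 < g) (hk : 0 < k) :
    ∫⁻ τ, (ENNReal.ofReal (cyclicExp τ (τ + g) (τ + (g + k))) +
      ENNReal.ofReal (cyclicExp τ (τ + (g + k)) (τ + g))) =
      ENNReal.ofReal (pointKernel g k * Real.exp (-(g + k))) +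
      ENNReal.ofReal (pointKernel g k * Real.exp (-max g k)) := by
  have e1 : ∀ τ, cyclicExp τ (τ + g) (τ + (g + k)) =
      Real.exp (-(|τ| + |τ + g| + |τ + (g + k)|)) * Real.exp (-(g + k)) := by
    intro τ
    rw [cyclicExp, ← Real.exp_add]
    have : max (τ - (τ + g)) (max (τ + g - (τ + (g + k))) (τ + (g + k) - τ)) = g + k := by
      rw [max_eq_right, max_eq_right]
      · ring
      · linarith
      · rw [max_eq_right] <;> linarith
    rw [this]; ring_nf
  have e2 : ∀ τ, cyclicExp τ (τ + (g + k)) (τ + g) =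
      Real.exp (-(|τ| + |τ + g| + |τ + (g + k)|)) * Real.exp (-max g k) := by
    intro τ
    rw [cyclicExp, ← Real.exp_add]
    have : max (τ - (τ + (g + k))) (max (τ + (g + k) - (τ + g)) (τ + g - τ)) = max g k := by
      rw [max_eq_right]
      · rw [max_comm]; congr 1 <;> ring
      · exact le_max_of_le_left (by linarith)
    rw [this]; ring_nf
  have hq := pointKernel_nonneg hg hk
  simp_rw [e1, e2]
  have hm : Measurable fun τ : ℝ => Real.exp (-(|τ| + |τ + g| + |τ + (g + k)|)) := by fun_prop
  rw [lintegral_add_left (by fun_prop)]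
  have h3 : ∀ r : ℝ, ∫⁻ τ, ENNReal.ofReal (Real.exp (-(|τ| + |τ + g| + |τ + (g + k)|)) * Real.exp r) =
      ENNReal.ofReal (pointKernel g k * Real.exp r) := by
    intro r
    simp_rw [ENNReal.ofReal_mul (Real.exp_pos _).le]
    rw [lintegral_mul_const _ (by fun_prop), lintegral_exp_abs hg hk, ← ENNReal.ofReal_mul hq]
  rw [h3, h3]

theorem posMeasure_ae : ∀ᵐ x ∂posMeasure, 0 < x := ae_restrict_mem measurableSet_Ioi

theorem lintegral_pos_congr {f g : ℝ → ℝ≥0∞} (h : ∀ x, 0 < x → f x = g x) :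
    ∫⁻ x, f x ∂posMeasure = ∫⁻ x, g x ∂posMeasure :=
  lintegral_congr_ae (posMeasure_ae.mono h)

theorem lintegral_pointKernel_add :
    ∫⁻ g, ∫⁻ k, ENNReal.ofReal (pointKernel g k * Real.exp (-(g + k))) ∂posMeasure ∂posMeasure =
      ENNReal.ofReal (5 / 18) := by
  have h1 : ∀ g, 0 < g → ∫⁻ k, ENNReal.ofReal (pointKernel g k * Real.exp (-(g + k))) ∂posMeasure =
      ENNReal.ofReal (Real.exp (-2 * g) - 1 / 3 * Real.exp (-3 * g) - 2 / 9 * Real.exp (-2 * g)) := by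
    intro g hg
    rw [lintegral_exp_sum Finset.univ
      (![2 * Real.exp (-2 * g), -(2 / 3) * Real.exp (-3 * g), -(2 / 3) * Real.exp (-2 * g)] : Fin 3 → ℝ)
      (![2, 2, 3] : Fin 3 → ℝ)]
    · simp only [Fin.sum_univ_three]; simp; congr 1; ring
    · intro i _; fin_cases i <;> simp
    · intro k _
      simp only [Fin.sum_univ_three]
      simp only [Matrix.cons_val]
      rw [pointKernel]
      have : ∀ a b c : ℝ, Real.exp a * (2 - 2 / 3 * (Real.exp b + Real.exp c)) * Real.exp a =
        2 * Real.exp (a + a) - 2 / 3 * Real.exp (a + a + b) - 2 / 3 * Real.exp (a + a + c) := by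
        intro a b c; simp only [Real.exp_add]; ring
      rw [this]
      simp only [mul_assoc, ← Real.exp_add]
      ring_nf
    · intro k hk
      exact mul_nonneg (pointKernel_nonneg hg hk) (Real.exp_pos _).le
  rw [lintegral_pos_congr h1, lintegral_exp_sum Finset.univ (![1, -(1 / 3), -(2 / 9)] : Fin 3 → ℝ)
      (![2, 3, 2] : Fin 3 → ℝ)]
  · simp only [Fin.sum_univ_three, Matrix.cons_val]; norm_num
  · intro i _; fin_cases i <;> simp
  · intro k _
    simp only [Fin.sum_univ_three, Matrix.cons_val]
    ring
  · intro k hk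
    have h2 : Real.exp (-3 * k) ≤ Real.exp (-2 * k) := Real.exp_le_exp.2 (by linarith)
    have h3 := Real.exp_pos (-2 * k)
    linarith

theorem lintegral_pointKernel_max :
    ∫⁻ g, ∫⁻ k, ENNReal.ofReal (pointKernel g k * Real.exp (-max g k)) ∂posMeasure ∂posMeasure =
      ENNReal.ofReal (7 / 18) := by
  have hm : Measurable (Function.uncurry fun g k => ENNReal.ofReal (pointKernel g k * Real.exp (-max g k))) := by
    unfold Function.uncurry pointKernel; fun_prop
  rw [lintegral_lintegral_order_pos hm]
  have h1 : ∀ g, 0 < g → ∫⁻ k, (ENNReal.ofReal (pointKernel g (g + k) * Real.exp (-max g (g + k))) +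
      ENNReal.ofReal (pointKernel (g + k) g * Real.exp (-max (g + k) g))) ∂posMeasure =
      ENNReal.ofReal (2 * Real.exp (-3 * g) - 2 / 3 * Real.exp (-4 * g) - 4 / 9 * Real.exp (-4 * g)) := by
    intro g hg
    have : ∫⁻ k, (ENNReal.ofReal (pointKernel g (g + k) * Real.exp (-max g (g + k))) +
      ENNReal.ofReal (pointKernel (g + k) g * Real.exp (-max (g + k) g))) ∂posMeasure =
      ∫⁻ k, ENNReal.ofReal (2 * (pointKernel g (g + k) * Real.exp (-(g + k)))) ∂posMeasure := by
      refine lintegral_pos_congr fun k hk => ?_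
      have h2 : 0 < g + k := by linarith
      have h3 := pointKernel_nonneg hg h2
      have h4 : pointKernel (g + k) g = pointKernel g (g + k) := by
        unfold pointKernel; ring_nf
      rw [h4, max_eq_right (by linarith), max_eq_left (by linarith), ← ENNReal.ofReal_add (by positivity) (by positivity),
        two_mul]
    rw [this, lintegral_exp_sum Finset.univ
      (![4 * Real.exp (-3 * g), -(4 / 3) * Real.exp (-4 * g), -(4 / 3) * Real.exp (-4 * g)] : Fin 3 → ℝ)
      (![2, 2, 3] : Fin 3 → ℝ)]
    · simp only [Fin.sum_univ_three]; simp; congr 1; ring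
    · intro i _; fin_cases i <;> simp
    · intro k _
      simp only [Fin.sum_univ_three]
      simp only [Matrix.cons_val]
      rw [pointKernel]
      have : ∀ a b c e : ℝ, 2 * (Real.exp a * (2 - 2 / 3 * (Real.exp b + Real.exp c)) * Real.exp e) =
        4 * Real.exp (a + e) - 4 / 3 * Real.exp (a + e + b) - 4 / 3 * Real.exp (a + e + c) := by
        intro a b c e; simp only [Real.exp_add]; ring
      rw [this]
      simp only [mul_assoc, ← Real.exp_add]
      ring_nf
    · intro k hk
      have := pointKernel_nonneg hg (add_pos hg hk)
      positivity
  rw [lintegral_pos_congr h1, lintegral_exp_sum Finset.univ (![2, -(2 / 3), -(4 / 9)] : Fin 3 → ℝ)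
      (![3, 4, 4] : Fin 3 → ℝ)]
  · simp only [Fin.sum_univ_three, Matrix.cons_val]; norm_num
  · intro i _; fin_cases i <;> simp
  · intro k _
    simp only [Fin.sum_univ_three, Matrix.cons_val]
    ring
  · intro k hk
    have h2 : Real.exp (-4 * k) ≤ Real.exp (-3 * k) := Real.exp_le_exp.2 (by linarith)
    have h3 := Real.exp_pos (-3 * k)
    linarith

/-- `cyclicExp` relative to its first argument. -/
noncomputable def cyclicShift (x g h : ℝ) : ℝ≥0∞ := ENNReal.ofReal (cyclicExp x (x + g) (x + h))

theorem measurable_cyclicShift {α : Type*} [MeasurableSpace α] {a b c : α → ℝ} (ha : Measurable a)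
    (hb : Measurable b) (hc : Measurable c) :
    Measurable fun t => cyclicShift (a t) (b t) (c t) :=
  measurable_cyclicExp ha (ha.add hb) (ha.add hc)

/-- The integral of `cyclicExp` over two arguments at least `y`, with one equal to `y`. -/
noncomputable def cyclicHalf (x y : ℝ) : ℝ≥0∞ :=
  ∫⁻ h, (ENNReal.ofReal (cyclicExp x y (y + h)) + ENNReal.ofReal (cyclicExp x (y + h) y)) ∂posMeasure

theorem measurable_cyclicHalf : Measurable (Function.uncurry cyclicHalf) := by
  have : Measurable fun p : (ℝ × ℝ) × ℝ => ENNReal.ofReal (cyclicExp p.1.1 p.1.2 (p.1.2 + p.2)) +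
      ENNReal.ofReal (cyclicExp p.1.1 (p.1.2 + p.2) p.1.2) :=
    (measurable_cyclicExp (by fun_prop) (by fun_prop) (by fun_prop)).add
      (measurable_cyclicExp (by fun_prop) (by fun_prop) (by fun_prop))
  exact this.lintegral_prod_right

theorem lintegral_cyclicExp_eq_half (x : ℝ) :
    ∫⁻ y, ∫⁻ z, ENNReal.ofReal (cyclicExp x y z) = ∫⁻ y, cyclicHalf x y := by
  have hm : Measurable (Function.uncurry fun y z => ENNReal.ofReal (cyclicExp x y z)) :=
    measurable_cyclicExp (a := fun _ : ℝ × ℝ => x) (b := Prod.fst) (c := Prod.snd)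
      measurable_const measurable_fst measurable_snd
  exact lintegral_lintegral_order hm

theorem measurable_lintegral_cyclicShift : Measurable fun p : ℝ × ℝ =>
    ∫⁻ h, (cyclicShift p.1 p.2 (p.2 + h) + cyclicShift p.1 (p.2 + h) p.2) ∂posMeasure := by
  have : Measurable fun q : (ℝ × ℝ) × ℝ => cyclicShift q.1.1 q.1.2 (q.1.2 + q.2) +
      cyclicShift q.1.1 (q.1.2 + q.2) q.1.2 :=
    (measurable_cyclicShift (by fun_prop) (by fun_prop) (by fun_prop)).add
      (measurable_cyclicShift (by fun_prop) (by fun_prop) (by fun_prop))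
  exact this.lintegral_prod_right

/-- Any of the three arguments may be the smallest, and rotation carries each case to the first;
hence the factor `3`. -/
theorem lintegral_cyclicHalf (x : ℝ) :
    ∫⁻ g, (cyclicHalf x (x + g) + cyclicHalf (x + g) x) ∂posMeasure =
      3 * ∫⁻ g, ∫⁻ h, (cyclicShift x g (g + h) + cyclicShift x (g + h) g) ∂posMeasure ∂posMeasure := by
  have m0 : Measurable fun p : ℝ × ℝ => ENNReal.ofReal (cyclicExp x (x + p.1) (x + p.1 + p.2)) +
      ENNReal.ofReal (cyclicExp x (x + p.1 + p.2) (x + p.1)) :=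
    (measurable_cyclicExp (by fun_prop) (by fun_prop) (by fun_prop)).add
      (measurable_cyclicExp (by fun_prop) (by fun_prop) (by fun_prop))
  have m1 : Measurable fun g => cyclicHalf x (x + g) := m0.lintegral_prod_right
  rw [lintegral_add_left m1]
  have t1 : ∫⁻ g, cyclicHalf x (x + g) ∂posMeasure =
      ∫⁻ g, ∫⁻ h, (cyclicShift x g (g + h) + cyclicShift x (g + h) g) ∂posMeasure ∂posMeasure := by
    refine lintegral_congr fun g => lintegral_congr fun h => ?_
    simp only [cyclicShift, add_assoc]
  have t2 : ∫⁻ g, cyclicHalf (x + g) x ∂posMeasure =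
      ∫⁻ g, ∫⁻ h, (cyclicShift x h g + cyclicShift x g h) ∂posMeasure ∂posMeasure := by
    refine lintegral_congr fun g => lintegral_congr fun h => ?_
    simp only [cyclicShift]
    rw [cyclicExp_rotate (x + g), ← cyclicExp_rotate x]
  have hsymm : Measurable (Function.uncurry fun g h => cyclicShift x h g + cyclicShift x g h) :=
    (measurable_cyclicShift measurable_const measurable_snd measurable_fst).add
      (measurable_cyclicShift measurable_const measurable_fst measurable_snd)
  have t3 : ∫⁻ g, ∫⁻ h, (cyclicShift x (g + h) g + cyclicShift x g (g + h) +
      (cyclicShift x g (g + h) + cyclicShift x (g + h) g)) ∂posMeasure ∂posMeasure =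
      2 * ∫⁻ g, ∫⁻ h, (cyclicShift x g (g + h) + cyclicShift x (g + h) g) ∂posMeasure ∂posMeasure := by
    have mm : Measurable fun p : ℝ × ℝ => cyclicShift x p.1 (p.1 + p.2) + cyclicShift x (p.1 + p.2) p.1 :=
      (measurable_cyclicShift (by fun_prop) (by fun_prop) (by fun_prop)).add
        (measurable_cyclicShift (by fun_prop) (by fun_prop) (by fun_prop))
    rw [← lintegral_const_mul _ mm.lintegral_prod_right]
    refine lintegral_congr fun g => ?_
    have mg : Measurable fun h : ℝ => cyclicShift x g (g + h) + cyclicShift x (g + h) g :=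
      (measurable_cyclicShift (by fun_prop) (by fun_prop) (by fun_prop)).add
        (measurable_cyclicShift (by fun_prop) (by fun_prop) (by fun_prop))
    rw [← lintegral_const_mul _ mg]
    refine lintegral_congr fun h => ?_
    ring
  rw [t1, t2, lintegral_lintegral_order_pos hsymm, t3]
  ring

theorem lintegral_cyclicShift :
    ∫⁻ x, ∫⁻ g, ∫⁻ h, (cyclicShift x g (g + h) + cyclicShift x (g + h) g) ∂posMeasure ∂posMeasure =
      ∫⁻ g, ∫⁻ h, (ENNReal.ofReal (pointKernel g h * Real.exp (-(g + h))) +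
      ENNReal.ofReal (pointKernel g h * Real.exp (-max g h))) ∂posMeasure ∂posMeasure := by
  have m4 := measurable_lintegral_cyclicShift
  rw [lintegral_lintegral_swap m4.aemeasurable]
  refine lintegral_pos_congr fun g hg => ?_
  have m5 : Measurable fun q : ℝ × ℝ => cyclicShift q.1 g (g + q.2) + cyclicShift q.1 (g + q.2) g :=
    (measurable_cyclicShift (by fun_prop) (by fun_prop) (by fun_prop)).add
      (measurable_cyclicShift (by fun_prop) (by fun_prop) (by fun_prop))
  rw [lintegral_lintegral_swap m5.aemeasurable]
  exact lintegral_pos_congr fun h hh => lintegral_cyclicExp_translate hg hh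

/-- After rotating the smallest argument to the front, the two orders of the others contribute `3 *
(5/18 + 7/18)`. -/
theorem lintegral_cyclicExp :
    ∫⁻ x, ∫⁻ y, ∫⁻ z, ENNReal.ofReal (cyclicExp x y z) = 2 := by
  have m4 := measurable_lintegral_cyclicShift
  rw [lintegral_congr lintegral_cyclicExp_eq_half, lintegral_lintegral_order measurable_cyclicHalf,
    lintegral_congr lintegral_cyclicHalf, lintegral_const_mul _ m4.lintegral_prod_right,
    lintegral_cyclicShift]
  have mA : Measurable fun p : ℝ × ℝ => ENNReal.ofReal (pointKernel p.1 p.2 * Real.exp (-(p.1 + p.2))) := by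
    unfold pointKernel; fun_prop
  have s4 : ∫⁻ g, ∫⁻ h, (ENNReal.ofReal (pointKernel g h * Real.exp (-(g + h))) +
      ENNReal.ofReal (pointKernel g h * Real.exp (-max g h))) ∂posMeasure ∂posMeasure =
      ENNReal.ofReal (5 / 18) + ENNReal.ofReal (7 / 18) := by
    rw [← lintegral_pointKernel_add, ← lintegral_pointKernel_max, ← lintegral_add_left mA.lintegral_prod_right]
    refine lintegral_congr fun g => ?_
    have mg : Measurable fun h : ℝ => ENNReal.ofReal (pointKernel g h * Real.exp (-(g + h))) :=
      mA.comp (measurable_const.prodMk measurable_id)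
    rw [lintegral_add_left mg]
  rw [s4, ← ENNReal.ofReal_add (by norm_num) (by norm_num)]
  have : (3 : ℝ≥0∞) = ENNReal.ofReal 3 := by simp
  rw [this, ← ENNReal.ofReal_mul (by norm_num)]
  norm_num

end Polytope
end CubicTorsor

namespace CubicTorsor

/-! ### The volume of the polytope. -/

section Volume

open MeasureTheory Set
open scoped ENNReal

theorem lintegral_pi_insertNth {n : ℕ} (m : Fin (n + 1) → Measure ℝ) [∀ i, SigmaFinite (m i)]
    (i : Fin (n + 1)) {f : (Fin (n + 1) → ℝ) → ℝ≥0∞} (hf : Measurable f) :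
    ∫⁻ x, f x ∂Measure.pi m =
      ∫⁻ t, ∫⁻ y, f (i.insertNth t y) ∂Measure.pi (fun k => m (i.succAbove k)) ∂m i := by
  have h := (measurePreserving_piFinSuccAbove m i).symm
  rw [← h.lintegral_comp hf, lintegral_prod]
  · rfl
  · exact (hf.comp (MeasurableEquiv.measurable _)).aemeasurable

theorem lintegral_pi_insertNth_symm {n : ℕ} (m : Fin (n + 1) → Measure ℝ) [∀ i, SigmaFinite (m i)]
    (i : Fin (n + 1)) {f : (Fin (n + 1) → ℝ) → ℝ≥0∞} (hf : Measurable f) :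
    ∫⁻ x, f x ∂Measure.pi m =
      ∫⁻ y, ∫⁻ t, f (i.insertNth t y) ∂m i ∂Measure.pi (fun k => m (i.succAbove k)) := by
  have h := (measurePreserving_piFinSuccAbove m i).symm
  rw [← h.lintegral_comp hf, lintegral_prod_symm]
  · rfl
  · exact (hf.comp (MeasurableEquiv.measurable _)).aemeasurable

theorem measurable_insertNth {n : ℕ} (i : Fin (n + 1)) :
    Measurable fun p : ℝ × (Fin n → ℝ) => (i.insertNth p.1 p.2 : Fin (n + 1) → ℝ) :=
  (MeasurableEquiv.piFinSuccAbove (fun _ : Fin (n + 1) => ℝ) i).symm.measurable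

theorem lintegral_pi_zero (m : Fin 0 → Measure ℝ) (f : (Fin 0 → ℝ) → ℝ≥0∞) :
    ∫⁻ x, f x ∂Measure.pi m = f ![] := by
  rw [Measure.pi_of_empty m ![], lintegral_dirac]

theorem lintegral_pi_cons {n : ℕ} (m : Measure ℝ) [SigmaFinite m]
    {f : (Fin (n + 1) → ℝ) → ℝ≥0∞} (hf : Measurable f) :
    ∫⁻ x, f x ∂Measure.pi (fun _ => m) =
      ∫⁻ t, ∫⁻ y, f (Matrix.vecCons t y) ∂Measure.pi (fun _ => m) ∂m := by
  rw [lintegral_pi_insertNth _ 0 hf]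
  simp only [Fin.insertNth_zero]
  rfl

theorem lintegral_pi_six (m : Measure ℝ) [SigmaFinite m]
    {f : (Fin 6 → ℝ) → ℝ≥0∞} (hf : Measurable f) :
    ∫⁻ x, f x ∂Measure.pi (fun _ => m) =
      ∫⁻ a, ∫⁻ b, ∫⁻ c, ∫⁻ d, ∫⁻ e, ∫⁻ g, f ![a, b, c, d, e, g] ∂m ∂m ∂m ∂m ∂m ∂m := by
  have hc : ∀ {n : ℕ} {f : (Fin (n + 1) → ℝ) → ℝ≥0∞} (_ : Measurable f) (t : ℝ),
      Measurable fun y : Fin n → ℝ => f (Matrix.vecCons t y) := by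
    intro n f hf t
    have := hf.comp ((measurable_insertNth (n := n) 0).comp (measurable_const (a := t) |>.prodMk measurable_id))
    simp only [Function.comp_def, Fin.insertNth_zero] at this
    exact this
  rw [lintegral_pi_cons m hf]
  refine lintegral_congr fun a => ?_
  have h1 := hc hf a
  rw [lintegral_pi_cons m h1]
  refine lintegral_congr fun b => ?_
  have h2 := hc h1 b
  rw [lintegral_pi_cons m h2]
  refine lintegral_congr fun c => ?_
  have h3 := hc h2 c
  rw [lintegral_pi_cons m h3]
  refine lintegral_congr fun d => ?_
  have h4 := hc h3 d
  rw [lintegral_pi_cons m h4]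
  refine lintegral_congr fun e => ?_
  have h5 := hc h4 e
  rw [lintegral_pi_cons m h5]
  refine lintegral_congr fun g => ?_
  rw [lintegral_pi_zero]

/-- The exponents of the six variables with two indices, in the order `12, 13, 21, 23, 31, 32`, in
the three monomials `psi`. -/
def cyclicCoeff : Fin 3 → Fin 6 → ℝ :=
  ![![1, 1, 2, 0, 2, 0], ![2, 0, 1, 1, 0, 2], ![0, 2, 0, 2, 1, 1]]

/-- The three linear forms with coefficients `cyclicCoeff`. -/
def cyclicForm (x : Fin 6 → ℝ) (j : Fin 3) : ℝ := ∑ i, cyclicCoeff j i * x i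

theorem cyclicForm_zero (x : Fin 6 → ℝ) : cyclicForm x 0 = x 0 + x 1 + 2 * x 2 + 2 * x 4 := by
  simp [cyclicForm, Fin.sum_univ_succ, cyclicCoeff]; ring_nf

theorem cyclicForm_one (x : Fin 6 → ℝ) : cyclicForm x 1 = x 2 + x 3 + 2 * x 0 + 2 * x 5 := by
  simp [cyclicForm, Fin.sum_univ_succ, cyclicCoeff]; ring_nf

theorem cyclicForm_two (x : Fin 6 → ℝ) : cyclicForm x 2 = x 4 + x 5 + 2 * x 1 + 2 * x 3 := by
  simp [cyclicForm, Fin.sum_univ_succ, cyclicCoeff]; ring_nf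

@[fun_prop]
theorem measurable_cyclicForm (j : Fin 3) : Measurable fun x => cyclicForm x j := by
  unfold cyclicForm; fun_prop

theorem cyclicForm_smul (t : ℝ) (x : Fin 6 → ℝ) (j : Fin 3) :
    cyclicForm (t • x) j = t * cyclicForm x j := by
  simp only [cyclicForm, Pi.smul_apply, smul_eq_mul, Finset.mul_sum]
  exact Finset.sum_congr rfl fun i _ => by ring

/-- The largest of the three linear forms. -/
noncomputable def cyclicMax (x : Fin 6 → ℝ) : ℝ :=
  max (cyclicForm x 0) (max (cyclicForm x 1) (cyclicForm x 2))

@[fun_prop]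
theorem measurable_cyclicMax : Measurable cyclicMax := by
  unfold cyclicMax; fun_prop

theorem cyclicMax_vec (a b c d e g : ℝ) : cyclicMax ![a, b, c, d, e, g] =
    (a + b) + ((c + d) + ((e + g) + max (c - d + (e - g)) (max (a - b - (e - g)) (-(a - b) - (c - d))))) := by
  simp only [cyclicMax, cyclicForm_zero, cyclicForm_one, cyclicForm_two, Matrix.cons_val,
    ← max_add_add_left]
  congr 1
  · ring
  · congr 1 <;> ring

/-- Apart from the three pair sums, the maximum depends only on the differences `m`, `p`, `r` within
the pairs. Three applications of `lintegral_pair` leave `1/8` of the integral of `cyclicExp (-m) p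
(-r)`, which is `2`. -/
theorem lintegral_cyclicMax :
    ∫⁻ x, ENNReal.ofReal (Real.exp (-cyclicMax x)) ∂Measure.pi (fun _ : Fin 6 => posMeasure) =
      ENNReal.ofReal (1 / 4) := by
  rw [lintegral_pi_six posMeasure (by fun_prop)]
  let h (m p r : ℝ) : ℝ≥0∞ := ENNReal.ofReal (Real.exp (-max (p + r) (max (m - r) (-m - p))))
  let E (s : ℝ) : ℝ≥0∞ := ENNReal.ofReal (Real.exp (-s))
  have hE : Measurable E := by fun_prop
  have hh : Measurable fun q : ℝ × ℝ × ℝ => h q.1 q.2.1 q.2.2 := by fun_prop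
  have e1 : ∀ a b c d e g : ℝ, ENNReal.ofReal (Real.exp (-cyclicMax ![a, b, c, d, e, g])) =
      E (a + b) * (E (c + d) * (E (e + g) * h (a - b) (c - d) (e - g))) := by
    intro a b c d e g
    simp only [E, h, ← ENNReal.ofReal_mul (Real.exp_pos _).le, ← Real.exp_add]
    rw [cyclicMax_vec]
    congr 2
    ring
  simp_rw [e1]
  have m1 : Measurable fun q : (ℝ × ℝ) × ℝ => E |q.2| * h q.1.1 q.1.2 q.2 := by fun_prop
  let h2 (m p : ℝ) : ℝ≥0∞ := ENNReal.ofReal (1 / 2) * ∫⁻ r, E |r| * h m p r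
  have hh2 : Measurable fun q : ℝ × ℝ => h2 q.1 q.2 := m1.lintegral_prod_right.const_mul _
  have m2 : Measurable fun q : ℝ × ℝ => E |q.2| * h2 q.1 q.2 := by fun_prop
  let h1 (m : ℝ) : ℝ≥0∞ := ENNReal.ofReal (1 / 2) * ∫⁻ p, E |p| * h2 m p
  have hh1 : Measurable fun q : ℝ => h1 q := m2.lintegral_prod_right.const_mul _
  have i1 : ∀ a b c d : ℝ, ∫⁻ e, ∫⁻ g, E (a + b) * (E (c + d) * (E (e + g) * h (a - b) (c - d) (e - g)))
      ∂posMeasure ∂posMeasure = E (a + b) * (E (c + d) * h2 (a - b) (c - d)) := by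
    intro a b c d
    have : Measurable (h (a - b) (c - d)) := by fun_prop
    have hm : Measurable fun p : ℝ × ℝ => E (p.1 + p.2) * h (a - b) (c - d) (p.1 - p.2) := by fun_prop
    have key : _ = h2 (a - b) (c - d) := lintegral_pair this
    rw [← key, ← lintegral_const_mul _ hm.lintegral_prod_right,
      ← lintegral_const_mul _ (by
        exact (hm.lintegral_prod_right).const_mul _)]
    refine lintegral_congr fun e => ?_
    have hm2 : Measurable fun g : ℝ => E (e + g) * h (a - b) (c - d) (e - g) := by fun_prop
    rw [← lintegral_const_mul _ hm2, ← lintegral_const_mul _ (hm2.const_mul _)]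
  simp_rw [i1]
  have i2 : ∀ a b : ℝ, ∫⁻ c, ∫⁻ d, E (a + b) * (E (c + d) * h2 (a - b) (c - d))
      ∂posMeasure ∂posMeasure = E (a + b) * h1 (a - b) := by
    intro a b
    have h3 : Measurable (h2 (a - b)) := by fun_prop
    have hm : Measurable fun p : ℝ × ℝ => E (p.1 + p.2) * h2 (a - b) (p.1 - p.2) := by fun_prop
    have key : _ = h1 (a - b) := lintegral_pair h3
    rw [← key, ← lintegral_const_mul _ hm.lintegral_prod_right]
    refine lintegral_congr fun c => ?_
    have hm2 : Measurable fun g : ℝ => E (c + g) * h2 (a - b) (c - g) := by fun_prop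
    rw [← lintegral_const_mul _ hm2]
  simp_rw [i2]
  rw [lintegral_pair hh1]
  have i3 : ∀ m, E |m| * h1 m = ENNReal.ofReal (1 / 4) * ∫⁻ p, ∫⁻ r, ENNReal.ofReal (cyclicExp (-m) p (-r)) := by
    intro m
    have m3 : ∀ p, Measurable fun r => E |r| * h m p r := fun p => by fun_prop
    have m4 : Measurable fun q : ℝ × ℝ => E |q.2| * h m q.1 q.2 := by fun_prop
    have m5 : Measurable fun p => h2 m p := by fun_prop
    simp only [h1, h2]
    have : ∀ p, E |p| * (ENNReal.ofReal (1 / 2) * ∫⁻ r, E |r| * h m p r) =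
        ENNReal.ofReal (1 / 2) * ∫⁻ r, E |p| * (E |r| * h m p r) := by
      intro p
      rw [lintegral_const_mul _ (m3 p)]; ring
    simp_rw [this]
    have m6 : Measurable fun p => ∫⁻ r, E |p| * (E |r| * h m p r) :=
      (show Measurable fun q : ℝ × ℝ => E |q.1| * (E |q.2| * h m q.1 q.2) by fun_prop).lintegral_prod_right
    have k4 : ENNReal.ofReal (1 / 4) = ENNReal.ofReal (1 / 2) * ENNReal.ofReal (1 / 2) := by
      rw [← ENNReal.ofReal_mul (by norm_num)]; norm_num
    have k5 : ∀ k a J : ℝ≥0∞, a * (k * (k * J)) = k * k * (a * J) := fun k a J => by ring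
    rw [lintegral_const_mul _ m6, k4, k5, ← lintegral_const_mul _ m6]
    congr 1
    refine lintegral_congr fun p => ?_
    rw [← lintegral_const_mul _ ((m3 p).const_mul _)]
    refine lintegral_congr fun r => ?_
    simp only [E, h, ← ENNReal.ofReal_mul (Real.exp_pos _).le, ← Real.exp_add, cyclicExp]
    congr 2
    rw [abs_neg, abs_neg, max_comm (-m - p), max_assoc]
    ring_nf
  have m7 : Measurable fun q : (ℝ × ℝ) × ℝ => ENNReal.ofReal (cyclicExp q.1.1 q.1.2 (-q.2)) :=
    measurable_cyclicExp (by fun_prop) (by fun_prop) (by fun_prop)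
  have m8 : Measurable fun m => ∫⁻ p, ∫⁻ r, ENNReal.ofReal (cyclicExp m p (-r)) :=
    (m7.lintegral_prod_right).lintegral_prod_right
  change _ * ∫⁻ m, E |m| * h1 m = _
  simp_rw [i3]
  have m9 : Measurable fun m => ∫⁻ p, ∫⁻ r, ENNReal.ofReal (cyclicExp (-m) p (-r)) := m8.comp measurable_neg
  rw [lintegral_const_mul _ m9, lintegral_neg_eq_self (fun m => ∫⁻ p, ∫⁻ r, ENNReal.ofReal (cyclicExp m p (-r)))]
  have : ∀ m p, ∫⁻ r, ENNReal.ofReal (cyclicExp m p (-r)) = ∫⁻ r, ENNReal.ofReal (cyclicExp m p r) :=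
    fun m p => lintegral_neg_eq_self (fun r => ENNReal.ofReal (cyclicExp m p r))
  simp only [this]
  rw [lintegral_cyclicExp]
  have : (2 : ℝ≥0∞) = ENNReal.ofReal 2 := by simp
  rw [this, ← ENNReal.ofReal_mul (by norm_num), ← ENNReal.ofReal_mul (by norm_num)]
  norm_num

theorem ofReal_exp_neg_eq_lintegral (M : ℝ) :
    ENNReal.ofReal (Real.exp (-M)) = ∫⁻ t in Ici M, ENNReal.ofReal (Real.exp (-t)) := by
  rw [setLIntegral_congr Ioi_ae_eq_Ici.symm, ← ofReal_integral_eq_lintegral_ofReal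
    (integrableOn_exp_neg_Ioi M) (Filter.Eventually.of_forall fun t => (Real.exp_pos _).le),
    integral_exp_neg_Ioi]

theorem lintegral_Ioi_exp_neg_mul_pow (n : ℕ) :
    ∫⁻ t in Ioi (0 : ℝ), ENNReal.ofReal (Real.exp (-t) * t ^ n) = ENNReal.ofReal n.factorial := by
  have h1 : (0 : ℝ) < n + 1 := by positivity
  rw [← ofReal_integral_eq_lintegral_ofReal]
  · congr 1
    rw [← Real.Gamma_nat_eq_factorial, Real.Gamma_eq_integral h1]
    refine setIntegral_congr_fun measurableSet_Ioi fun t ht => ?_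
    simp
  · have := Real.GammaIntegral_convergent h1
    simp only [add_sub_cancel_right, Real.rpow_natCast] at this
    exact this
  · filter_upwards [ae_restrict_mem measurableSet_Ioi] with t ht
    have : 0 < t := ht
    positivity

/-- The polytope cut out of the nonnegative orthant by bounds for the three linear forms. -/
def cyclicPolytope (t : Fin 3 → ℝ) : Set (Fin 6 → ℝ) :=
  {x | (∀ i, 0 ≤ x i) ∧ ∀ j, cyclicForm x j ≤ t j}

theorem measurableSet_cyclicPolytope (t : Fin 3 → ℝ) : MeasurableSet (cyclicPolytope t) := by
  have : cyclicPolytope t = (⋂ i, {x | 0 ≤ x i}) ∩ ⋂ j, {x | cyclicForm x j ≤ t j} := by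
    ext x; simp [cyclicPolytope]
  rw [this]
  exact (MeasurableSet.iInter fun i => measurableSet_le measurable_const (by fun_prop)).inter
    (MeasurableSet.iInter fun j => measurableSet_le (by fun_prop) measurable_const)

theorem cyclicPolytope_const (t : ℝ) :
    cyclicPolytope (fun _ => t) = {x | cyclicMax x ≤ t} ∩ Set.univ.pi fun _ => Ici 0 := by
  ext x
  simp only [cyclicPolytope, cyclicMax, Set.mem_ofPred_eq, Set.mem_inter_iff,
    max_le_iff, Set.mem_univ_pi, Set.mem_Ici]
  have : (∀ j, cyclicForm x j ≤ t) ↔ cyclicForm x 0 ≤ t ∧ cyclicForm x 1 ≤ t ∧ cyclicForm x 2 ≤ t := by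
    rw [Fin.forall_fin_succ, Fin.forall_fin_two]; rfl
  tauto

open scoped Pointwise in
theorem volume_cyclicPolytope_const_eq {t : ℝ} (ht : 0 < t) :
    volume (cyclicPolytope fun _ => t) = ENNReal.ofReal (t ^ 6) * volume (cyclicPolytope fun _ => 1) := by
  have : cyclicPolytope (fun _ => t) = t • cyclicPolytope fun _ => 1 := by
    ext x
    rw [Set.mem_smul_set_iff_inv_smul_mem₀ ht.ne']
    simp only [cyclicPolytope, Set.mem_ofPred_eq, cyclicForm_smul, Pi.smul_apply, smul_eq_mul]
    have h1 : ∀ a : ℝ, 0 ≤ t⁻¹ * a ↔ 0 ≤ a := fun a => by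
      rw [mul_nonneg_iff_of_pos_left (by positivity)]
    have h2 : ∀ a : ℝ, t⁻¹ * a ≤ 1 ↔ a ≤ t := fun a => by
      rw [inv_mul_le_iff₀ ht, mul_one]
    simp only [h1, h2]
  rw [this, Measure.addHaar_smul]
  simp [abs_of_pos ht]

/-- Layer cake: writing `exp (-cyclicMax x)` as an integral of `exp (-t)` over `t ≥ cyclicMax x` and
exchanging integrals gives `∫ e^(-t) t⁶ dt = 6!` times the volume. So the volume is `(1/4) / 720`.
-/
theorem volume_cyclicPolytope_one : volume (cyclicPolytope fun _ => 1) = ENNReal.ofReal (1 / 2880) := by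
  have hpi : Measure.pi (fun _ : Fin 6 => posMeasure) = volume.restrict (Set.univ.pi fun _ => Ici 0) := by
    rw [volume_pi, Measure.restrict_pi_pi]
    unfold posMeasure
    rw [restrict_Ioi_eq_restrict_Ici]
  have hae : ∀ᵐ x ∂Measure.pi (fun _ : Fin 6 => posMeasure), 0 < cyclicMax x := by
    have : ∀ᵐ x ∂Measure.pi (fun _ : Fin 6 => posMeasure), ∀ i, 0 < x i :=
      Filter.Eventually.filter_mono Measure.ae_pi_le_pi
        (Filter.eventually_pi (p := fun _ x => 0 < x) fun _ => posMeasure_ae)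
    filter_upwards [this] with x hx
    refine lt_max_of_lt_left ?_
    rw [cyclicForm_zero]
    have := hx 0; have := hx 1; have := hx 2; have := hx 4
    positivity
  have h1 : ∫⁻ x, ENNReal.ofReal (Real.exp (-cyclicMax x)) ∂Measure.pi (fun _ : Fin 6 => posMeasure) =
      ∫⁻ x, ∫⁻ t, {p : (Fin 6 → ℝ) × ℝ | cyclicMax p.1 ≤ p.2}.indicator (fun p => ENNReal.ofReal (Real.exp (-p.2)))
        (x, t) ∂posMeasure ∂Measure.pi (fun _ : Fin 6 => posMeasure) := by
    refine lintegral_congr_ae (hae.mono fun x hx => ?_)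
    simp only
    rw [ofReal_exp_neg_eq_lintegral, posMeasure, ← lintegral_indicator measurableSet_Ici,
      ← lintegral_indicator measurableSet_Ioi]
    refine lintegral_congr fun t => ?_
    by_cases h : cyclicMax x ≤ t
    · have : 0 < t := hx.trans_le h
      simp [indicator, h, this]
    · simp [indicator, h]
  have hm : Measurable ({p : (Fin 6 → ℝ) × ℝ | cyclicMax p.1 ≤ p.2}.indicator
      (fun p => ENNReal.ofReal (Real.exp (-p.2)))) :=
    Measurable.indicator (by fun_prop) (measurableSet_le (by fun_prop) (by fun_prop))
  have h2 := lintegral_lintegral_swap (μ := Measure.pi (fun _ : Fin 6 => posMeasure)) (ν := posMeasure)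
    (f := fun x t => {p : (Fin 6 → ℝ) × ℝ | cyclicMax p.1 ≤ p.2}.indicator
      (fun p => ENNReal.ofReal (Real.exp (-p.2))) (x, t)) hm.aemeasurable
  rw [lintegral_cyclicMax, h2] at h1
  have h3 : ∀ t, 0 < t → ∫⁻ x, {p : (Fin 6 → ℝ) × ℝ | cyclicMax p.1 ≤ p.2}.indicator
      (fun p => ENNReal.ofReal (Real.exp (-p.2))) (x, t) ∂Measure.pi (fun _ : Fin 6 => posMeasure) =
      ENNReal.ofReal (Real.exp (-t) * t ^ 6) * volume (cyclicPolytope fun _ => 1) := by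
    intro t ht
    have e1 : ∀ x, {p : (Fin 6 → ℝ) × ℝ | cyclicMax p.1 ≤ p.2}.indicator
      (fun p => ENNReal.ofReal (Real.exp (-p.2))) (x, t) =
      {x | cyclicMax x ≤ t}.indicator (fun _ => ENNReal.ofReal (Real.exp (-t))) x := fun x => by
      simp [indicator]
    have e2 : MeasurableSet {x | cyclicMax x ≤ t} := measurableSet_le (by fun_prop) measurable_const
    simp_rw [e1]
    rw [lintegral_indicator_const e2, hpi, Measure.restrict_apply e2, ← cyclicPolytope_const,
      volume_cyclicPolytope_const_eq ht, ← mul_assoc, ← ENNReal.ofReal_mul (Real.exp_pos _).le]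
  rw [lintegral_pos_congr h3, lintegral_mul_const _ (by fun_prop), posMeasure,
    lintegral_Ioi_exp_neg_mul_pow] at h1
  have h4 : ENNReal.ofReal (1 / 2880) = ENNReal.ofReal (1 / 720) * ENNReal.ofReal (1 / 4) := by
    rw [← ENNReal.ofReal_mul (by norm_num)]; norm_num
  have h5 : (Nat.factorial 6 : ℝ) = 720 := by norm_num [Nat.factorial]
  rw [h4, h1, h5, ← mul_assoc, ← ENNReal.ofReal_mul (by norm_num)]
  norm_num

theorem volume_cyclicPolytope_const {t : ℝ} (ht : 0 < t) :
    volume (cyclicPolytope fun _ => t) = ENNReal.ofReal (t ^ 6 / 2880) := by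
  rw [volume_cyclicPolytope_const_eq ht, volume_cyclicPolytope_one, ← ENNReal.ofReal_mul (by positivity)]
  ring_nf

end Volume
end CubicTorsor

namespace CubicTorsor

/-! ### Partial summation for exponentially distributed points. -/

section PartialSummation

open MeasureTheory Set

theorem integral_exp_indicator {x M : ℝ} (h0 : 0 ≤ x) (hM : x ≤ M) (α : ℝ) :
    ∫ t in (0 : ℝ)..M, (if x ≤ t then α * Real.exp (-α * t) else 0) =
      Real.exp (-α * x) - Real.exp (-α * M) := by
  have h1 : ∀ t : ℝ, HasDerivAt (fun t => -Real.exp (-α * t)) (α * Real.exp (-α * t)) t := by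
    intro t
    have := ((hasDerivAt_id t).const_mul (-α)).exp.neg
    convert! this using 1
    simp; ring
  have h2 : ∫ t in x..M, α * Real.exp (-α * t) = Real.exp (-α * x) - Real.exp (-α * M) := by
    rw [intervalIntegral.integral_eq_sub_of_hasDerivAt (fun t _ => h1 t)
      (Continuous.intervalIntegrable (by fun_prop) _ _)]
    ring
  rw [← h2, intervalIntegral.integral_of_le (h0.trans hM), intervalIntegral.integral_of_le hM,
    ← integral_Icc_eq_integral_Ioc, ← integral_Icc_eq_integral_Ioc]
  have h3 : (fun t => if x ≤ t then α * Real.exp (-α * t) else 0) =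
      (Ici x).indicator fun t => α * Real.exp (-α * t) := by
    ext t; simp [indicator]
  have h4 : Icc 0 M ∩ Ici x = Icc x M := by
    ext t; simp only [mem_inter_iff, mem_Icc, mem_Ici]
    constructor
    · rintro ⟨⟨_, h⟩, h'⟩; exact ⟨h', h⟩
    · rintro ⟨h, h'⟩; exact ⟨⟨h0.trans h, h'⟩, h⟩
  rw [h3, setIntegral_indicator measurableSet_Ici, h4]

theorem intervalIntegrable_exp_indicator (x M α : ℝ) :
    IntervalIntegrable (fun t => if x ≤ t then α * Real.exp (-α * t) else 0) volume 0 M := by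
  have h3 : (fun t => if x ≤ t then α * Real.exp (-α * t) else 0) =
      (Ici x).indicator fun t => α * Real.exp (-α * t) := by
    ext t; simp [indicator]
  rw [h3]
  have h : IntervalIntegrable (fun t => α * Real.exp (-α * t)) volume 0 M :=
    Continuous.intervalIntegrable (by fun_prop) _ _
  exact ⟨h.1.indicator measurableSet_Ici, h.2.indicator measurableSet_Ici⟩

theorem mul_card_filter_le_eq_sum {ι : Type*} (s : Finset ι) (x : ι → ℝ) (α t : ℝ) :
    α * Real.exp (-α * t) * ((s.filter fun i => x i ≤ t).card : ℝ) =
      ∑ i ∈ s, if x i ≤ t then α * Real.exp (-α * t) else 0 := by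
  rw [Finset.sum_ite, Finset.sum_const_zero, add_zero, Finset.sum_const, nsmul_eq_mul, mul_comm]

/-- Partial summation for exponential weights. -/
theorem sum_exp_neg_eq {ι : Type*} (s : Finset ι) (x : ι → ℝ) {M : ℝ} (h0 : ∀ i ∈ s, 0 ≤ x i)
    (hM : ∀ i ∈ s, x i ≤ M) (α : ℝ) :
    ∑ i ∈ s, Real.exp (-α * x i) = Real.exp (-α * M) * s.card +
      ∫ t in (0 : ℝ)..M, α * Real.exp (-α * t) * ((s.filter fun i => x i ≤ t).card : ℝ) := by
  simp_rw [mul_card_filter_le_eq_sum]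
  rw [intervalIntegral.integral_finsetSum fun i _ => intervalIntegrable_exp_indicator _ _ _,
    Finset.sum_congr rfl fun i hi => integral_exp_indicator (h0 i hi) (hM i hi) α,
    Finset.sum_sub_distrib, Finset.sum_const, nsmul_eq_mul]
  ring

theorem intervalIntegrable_card {ι : Type*} (s : Finset ι) (x : ι → ℝ) (α M : ℝ) :
    IntervalIntegrable (fun t => α * Real.exp (-α * t) * ((s.filter fun i => x i ≤ t).card : ℝ))
      volume 0 M := by
  simp_rw [mul_card_filter_le_eq_sum]
  have := IntervalIntegrable.sum s (f := fun i t => if x i ≤ t then α * Real.exp (-α * t) else 0)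
    (fun i _ => intervalIntegrable_exp_indicator (x i) M α)
  convert! this using 1
  ext t; simp

theorem integral_exp_mul {a : ℝ} (ha : a ≠ 0) (M : ℝ) :
    ∫ t in (0 : ℝ)..M, Real.exp (a * t) = (Real.exp (a * M) - 1) / a := by
  have h1 : ∀ t : ℝ, HasDerivAt (fun t => Real.exp (a * t) / a) (Real.exp (a * t)) t := by
    intro t
    have := (((hasDerivAt_id t).const_mul a).exp).div_const a
    convert! this using 1
    simp; field_simp
  rw [intervalIntegral.integral_eq_sub_of_hasDerivAt (fun t _ => h1 t)
      (Continuous.intervalIntegrable (by fun_prop) _ _)]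
  simp; ring

variable {ι : Type*} [Fintype ι] {x : ι → ℝ} {κ C θ L : ℝ}

/-- The points `x i` are distributed on `[0, L]` like the density `κ * exp t`. -/
structure IsExpDistributed (x : ι → ℝ) (κ C θ L : ℝ) : Prop where
  nonneg : ∀ i, 0 ≤ x i
  le : ∀ i, x i ≤ L
  card_sub : ∀ t, 0 ≤ t → t ≤ L →
    |((Finset.univ.filter fun i => x i ≤ t).card : ℝ) - κ * Real.exp t| ≤ C * Real.exp ((1 - θ) * t)

theorem filter_filter_le (x : ι → ℝ) {t M : ℝ} (h : t ≤ M) :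
    ((Finset.univ.filter fun i => x i ≤ M).filter fun i => x i ≤ t) = Finset.univ.filter fun i => x i ≤ t := by
  ext i
  simp only [Finset.mem_filter, Finset.mem_univ, true_and]
  exact ⟨fun h => h.2, fun h' => ⟨h'.trans h, h'⟩⟩

theorem IsExpDistributed.card_le (h : IsExpDistributed x κ C θ L) (hC : 0 ≤ C) (hθ : 0 ≤ θ) {t : ℝ}
    (h0 : 0 ≤ t) (hL : t ≤ L) :
    ((Finset.univ.filter fun i => x i ≤ t).card : ℝ) ≤ (κ + C) * Real.exp t := by
  have h1 := (abs_le.1 (h.card_sub t h0 hL)).2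
  have h2 : Real.exp ((1 - θ) * t) ≤ Real.exp t := Real.exp_le_exp.2 (by nlinarith)
  nlinarith

/-- In the partial summation, `e^(-t)` times the counting function is `κ + O(e^(-θt))`. The error is
integrable on the half-line, so the bound does not depend on `M`. -/
theorem IsExpDistributed.sum_exp_sub (h : IsExpDistributed x κ C θ L) (hC : 0 ≤ C) (hθ : 0 < θ)
    {M : ℝ} (h0 : 0 ≤ M) (hL : M ≤ L) :
    |∑ i with x i ≤ M, Real.exp (-x i) - κ * M| ≤ κ + C + C / θ := by
  have e := sum_exp_neg_eq (Finset.univ.filter fun i => x i ≤ M) x (M := M) (fun i _ => h.nonneg i)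
    (fun i hi => (Finset.mem_filter.1 hi).2) 1
  simp only [neg_mul, one_mul] at e
  have hint := intervalIntegrable_card (Finset.univ.filter fun i => x i ≤ M) x 1 M
  simp only [neg_mul, one_mul] at hint
  have hc : ∫ t in (0 : ℝ)..M, κ = κ * M := by simp [mul_comm]
  rw [e, ← hc, add_sub_assoc, ← intervalIntegral.integral_sub hint (by simp)]
  have b1 : |Real.exp (-M) * ((Finset.univ.filter fun i => x i ≤ M).card : ℝ)| ≤ κ + C := by
    rw [abs_of_nonneg (by positivity), Real.exp_neg, inv_mul_le_iff₀ (Real.exp_pos _), mul_comm]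
    exact h.card_le hC hθ.le h0 hL
  have b2 : |∫ t in (0 : ℝ)..M, (Real.exp (-t) *
      (((Finset.univ.filter fun i => x i ≤ M).filter fun i => x i ≤ t).card : ℝ) - κ)| ≤ C / θ := by
    have b3 : ∫ t in (0 : ℝ)..M, C * Real.exp (-θ * t) ≤ C / θ := by
      rw [intervalIntegral.integral_const_mul, integral_exp_mul (by linarith), div_eq_mul_inv C]
      refine mul_le_mul_of_nonneg_left ?_ hC
      rw [div_neg, ← neg_div, inv_eq_one_div]
      gcongr
      linarith [Real.exp_pos (-θ * M)]
    refine le_trans ?_ b3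
    rw [← Real.norm_eq_abs]
    refine intervalIntegral.norm_integral_le_of_norm_le h0 (Filter.Eventually.of_forall fun t ht => ?_)
      (Continuous.intervalIntegrable (by fun_prop) _ _)
    rw [filter_filter_le x ht.2, Real.norm_eq_abs]
    have := h.card_sub t ht.1.le (ht.2.trans hL)
    have e1 : Real.exp (-t) * ((Finset.univ.filter fun i => x i ≤ t).card : ℝ) - κ =
        Real.exp (-t) * (((Finset.univ.filter fun i => x i ≤ t).card : ℝ) - κ * Real.exp t) := by
      have : Real.exp (-t) * Real.exp t = 1 := by rw [← Real.exp_add]; simp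
      linear_combination κ * this
    have e2 : C * Real.exp (-θ * t) = Real.exp (-t) * (C * Real.exp ((1 - θ) * t)) := by
      have : Real.exp (-θ * t) = Real.exp (-t) * Real.exp ((1 - θ) * t) := by
        rw [← Real.exp_add]; ring_nf
      rw [this]; ring
    rw [e1, e2, abs_mul, abs_of_pos (Real.exp_pos _)]
    gcongr
  exact (abs_add_le _ _).trans (add_le_add b1 b2)

/-- The weights `exp (-x i)` have bounded mass per unit length, and the second factor concentrates
the sum near `M`. -/
theorem IsExpDistributed.sum_exp_le (h : IsExpDistributed x κ C θ L) (hκ : 0 ≤ κ) (hC : 0 ≤ C) (hθ : 0 ≤ θ)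
    {η : ℝ} (hη : 0 < η) {M : ℝ} (h0 : 0 ≤ M) (hL : M ≤ L) :
    ∑ i with x i ≤ M, Real.exp (-x i) * Real.exp (-η * (M - x i)) ≤ (κ + C) * (1 + 1 / η) := by
  have e := sum_exp_neg_eq (Finset.univ.filter fun i => x i ≤ M) x (M := M) (fun i _ => h.nonneg i)
    (fun i hi => (Finset.mem_filter.1 hi).2) (1 - η)
  have e1 : ∑ i with x i ≤ M, Real.exp (-x i) * Real.exp (-η * (M - x i)) =
      Real.exp (-η * M) * ∑ i with x i ≤ M, Real.exp (-(1 - η) * x i) := by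
    rw [Finset.mul_sum]
    refine Finset.sum_congr rfl fun i _ => ?_
    rw [← Real.exp_add, ← Real.exp_add]; ring_nf
  have b1 : Real.exp (-(1 - η) * M) * ((Finset.univ.filter fun i => x i ≤ M).card : ℝ) ≤
      (κ + C) * Real.exp (η * M) := by
    have e2 : (κ + C) * Real.exp (η * M) = Real.exp (-(1 - η) * M) * ((κ + C) * Real.exp M) := by
      have : Real.exp (η * M) = Real.exp (-(1 - η) * M) * Real.exp M := by
        rw [← Real.exp_add]; ring_nf
      rw [this]; ring
    rw [e2]
    exact mul_le_mul_of_nonneg_left (h.card_le hC hθ h0 hL) (Real.exp_pos _).le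
  have b2 : ∫ t in (0 : ℝ)..M, (1 - η) * Real.exp (-(1 - η) * t) *
      (((Finset.univ.filter fun i => x i ≤ M).filter fun i => x i ≤ t).card : ℝ) ≤
      (κ + C) * (1 / η * Real.exp (η * M)) := by
    have b3 : ∫ t in (0 : ℝ)..M, (κ + C) * Real.exp (η * t) ≤ (κ + C) * (1 / η * Real.exp (η * M)) := by
      rw [intervalIntegral.integral_const_mul, integral_exp_mul hη.ne']
      gcongr
      rw [div_eq_mul_one_div, mul_comm]
      gcongr
      linarith
    refine le_trans ?_ b3
    refine intervalIntegral.integral_mono_on h0 (intervalIntegrable_card _ _ _ _)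
      (Continuous.intervalIntegrable (by fun_prop) _ _) fun t ht => ?_
    rw [filter_filter_le x ht.2]
    have e2 : (κ + C) * Real.exp (η * t) = Real.exp (-(1 - η) * t) * ((κ + C) * Real.exp t) := by
      have : Real.exp (η * t) = Real.exp (-(1 - η) * t) * Real.exp t := by
        rw [← Real.exp_add]; ring_nf
      rw [this]; ring
    rw [e2, mul_assoc]
    have h1 := h.card_le hC hθ ht.1 (ht.2.trans hL)
    have h2 : Real.exp (-(1 - η) * t) * ((Finset.univ.filter fun i => x i ≤ t).card : ℝ) ≤
      Real.exp (-(1 - η) * t) * ((κ + C) * Real.exp t) := mul_le_mul_of_nonneg_left h1 (Real.exp_pos _).le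
    -- The factor `1 - η` may be negative; only `1 - η ≤ 1` is used.
    refine le_trans ?_ h2
    have h3 : 0 ≤ Real.exp (-(1 - η) * t) * ((Finset.univ.filter fun i => x i ≤ t).card : ℝ) := by positivity
    nlinarith
  rw [e1, e]
  have h5 : Real.exp (-η * M) * Real.exp (η * M) = 1 := by rw [← Real.exp_add]; simp
  calc _ ≤ Real.exp (-η * M) * ((κ + C) * Real.exp (η * M) + (κ + C) * (1 / η * Real.exp (η * M))) := by
        gcongr
    _ = (κ + C) * (1 + 1 / η) * (Real.exp (-η * M) * Real.exp (η * M)) := by ring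
    _ = _ := by rw [h5, mul_one]

end PartialSummation

/-! ### Comparison of product measures, one coordinate at a time. -/

section Hybrid

open MeasureTheory Set
open scoped ENNReal

variable {n : ℕ}

theorem pi_eq_lintegral_slice (m : Fin (n + 1) → Measure ℝ) [∀ i, SigmaFinite (m i)]
    (i : Fin (n + 1)) {P : Set (Fin (n + 1) → ℝ)} (hP : MeasurableSet P) :
    Measure.pi m P = ∫⁻ y, m i {t | i.insertNth t y ∈ P} ∂Measure.pi (fun k => m (i.succAbove k)) := by
  rw [← lintegral_indicator_one hP, lintegral_pi_insertNth_symm m i (measurable_one.indicator hP)]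
  refine lintegral_congr fun y => ?_
  have hs : MeasurableSet {t | i.insertNth t y ∈ P} :=
    hP.preimage ((measurable_insertNth i).comp (measurable_id.prodMk measurable_const))
  rw [← lintegral_indicator_one hs]
  rfl

theorem pi_univ_le (m : Fin n → Measure ℝ) [∀ i, SigmaFinite (m i)] {A : ℝ≥0∞}
    (hA : ∀ k, m k univ ≤ A) : Measure.pi m univ ≤ A ^ n := by
  rw [Measure.pi_univ]
  calc _ ≤ ∏ _i : Fin n, A := Finset.prod_le_prod' fun i _ => hA i
    _ = _ := by simp

theorem pi_update_le (m : Fin (n + 1) → Measure ℝ) [∀ i, IsFiniteMeasure (m i)]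
    (i : Fin (n + 1)) (ν : Measure ℝ) [IsFiniteMeasure ν] {P : Set (Fin (n + 1) → ℝ)} (hP : MeasurableSet P)
    {C A : ℝ≥0∞} (hA : ∀ k, m k univ ≤ A)
    (h : ∀ y, ν {t | i.insertNth t y ∈ P} ≤ m i {t | i.insertNth t y ∈ P} + C) :
    Measure.pi (Function.update m i ν) P ≤ Measure.pi m P + C * A ^ n := by
  have : ∀ k, IsFiniteMeasure (Function.update m i ν k) := fun k => by
    by_cases hk : k = i
    · subst hk; rw [Function.update_self]; infer_instance
    · rw [Function.update_of_ne hk]; infer_instance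
  rw [pi_eq_lintegral_slice _ i hP, pi_eq_lintegral_slice m i hP]
  have h1 : (fun k => Function.update m i ν (i.succAbove k)) = fun k => m (i.succAbove k) := by
    ext1 k; rw [Function.update_of_ne (Fin.succAbove_ne i k)]
  simp only [Function.update_self]
  rw [h1]
  calc _ ≤ ∫⁻ y, (m i {t | i.insertNth t y ∈ P} + C) ∂Measure.pi (fun k => m (i.succAbove k)) :=
        lintegral_mono h
    _ = ∫⁻ y, m i {t | i.insertNth t y ∈ P} ∂Measure.pi (fun k => m (i.succAbove k)) +
        C * Measure.pi (fun k => m (i.succAbove k)) univ := by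
        rw [lintegral_add_right _ measurable_const, lintegral_const]
    _ ≤ _ := by
        gcongr
        exact pi_univ_le _ fun k => hA _

/-- If each slice of `P` parallel to a coordinate axis has nearly the same measure for `μ i` as
for `ν i`, then `P` has nearly the same measure for the two product measures. -/
theorem pi_le_pi_add (μ ν : Fin (n + 1) → Measure ℝ) [∀ i, IsFiniteMeasure (μ i)]
    [∀ i, IsFiniteMeasure (ν i)] {P : Set (Fin (n + 1) → ℝ)} (hP : MeasurableSet P)
    {C A : ℝ≥0∞} (hμ : ∀ k, μ k univ ≤ A) (hν : ∀ k, ν k univ ≤ A)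
    (h : ∀ i y, μ i {t | i.insertNth t y ∈ P} ≤ ν i {t | i.insertNth t y ∈ P} + C) :
    Measure.pi μ P ≤ Measure.pi ν P + (n + 1) * (C * A ^ n) := by
  classical
  have key : ∀ s : Finset (Fin (n + 1)), Measure.pi (s.piecewise μ ν) P ≤
      Measure.pi ν P + s.card * (C * A ^ n) := by
    intro s
    induction s using Finset.induction_on with
    | empty => simp
    | insert j s hj ih =>
      have : ∀ k, IsFiniteMeasure (s.piecewise μ ν k) := fun k => by
        by_cases hk : k ∈ s
        · rw [Finset.piecewise_eq_of_mem _ _ _ hk]; infer_instance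
        · rw [Finset.piecewise_eq_of_notMem _ _ _ hk]; infer_instance
      rw [Finset.piecewise_insert]
      have hA : ∀ k, s.piecewise μ ν k univ ≤ A := fun k => by
        by_cases hk : k ∈ s
        · rw [Finset.piecewise_eq_of_mem _ _ _ hk]; exact hμ k
        · rw [Finset.piecewise_eq_of_notMem _ _ _ hk]; exact hν k
      have := pi_update_le (s.piecewise μ ν) j (μ j) hP (C := C) hA fun y => by
        rw [Finset.piecewise_eq_of_notMem _ _ _ hj]; exact h j y
      refine this.trans ((add_le_add_left ih _).trans ?_)
      rw [Finset.card_insert_of_notMem hj]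
      push_cast
      rw [add_assoc, add_mul, one_mul]
  have := key Finset.univ
  rw [Finset.piecewise_univ] at this
  simpa using this

theorem eq_empty_or_eq_Icc {T : Set ℝ} {L : ℝ} (hc : IsClosed T) (h0 : ∀ t ∈ T, 0 ≤ t) (hL : ∀ t ∈ T, t ≤ L)
    (hl : ∀ t ∈ T, ∀ s, 0 ≤ s → s ≤ t → s ∈ T) : T = ∅ ∨ ∃ M, 0 ≤ M ∧ M ≤ L ∧ T = Icc 0 M := by
  rcases T.eq_empty_or_nonempty with h | h
  · exact Or.inl h
  · have hk : IsCompact T := (isCompact_Icc (a := (0:ℝ)) (b := L)).of_isClosed_subset hc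
      fun t ht => ⟨h0 t ht, hL t ht⟩
    have hs := hk.sSup_mem h
    refine Or.inr ⟨sSup T, h0 _ hs, hL _ hs, ?_⟩
    ext t
    exact ⟨fun ht => ⟨h0 t ht, le_csSup hk.bddAbove ht⟩, fun ht => hl _ hs t ht.1 ht.2⟩

end Hybrid
end CubicTorsor

namespace CubicTorsor

/-! ### Weighted sums over points in the polytope. -/

section PolytopeSum

open MeasureTheory Set
open scoped ENNReal

/-- The sum of point masses at the points `x i` with weights `exp (-x i) / κ`. -/
noncomputable def pointMeasure {ι : Type*} [Fintype ι] (x : ι → ℝ) (κ : ℝ) : Measure ℝ :=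
  ∑ i, ENNReal.ofReal (Real.exp (-x i) / κ) • Measure.dirac (x i)

theorem lintegral_pointMeasure {ι : Type*} [Fintype ι] (x : ι → ℝ) (κ : ℝ) (f : ℝ → ℝ≥0∞) :
    ∫⁻ t, f t ∂pointMeasure x κ = ∑ i, ENNReal.ofReal (Real.exp (-x i) / κ) * f (x i) := by
  rw [pointMeasure, lintegral_finsetSum_measure]
  simp

instance {ι : Type*} [Fintype ι] (x : ι → ℝ) (κ : ℝ) : IsFiniteMeasure (pointMeasure x κ) := by
  constructor
  rw [← setLIntegral_one, setLIntegral_univ, lintegral_pointMeasure]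
  exact ENNReal.sum_lt_top.2 fun i _ => by simp

theorem lintegral_pi_pointMeasure {n : ℕ} {ι : Fin n → Type*} [∀ i, Fintype (ι i)] (x : ∀ i, ι i → ℝ) (κ : ℝ)
    {f : (Fin n → ℝ) → ℝ≥0∞} (hf : Measurable f) :
    ∫⁻ t, f t ∂Measure.pi (fun i => pointMeasure (x i) κ) =
      ∑ z : ∀ i, ι i, (∏ i, ENNReal.ofReal (Real.exp (-x i (z i)) / κ)) * f fun i => x i (z i) := by
  induction n with
  | zero =>
    rw [lintegral_pi_zero]
    simp
    congr 1
    ext i; exact i.elim0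
  | succ n ih =>
    rw [lintegral_pi_insertNth _ 0 hf, lintegral_pointMeasure,
      ← Fintype.sum_equiv (Fin.consEquiv ι) (fun p => (∏ i, ENNReal.ofReal (Real.exp (-x i (Fin.cons (α := ι) p.1 p.2 i)) / κ)) *
        f fun i => x i (Fin.cons (α := ι) p.1 p.2 i)) _ (fun _ => rfl), Fintype.sum_prod_type]
    refine Finset.sum_congr rfl fun a _ => ?_
    have hfa : Measurable fun y : Fin n → ℝ => f ((0 : Fin (n + 1)).insertNth (x 0 a) y) :=
      hf.comp ((measurable_insertNth 0).comp (measurable_const.prodMk measurable_id))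
    have := ih (ι := fun i => ι i.succ) (fun i => x i.succ) hfa
    refine (congrArg (_ * ·) this).trans ?_
    simp only
    rw [Finset.mul_sum]
    refine Finset.sum_congr rfl fun z _ => ?_
    rw [Fin.prod_univ_succ, ← mul_assoc]
    simp only [Fin.cons_zero, Fin.cons_succ, Fin.insertNth_zero]
    congr 2
    ext i
    refine Fin.cases ?_ (fun i => ?_) i <;> simp

variable {ι : Type*} [Fintype ι] {x : ι → ℝ} {κ C θ L : ℝ}

theorem IsExpDistributed.pointMeasure_Icc (h : IsExpDistributed x κ C θ L) (hκ : 0 < κ) (M : ℝ) :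
    pointMeasure x κ (Icc 0 M) = ENNReal.ofReal ((∑ i with x i ≤ M, Real.exp (-x i)) / κ) := by
  rw [← lintegral_indicator_one measurableSet_Icc, lintegral_pointMeasure, Finset.sum_filter,
    Finset.sum_div, ENNReal.ofReal_sum_of_nonneg]
  · refine Finset.sum_congr rfl fun i _ => ?_
    by_cases hi : x i ≤ M
    · simp [indicator, hi, h.nonneg i]
    · simp [indicator, hi]
  · intro i _
    split_ifs <;> positivity

/-- The normalisation by `κ` makes the point measure agree with length on initial intervals up to a
bounded error, whatever their length. -/
theorem IsExpDistributed.pointMeasure_le (h : IsExpDistributed x κ C θ L) (hκ : 0 < κ) (hC : 0 ≤ C) (hθ : 0 < θ)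
    {M : ℝ} (h0 : 0 ≤ M) (hL : M ≤ L) :
    pointMeasure x κ (Icc 0 M) ≤ ENNReal.ofReal M + ENNReal.ofReal ((κ + C + C / θ) / κ) ∧
    ENNReal.ofReal M ≤ pointMeasure x κ (Icc 0 M) + ENNReal.ofReal ((κ + C + C / θ) / κ) := by
  have h1 := abs_le.1 (h.sum_exp_sub hC hθ h0 hL)
  have hp : 0 ≤ ∑ i with x i ≤ M, Real.exp (-x i) := Finset.sum_nonneg fun i _ => (Real.exp_pos _).le
  rw [h.pointMeasure_Icc hκ, ← ENNReal.ofReal_add h0 (by positivity), ← ENNReal.ofReal_add (by positivity) (by positivity)]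
  constructor
  · refine ENNReal.ofReal_le_ofReal ?_
    rw [div_le_iff₀ hκ, add_mul, div_mul_cancel₀ _ hκ.ne']
    linarith
  · refine ENNReal.ofReal_le_ofReal ?_
    rw [← add_div, le_div_iff₀ hκ]
    linarith

theorem IsExpDistributed.pointMeasure_univ (h : IsExpDistributed x κ C θ L) :
    pointMeasure x κ univ = pointMeasure x κ (Icc 0 L) := by
  rw [← lintegral_indicator_one measurableSet_Icc, ← lintegral_indicator_one MeasurableSet.univ,
    lintegral_pointMeasure, lintegral_pointMeasure]
  simp [indicator, h.nonneg, h.le]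

theorem cyclicCoeff_nonneg (j : Fin 3) (i : Fin 6) : 0 ≤ cyclicCoeff j i := by
  fin_cases j <;> fin_cases i <;> simp [cyclicCoeff]

theorem exists_one_le_cyclicCoeff (i : Fin 6) : ∃ j, 1 ≤ cyclicCoeff j i := by
  fin_cases i
  · exact ⟨0, by simp [cyclicCoeff]⟩
  · exact ⟨0, by simp [cyclicCoeff]⟩
  · exact ⟨0, by simp [cyclicCoeff]⟩
  · exact ⟨1, by simp [cyclicCoeff]⟩
  · exact ⟨0, by simp [cyclicCoeff]⟩
  · exact ⟨1, by simp [cyclicCoeff]⟩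

theorem exists_cyclicCoeff_eq_one (j : Fin 3) : ∃ i, cyclicCoeff j i = 1 := by
  fin_cases j
  · exact ⟨0, by simp [cyclicCoeff]⟩
  · exact ⟨2, by simp [cyclicCoeff]⟩
  · exact ⟨4, by simp [cyclicCoeff]⟩

theorem le_of_mem_cyclicPolytope {L : Fin 3 → ℝ} {L₀ : ℝ} (hL : ∀ j, L j ≤ L₀) {x : Fin 6 → ℝ}
    (hx : x ∈ cyclicPolytope L) (i : Fin 6) : x i ≤ L₀ := by
  obtain ⟨j, hj⟩ := exists_one_le_cyclicCoeff i
  have h1 : cyclicCoeff j i * x i ≤ cyclicForm x j :=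
    Finset.single_le_sum (f := fun i => cyclicCoeff j i * x i)
      (fun k _ => mul_nonneg (cyclicCoeff_nonneg j k) (hx.1 k)) (Finset.mem_univ i)
  have h2 := hx.1 i
  nlinarith [hx.2 j, hL j]

theorem cyclicForm_insertNth (i : Fin 6) (t s : ℝ) (y : Fin 5 → ℝ) (j : Fin 3) :
    cyclicForm (i.insertNth t y) j = cyclicForm (i.insertNth s y) j + cyclicCoeff j i * (t - s) := by
  simp only [cyclicForm, Fin.sum_univ_succAbove _ i, Fin.insertNth_apply_same, Fin.insertNth_apply_succAbove]
  ring

/-- The forms have nonnegative coefficients, so lowering a coordinate to any nonnegative value stays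
inside the closed polytope. -/
theorem cyclicPolytope_slice {L : Fin 3 → ℝ} {L₀ : ℝ} (hL : ∀ j, L j ≤ L₀) (i : Fin 6) (y : Fin 5 → ℝ) :
    {t | i.insertNth t y ∈ cyclicPolytope L} = ∅ ∨
      ∃ M, 0 ≤ M ∧ M ≤ L₀ ∧ {t | i.insertNth t y ∈ cyclicPolytope L} = Icc 0 M := by
  have hcl : IsClosed (cyclicPolytope L) := by
    have : cyclicPolytope L = (⋂ i, {x | 0 ≤ x i}) ∩ ⋂ j, {x | cyclicForm x j ≤ L j} := by
      ext x; simp [cyclicPolytope]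
    rw [this]
    unfold cyclicForm
    exact (isClosed_iInter fun i => isClosed_le continuous_const (continuous_apply i)).inter
      (isClosed_iInter fun j => isClosed_le (by fun_prop) continuous_const)
  have hc : Continuous fun t : ℝ => (i.insertNth t y : Fin 6 → ℝ) :=
    Continuous.finInsertNth i continuous_id continuous_const
  have h0 : ∀ t ∈ {t | i.insertNth t y ∈ cyclicPolytope L}, 0 ≤ t := fun t ht => by
    have := ht.1 i
    rwa [Fin.insertNth_apply_same] at this
  refine eq_empty_or_eq_Icc (hcl.preimage hc) h0 (fun t ht => ?_) fun t ht s hs hst => ⟨fun k => ?_, fun j => ?_⟩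
  · have := le_of_mem_cyclicPolytope hL ht i
    rwa [Fin.insertNth_apply_same] at this
  · by_cases hk : k = i
    · subst hk; rwa [Fin.insertNth_apply_same]
    · obtain ⟨k, rfl⟩ := Fin.exists_succAbove_eq hk
      have := ht.1 (i.succAbove k)
      rwa [Fin.insertNth_apply_succAbove] at this ⊢
  · rw [cyclicForm_insertNth i s t]
    have := ht.2 j
    nlinarith [cyclicCoeff_nonneg j i]

section Estimate

variable {ι : Fin 6 → Type*} [∀ i, Fintype (ι i)] {x : ∀ i, ι i → ℝ} {κ C θ L₀ : ℝ}

/-- By `pi_le_pi_add` only slices parallel to the axes matter. These are initial intervals, on which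
the two measures differ by at most `c`; each of the other five coordinates has mass at most `L₀ +
c`. -/
theorem pi_pointMeasure_cyclicPolytope (hκ : 0 < κ) (hC : 0 ≤ C) (hθ : 0 < θ) (hL₀ : 0 ≤ L₀)
    (h : ∀ i, IsExpDistributed (x i) κ C θ L₀) {L : Fin 3 → ℝ} (hL : ∀ j, L j ≤ L₀) :
    let c := (κ + C + C / θ) / κ
    Measure.pi (fun i => pointMeasure (x i) κ) (cyclicPolytope L) ≤
      volume (cyclicPolytope L) + ENNReal.ofReal (6 * (c * (L₀ + c) ^ 5)) ∧
    volume (cyclicPolytope L) ≤ Measure.pi (fun i => pointMeasure (x i) κ) (cyclicPolytope L) +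
      ENNReal.ofReal (6 * (c * (L₀ + c) ^ 5)) := by
  intro c
  have hc : 0 ≤ c := by positivity
  have hvol : volume (cyclicPolytope L) =
      Measure.pi (fun _ : Fin 6 => (volume : Measure ℝ).restrict (Icc 0 L₀)) (cyclicPolytope L) := by
    rw [← Measure.restrict_pi_pi, Measure.restrict_apply (measurableSet_cyclicPolytope L), ← volume_pi,
      inter_eq_left.2 fun x hx i _ => ⟨hx.1 i, le_of_mem_cyclicPolytope hL hx i⟩]
  have hμ : ∀ i, pointMeasure (x i) κ univ ≤ ENNReal.ofReal (L₀ + c) := fun i => by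
    rw [(h i).pointMeasure_univ, ENNReal.ofReal_add hL₀ hc]
    exact ((h i).pointMeasure_le hκ hC hθ hL₀ le_rfl).1
  have hν : ∀ _ : Fin 6, (volume : Measure ℝ).restrict (Icc 0 L₀) univ ≤ ENNReal.ofReal (L₀ + c) := fun _ => by
    simp
    gcongr
    linarith
  have hs : ∀ {M : ℝ}, M ≤ L₀ → (volume : Measure ℝ).restrict (Icc 0 L₀) (Icc 0 M) = ENNReal.ofReal M := by
    intro M hM
    rw [Measure.restrict_apply measurableSet_Icc, inter_eq_left.2 (Icc_subset_Icc_right hM)]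
    simp
  have he : ENNReal.ofReal (6 * (c * (L₀ + c) ^ 5)) =
      ((5 : ℕ) + 1) * (ENNReal.ofReal c * ENNReal.ofReal (L₀ + c) ^ 5) := by
    rw [ENNReal.ofReal_mul (by norm_num), ENNReal.ofReal_mul hc, ENNReal.ofReal_pow (by positivity)]
    norm_num
  rw [hvol, he]
  constructor
  · refine pi_le_pi_add _ _ (measurableSet_cyclicPolytope L) hμ hν fun i y => ?_
    rcases cyclicPolytope_slice hL i y with hT | ⟨M, h0, hM, hT⟩
    · rw [hT]; simp
    · rw [hT, hs hM]
      exact ((h i).pointMeasure_le hκ hC hθ h0 hM).1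
  · refine pi_le_pi_add _ _ (measurableSet_cyclicPolytope L) hν hμ fun i y => ?_
    rcases cyclicPolytope_slice hL i y with hT | ⟨M, h0, hM, hT⟩
    · rw [hT]; simp
    · rw [hT, hs hM]
      exact ((h i).pointMeasure_le hκ hC hθ h0 hM).2

theorem prod_ofReal_exp_div (hκ : 0 < κ) (t : Fin 6 → ℝ) :
    ∏ i, ENNReal.ofReal (Real.exp (-t i) / κ) = ENNReal.ofReal (Real.exp (-∑ i, t i) / κ ^ 6) := by
  rw [← ENNReal.ofReal_prod_of_nonneg fun i _ => by positivity, Finset.prod_div_distrib, ← Real.exp_sum,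
    Finset.sum_neg_distrib]
  simp

theorem lintegral_pi_pointMeasure_ofReal (hκ : 0 < κ) {f : (Fin 6 → ℝ) → ℝ} (hf : Measurable f) (h0 : ∀ x, 0 ≤ f x) :
    ∫⁻ t, ENNReal.ofReal (f t) ∂Measure.pi (fun i => pointMeasure (x i) κ) =
      ENNReal.ofReal ((∑ z : ∀ i, ι i, Real.exp (-∑ i, x i (z i)) * f fun i => x i (z i)) / κ ^ 6) := by
  rw [lintegral_pi_pointMeasure x κ (by fun_prop), Finset.sum_div, ENNReal.ofReal_sum_of_nonneg]
  · refine Finset.sum_congr rfl fun z _ => ?_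
    rw [prod_ofReal_exp_div hκ fun i => x i (z i), ← ENNReal.ofReal_mul (by positivity)]
    congr 1; ring
  · intro z _
    have := h0 fun i => x i (z i)
    positivity

theorem sum_cyclicPolytope_sub (hκ : 0 < κ) (hC : 0 ≤ C) (hθ : 0 < θ) (hL₀ : 0 ≤ L₀)
    (h : ∀ i, IsExpDistributed (x i) κ C θ L₀) {L : Fin 3 → ℝ} (hL : ∀ j, L j ≤ L₀) :
    let c := (κ + C + C / θ) / κ
    |∑ z : ∀ i, ι i, Real.exp (-∑ i, x i (z i)) * (cyclicPolytope L).indicator (fun _ => 1) (fun i => x i (z i)) -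
      κ ^ 6 * (volume (cyclicPolytope L)).toReal| ≤ κ ^ 6 * (6 * (c * (L₀ + c) ^ 5)) := by
  intro c
  have hc : 0 ≤ c := by positivity
  obtain ⟨h1, h2⟩ := pi_pointMeasure_cyclicPolytope hκ hC hθ hL₀ h hL
  have h3 := lintegral_pi_pointMeasure_ofReal (x := x) hκ
    (f := (cyclicPolytope L).indicator (fun _ => 1)) (measurable_one.indicator (measurableSet_cyclicPolytope L))
    (fun x => indicator_nonneg (fun _ _ => zero_le_one) x)
  have h4 : ∀ t, ENNReal.ofReal ((cyclicPolytope L).indicator (fun _ => 1) t) =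
      (cyclicPolytope L).indicator 1 t := fun t => by
    by_cases ht : t ∈ cyclicPolytope L <;> simp [ht]
  simp_rw [h4] at h3
  rw [lintegral_indicator_one (measurableSet_cyclicPolytope L)] at h3
  set S := ∑ z : ∀ i, ι i, Real.exp (-∑ i, x i (z i)) * (cyclicPolytope L).indicator (fun _ => 1) (fun i => x i (z i)) with hS
  have hS0 : 0 ≤ S := Finset.sum_nonneg fun z _ =>
    mul_nonneg (Real.exp_pos _).le (indicator_nonneg (fun _ _ => zero_le_one) _)
  have hfin : volume (cyclicPolytope L) ≠ ⊤ := by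
    refine ne_top_of_le_ne_top ?_ h2
    rw [h3]; exact ENNReal.add_ne_top.2 ⟨ENNReal.ofReal_ne_top, ENNReal.ofReal_ne_top⟩
  rw [h3] at h1 h2
  have hS1 : 0 ≤ S / κ ^ 6 := by positivity
  have hE : 0 ≤ 6 * (c * (L₀ + c) ^ 5) := by positivity
  rw [← ENNReal.ofReal_toReal hfin, ← ENNReal.ofReal_add ENNReal.toReal_nonneg hE,
    ENNReal.ofReal_le_ofReal_iff (add_nonneg ENNReal.toReal_nonneg hE), div_le_iff₀ (by positivity)] at h1
  rw [← ENNReal.ofReal_toReal hfin, ← ENNReal.ofReal_add hS1 hE,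
    ENNReal.ofReal_le_ofReal_iff (add_nonneg hS1 hE), ← sub_le_iff_le_add, le_div_iff₀ (by positivity)] at h2
  rw [abs_le]
  constructor <;> linarith

/-- Choose a coordinate that enters the `j`-th form with coefficient `1`. If its slice is `[0, M]`,
the slack of the form at `x` is at least `M - x`, so the sum along the slice is bounded by
`sum_exp_le`. Only five coordinates are left to contribute powers of `L₀`. -/
theorem sum_cyclicPolytope_exp_le (hκ : 0 < κ) (hC : 0 ≤ C) (hθ : 0 < θ) {η : ℝ} (hη : 0 < η)
    (hL₀ : 0 ≤ L₀)
    (h : ∀ i, IsExpDistributed (x i) κ C θ L₀) {L : Fin 3 → ℝ} (hL : ∀ j, L j ≤ L₀) (j : Fin 3) :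
    let c := (κ + C + C / θ) / κ
    ∑ z : ∀ i, ι i, Real.exp (-∑ i, x i (z i)) * (cyclicPolytope L).indicator
      (fun t => Real.exp (-η * (L j - cyclicForm t j))) (fun i => x i (z i)) ≤
      κ ^ 6 * ((κ + C) * (1 + 1 / η) / κ * (L₀ + c) ^ 5) := by
  intro c
  have hc : 0 ≤ c := by positivity
  set D := (κ + C) * (1 + 1 / η) / κ with hD
  have hD0 : 0 ≤ D := by positivity
  have hfm : Measurable ((cyclicPolytope L).indicator (fun t => Real.exp (-η * (L j - cyclicForm t j)))) :=
    Measurable.indicator (by fun_prop) (measurableSet_cyclicPolytope L)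
  have h3 := lintegral_pi_pointMeasure_ofReal (x := x) hκ
    (f := (cyclicPolytope L).indicator (fun t => Real.exp (-η * (L j - cyclicForm t j)))) hfm
    (fun x => indicator_nonneg (fun _ _ => (Real.exp_pos _).le) x)
  obtain ⟨i, hi⟩ := exists_cyclicCoeff_eq_one j
  rw [lintegral_pi_insertNth_symm _ i (by fun_prop)] at h3
  have hμ : ∀ i, pointMeasure (x i) κ univ ≤ ENNReal.ofReal (L₀ + c) := fun i => by
    rw [(h i).pointMeasure_univ, ENNReal.ofReal_add hL₀ hc]
    exact ((h i).pointMeasure_le hκ hC hθ hL₀ le_rfl).1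
  have key : ∀ y : Fin 5 → ℝ, ∫⁻ t, ENNReal.ofReal ((cyclicPolytope L).indicator
      (fun t => Real.exp (-η * (L j - cyclicForm t j))) (i.insertNth t y)) ∂pointMeasure (x i) κ ≤ ENNReal.ofReal D := by
    intro y
    rcases cyclicPolytope_slice hL i y with hT | ⟨M, h0, hM, hT⟩
    · have : ∀ t, i.insertNth t y ∉ cyclicPolytope L := fun t ht => by
        have : t ∈ ({t | i.insertNth t y ∈ cyclicPolytope L} : Set ℝ) := ht
        rw [hT] at this; exact this
      simp [indicator_of_notMem (this _)]
    · have hmem : ∀ t, i.insertNth t y ∈ cyclicPolytope L ↔ t ∈ Icc 0 M := fun t => by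
        rw [← hT]; rfl
      have hMP : i.insertNth M y ∈ cyclicPolytope L := (hmem M).2 ⟨h0, le_rfl⟩
      rw [lintegral_pointMeasure]
      calc _ ≤ ∑ a, ENNReal.ofReal (if x i a ≤ M then Real.exp (-x i a) * Real.exp (-η * (M - x i a)) / κ else 0) := by
            refine Finset.sum_le_sum fun a _ => ?_
            rw [← ENNReal.ofReal_mul (by positivity)]
            refine ENNReal.ofReal_le_ofReal ?_
            by_cases ha : x i a ≤ M
            · rw [indicator_of_mem ((hmem _).2 ⟨(h i).nonneg a, ha⟩), if_pos ha, div_mul_eq_mul_div]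
              refine div_le_div_of_nonneg_right (mul_le_mul_of_nonneg_left (Real.exp_le_exp.2 ?_)
                (Real.exp_pos _).le) hκ.le
              rw [cyclicForm_insertNth i _ M, hi]
              have := hMP.2 j
              nlinarith
            · rw [indicator_of_notMem fun hm => ha ((hmem _).1 hm).2, if_neg ha, mul_zero]
        _ = ENNReal.ofReal ((∑ a with x i a ≤ M, Real.exp (-x i a) * Real.exp (-η * (M - x i a))) / κ) := by
            rw [Finset.sum_filter, Finset.sum_div, ENNReal.ofReal_sum_of_nonneg]
            · refine Finset.sum_congr rfl fun a _ => ?_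
              split_ifs <;> simp
            · intro a _
              split_ifs <;> positivity
        _ ≤ _ := by
            refine ENNReal.ofReal_le_ofReal ?_
            have := (h i).sum_exp_le hκ.le hC hθ.le hη h0 hM
            rw [hD]; gcongr
  have h5 : ENNReal.ofReal ((∑ z : ∀ i, ι i, Real.exp (-∑ i, x i (z i)) * (cyclicPolytope L).indicator
      (fun t => Real.exp (-η * (L j - cyclicForm t j))) (fun i => x i (z i))) / κ ^ 6) ≤
      ENNReal.ofReal (D * (L₀ + c) ^ 5) := by
    rw [← h3]
    refine (lintegral_mono key).trans ?_
    rw [lintegral_const, ENNReal.ofReal_mul hD0, ENNReal.ofReal_pow (by positivity)]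
    gcongr
    exact pi_univ_le _ fun k => hμ _
  rw [ENNReal.ofReal_le_ofReal_iff (by positivity), div_le_iff₀ (by positivity)] at h5
  linarith

end Estimate
end PolytopeSum
end CubicTorsor

namespace CubicTorsor

/-! ### Norms of ideal elements modulo units. -/

section Representatives

open InfinitePlace Module Units

/-- `D` contains exactly one element of every coset of `F`. -/
def IsCosetTransversal {G : Type*} [Group G] (F : Subgroup G) (D : Set G) : Prop :=
  ∀ y : G, ∃! ζ : G, ζ ∈ F ∧ ζ * y ∈ D

theorem exists_isCosetTransversal {G : Type*} [CommGroup G] (F : Subgroup G) :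
    ∃ D : Set G, IsCosetTransversal F D := by
  refine ⟨Set.range (Quotient.out : G ⧸ F → G), fun y => ?_⟩
  refine ⟨Quotient.out (y : G ⧸ F) * y⁻¹, ⟨?_, ?_⟩, ?_⟩
  · have h : ((Quotient.out (y : G ⧸ F) : G) : G ⧸ F) = (y : G ⧸ F) := QuotientGroup.out_eq' _
    have := QuotientGroup.eq.1 h.symm
    rwa [mul_comm] at this
  · exact ⟨(y : G ⧸ F), by simp⟩
  · rintro ζ ⟨hζ, q, hq⟩
    have h1 : q = (y : G ⧸ F) := by
      have h : ((Quotient.out q : G) : G ⧸ F) = q := QuotientGroup.out_eq' _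
      rw [← h, hq]
      refine (QuotientGroup.eq.2 ?_)
      rw [mul_comm ζ y, mul_inv_rev, _root_.inv_mul_cancel_right]
      exact F.inv_mem hζ
    rw [← h1, hq, _root_.mul_inv_cancel_right]

variable {K : Type*} [Field K] [NumberField K]

/-- The absolute value of the norm. -/
noncomputable def absNorm (y : Kˣ) : ℝ := ∏ w : InfinitePlace K, w (y : K) ^ mult w

theorem absNorm_pos (y : Kˣ) : 0 < absNorm y := Finset.prod_pos fun w _ => pow_pos (place_pos w y) _

theorem absNorm_mul (x y : Kˣ) : absNorm (x * y) = absNorm x * absNorm y := by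
  simp [absNorm, mul_pow, Finset.prod_mul_distrib]

theorem absNorm_pow (x : Kˣ) (n : ℕ) : absNorm (x ^ n) = absNorm x ^ n := by
  simp only [absNorm, Units.val_pow_eq_pow_val, map_pow, ← Finset.prod_pow]
  exact Finset.prod_congr rfl fun w _ => by rw [← pow_mul, ← pow_mul, mul_comm]

theorem idealNorm_le_absNorm (I : (FractionalIdeal (𝓞 K)⁰ K)ˣ) {y : Kˣ}
    (hy : (y : K) ∈ (I : FractionalIdeal (𝓞 K)⁰ K)) :
    idealNorm (I : FractionalIdeal (𝓞 K)⁰ K) ≤ absNorm y := by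
  rw [absNorm, prod_eq_abs_norm]
  exact_mod_cast idealNorm_le_abs_norm I hy y.ne_zero

/-- The logarithm of the norm relative to an ideal. -/
noncomputable def logRatio (I : (FractionalIdeal (𝓞 K)⁰ K)ˣ) (y : Kˣ) : ℝ :=
  Real.log (absNorm y / idealNorm (I : FractionalIdeal (𝓞 K)⁰ K))

theorem logRatio_nonneg (I : (FractionalIdeal (𝓞 K)⁰ K)ˣ) {y : Kˣ}
    (hy : (y : K) ∈ (I : FractionalIdeal (𝓞 K)⁰ K)) : 0 ≤ logRatio I y :=
  Real.log_nonneg ((one_le_div (idealNorm_pos I)).2 (idealNorm_le_absNorm I hy))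

theorem logRatio_le_iff (I : (FractionalIdeal (𝓞 K)⁰ K)ˣ) (y : Kˣ) (t : ℝ) :
    logRatio I y ≤ t ↔ absNorm y ≤ Real.exp t * idealNorm (I : FractionalIdeal (𝓞 K)⁰ K) := by
  rw [logRatio, Real.log_le_iff_le_exp (div_pos (absNorm_pos y) (idealNorm_pos I)),
    div_le_iff₀ (idealNorm_pos I)]

/-- The representatives in an ideal whose relative norm is bounded. -/
def boundedReps (D : Set Kˣ) (I : (FractionalIdeal (𝓞 K)⁰ K)ˣ) (L : ℝ) : Set Kˣ :=
  {y | y ∈ D ∧ (y : K) ∈ (I : FractionalIdeal (𝓞 K)⁰ K) ∧ logRatio I y ≤ L}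

theorem boundedReps_eq_image (D : Set Kˣ) (I : (FractionalIdeal (𝓞 K)⁰ K)ˣ) (t : ℝ) :
    boundedReps D I t = (fun y : Unit → Kˣ => y ()) '' weightedPoints (fun _ : Unit => I) (fun _ _ => 1)
      {y | y () ∈ D} (Real.exp t * idealNorm (I : FractionalIdeal (𝓞 K)⁰ K)) := by
  have hw : ∀ y : Unit → Kˣ, weightedHeight (fun _ _ => 1) y = absNorm (y ()) := fun y => by
    simp [weightedHeight, gauge, absNorm]
  ext y
  simp only [boundedReps, weightedPoints, Set.mem_image, Set.mem_ofPred_eq, hw, logRatio_le_iff]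
  constructor
  · rintro ⟨h1, h2, h3⟩
    exact ⟨fun _ => y, ⟨h1, fun _ => h2, h3⟩, rfl⟩
  · rintro ⟨y, ⟨h1, h2, h3⟩, rfl⟩
    exact ⟨h1, h2 (), h3⟩

variable (K) in
-- This is the tuple count for a single coordinate of weight one: relative to the ideal, norm bound
-- `e^t` means density `e^t`, so `μ = e^t` is allowed.
theorem exists_isExpDistributed :
    ∃ C : ℝ, 0 < C ∧ ∀ F : Subgroup Kˣ, IsUnitComplement F → ∀ D : Set Kˣ, IsCosetTransversal F D →
      ∀ (I : (FractionalIdeal (𝓞 K)⁰ K)ˣ) (L : ℝ), (boundedReps D I L).Finite ∧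
        ∀ [Fintype (boundedReps D I L)], IsExpDistributed (fun y : boundedReps D I L => logRatio I y)
          (regulator K * boxConst K) C (saving K) L := by
  obtain ⟨C, hC, h⟩ := exists_weightedPoints_estimate K Unit
  refine ⟨C, hC, fun F hF D hD I L => ?_⟩
  have hN := idealNorm_pos I
  have hY : IsTransversal F {y : Unit → Kˣ | y () ∈ D} := fun y => hD (y ())
  have hinj : Function.Injective fun y : Unit → Kˣ => y () := fun a b h => funext fun _ => h
  have hdens : ∀ t : ℝ, ∀ j : Unit, density (fun _ : Unit => I) (fun _ _ => 1)
      (Real.exp t * idealNorm (I : FractionalIdeal (𝓞 K)⁰ K)) j = Real.exp t := fun t j => by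
    simp [density]; field_simp
  have key : ∀ t : ℝ, 0 ≤ t → (boundedReps D I t).Finite ∧
      |((boundedReps D I t).ncard : ℝ) - regulator K * boxConst K * Real.exp t| ≤
        C * Real.exp ((1 - saving K) * t) := by
    intro t ht
    obtain ⟨h1, h2⟩ := h F hF _ hY (fun _ => I) (fun _ _ => 1) (fun _ _ => one_pos)
      (Real.exp t * idealNorm (I : FractionalIdeal (𝓞 K)⁰ K)) (by positivity) (Real.exp t)
      (Real.one_le_exp ht) (fun j => (hdens t j).ge)
    rw [boundedReps_eq_image]
    refine ⟨h1.image _, ?_⟩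
    rw [Set.ncard_image_of_injective _ hinj]
    simp only [hdens, Fintype.card_unit, Nat.cast_one, one_pow, one_mul, pow_one, Finset.univ_unique,
      Finset.prod_const, Finset.card_singleton] at h2
    convert! h2 using 2
    rw [← Real.exp_mul, ← Real.exp_add]
    ring_nf
  constructor
  · rcases le_or_gt 0 L with hL | hL
    · exact (key L hL).1
    · convert! Set.finite_empty
      refine Set.eq_empty_of_forall_notMem fun y hy => ?_
      exact absurd (logRatio_nonneg I hy.2.1) (not_le.2 (hy.2.2.trans_lt hL))
  · intro _
    refine ⟨fun y => logRatio_nonneg I y.2.2.1, fun y => y.2.2.2, fun t h0 ht => ?_⟩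
    have hest := (key t h0).2
    have hcard : (Finset.univ.filter fun y : boundedReps D I L => logRatio I y ≤ t).card =
        (boundedReps D I t).ncard := by
      rw [Set.ncard_eq_toFinset_card _ (key t h0).1]
      refine Finset.card_bij (fun y _ => (y : Kˣ)) ?_ ?_ ?_
      · intro y hy
        rw [Set.Finite.mem_toFinset]
        exact ⟨y.2.1, y.2.2.1, (Finset.mem_filter.1 hy).2⟩
      · intro a _ b _ hab
        exact Subtype.ext hab
      · intro y hy
        rw [Set.Finite.mem_toFinset] at hy
        exact ⟨⟨y, hy.1, hy.2.1, hy.2.2.trans ht⟩, by simpa using hy.2.2, rfl⟩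
    rwa [hcard]

end Representatives

/-! ### Invariance under the unit action. -/

section Orbits

open InfinitePlace Module Units

variable {K : Type*} [Field K]

theorem act_one (y : TorsorIndex → Kˣ) : act (fun _ => 1) y = y := by
  ext v; cases v <;> simp [act]

theorem act_act (ζ ξ : UnitIndex → Kˣ) (y : TorsorIndex → Kˣ) :
    act ζ (act ξ y) = act (fun i => ζ i * ξ i) y := by
  funext v
  cases v <;> simp only [act, _root_.mul_inv, mul_pow] <;> ac_rfl

theorem exists_act_eq_mul {F : Subgroup Kˣ} {ζ : UnitIndex → Kˣ} (hζ : ∀ i, ζ i ∈ F) (y : TorsorIndex → Kˣ)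
    (v : TorsorIndex) : ∃ ξ ∈ F, act ζ y v = ξ * y v := by
  have hi : ∀ i, (ζ i)⁻¹ ∈ F := fun i => F.inv_mem (hζ i)
  have h2 : ∀ i, (ζ i ^ 2)⁻¹ ∈ F := fun i => F.inv_mem (F.pow_mem (hζ i) 2)
  cases v
  case v12 => exact ⟨_, F.mul_mem (F.mul_mem (F.mul_mem (F.mul_mem (hζ _) (h2 _)) (hi _)) (hi _)) (hi _), rfl⟩
  case v23 => exact ⟨_, F.mul_mem (F.mul_mem (F.mul_mem (F.mul_mem (hζ _) (h2 _)) (hi _)) (hi _)) (hi _), rfl⟩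
  case v31 => exact ⟨_, F.mul_mem (F.mul_mem (F.mul_mem (F.mul_mem (hζ _) (h2 _)) (hi _)) (hi _)) (hi _), rfl⟩
  all_goals exact ⟨_, hζ _, rfl⟩

/-- The exponents in `⊙` are arranged so that all three monomials pick up the same unit; as its norm
is one, the height is invariant. -/
theorem exists_psi_act_eq_mul {F : Subgroup Kˣ} {ζ : UnitIndex → Kˣ} (hζ : ∀ i, ζ i ∈ F)
    (y : TorsorIndex → Kˣ) : ∃ ξ ∈ F, ∀ j, psi (act ζ y) j = (ξ : K) * psi y j := by
  refine ⟨ζ .z ^ 3 * (ζ .z1 ^ 2)⁻¹ * (ζ .z2 ^ 2)⁻¹ * (ζ .z3 ^ 2)⁻¹ * (ζ .z21)⁻¹ * (ζ .z32)⁻¹ * (ζ .z13)⁻¹, ?_, ?_⟩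
  · have hi : ∀ i, (ζ i)⁻¹ ∈ F := fun i => F.inv_mem (hζ i)
    have h2 : ∀ i, (ζ i ^ 2)⁻¹ ∈ F := fun i => F.inv_mem (F.pow_mem (hζ i) 2)
    exact F.mul_mem (F.mul_mem (F.mul_mem (F.mul_mem (F.mul_mem (F.mul_mem (F.pow_mem (hζ _) 3) (h2 _)) (h2 _))
      (h2 _)) (hi _)) (hi _)) (hi _)
  · intro j
    have hne : ∀ i, (ζ i : K) ≠ 0 := fun i => (ζ i).ne_zero
    have h0 := hne .z
    have h1 := hne .z1
    have h2 := hne .z2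
    have h3 := hne .z3
    have h4 := hne .z21
    have h5 := hne .z32
    have h6 := hne .z13
    fin_cases j <;> simp [psi, act] <;> field_simp

variable [NumberField K]

theorem height_act {F : Subgroup Kˣ} (hF : IsUnitComplement F) {ζ : UnitIndex → Kˣ} (hζ : ∀ i, ζ i ∈ F)
    (y : TorsorIndex → Kˣ) : height (act ζ y) = height y := by
  obtain ⟨ξ, hξ, h⟩ := exists_psi_act_eq_mul hζ y
  have h1 : ∀ w : InfinitePlace K, (Finset.univ.sup' Finset.univ_nonempty fun j : Fin 3 => w (psi (act ζ y) j)) =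
      w (ξ : K) * Finset.univ.sup' Finset.univ_nonempty fun j : Fin 3 => w (psi y j) := by
    intro w
    rw [Finset.mul₀_sup' (place_pos w ξ).le]
    simp_rw [h, map_mul]
  simp only [height, h1, mul_pow, Finset.prod_mul_distrib]
  rw [hF.prod_eq_one hξ, one_mul]

theorem act_mem_ideal_iff {F : Subgroup Kˣ} (hF : IsUnitComplement F) {ζ : UnitIndex → Kˣ} (hζ : ∀ i, ζ i ∈ F)
    (y : TorsorIndex → Kˣ) (A : FractionalIdeal (𝓞 K)⁰ K) (v : TorsorIndex) :
    (act ζ y v : K) ∈ A ↔ (y v : K) ∈ A := by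
  obtain ⟨ξ, hξ, h⟩ := exists_act_eq_mul hζ y v
  rw [h]
  exact hF.mul_mem_iff hξ A (y v)

/-- Send each point to the representative of its orbit in `R'`. Two points with the same image share
an orbit, which meets `R` only once. -/
theorem encard_points_le {F : Subgroup Kˣ} (hF : IsUnitComplement F) {R R' : Set (TorsorIndex → Kˣ)}
    (hR : IsOrbitRepresentatives F R) (hR' : IsOrbitRepresentatives F R')
    (𝔞 : TorsorIndex → FractionalIdeal (𝓞 K)⁰ K) (B : ℝ) :
    (points R 𝔞 B).encard ≤ (points R' 𝔞 B).encard := by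
  choose f hf ζ hζ hfζ using fun y => (hR' y).exists
  refine Set.encard_le_encard_of_injOn (f := f) ?_ ?_
  · rintro y ⟨⟨_, hB⟩, hy⟩
    refine ⟨⟨hf y, ?_⟩, fun v => ?_⟩
    · rw [hfζ, height_act hF (hζ y)]; exact hB
    · rw [hfζ, act_mem_ideal_iff hF (hζ y)]; exact hy v
  · rintro y ⟨⟨hy, _⟩, _⟩ z ⟨⟨hz, _⟩, _⟩ hyz
    have hz' : z = act (fun i => (ζ z i)⁻¹ * ζ y i) y := by
      rw [← act_act, ← hfζ y, hyz, hfζ z, act_act]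
      simp [act_one]
    exact (hR y).unique ⟨hy, fun _ => 1, fun _ => F.one_mem, (act_one y).symm⟩
      ⟨hz, _, fun i => F.mul_mem (F.inv_mem (hζ z i)) (hζ y i), hz'⟩

theorem encard_points_eq {F : Subgroup Kˣ} (hF : IsUnitComplement F) {R R' : Set (TorsorIndex → Kˣ)}
    (hR : IsOrbitRepresentatives F R) (hR' : IsOrbitRepresentatives F R')
    (𝔞 : TorsorIndex → FractionalIdeal (𝓞 K)⁰ K) (B : ℝ) :
    (points R 𝔞 B).encard = (points R' 𝔞 B).encard :=
  (encard_points_le hF hR hR' 𝔞 B).antisymm (encard_points_le hF hR' hR 𝔞 B)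

end Orbits
end CubicTorsor

namespace CubicTorsor

/-! ### An explicit system of orbit representatives. -/

section StandardRepresentatives

open InfinitePlace Module

variable {K : Type*} [Field K] [NumberField K]
variable {u : Fin (Units.rank K) → (𝓞 K)ˣ} {D : Set Kˣ}

/-- The units representing the classes of the generated group modulo cubes. -/
noncomputable def cubeClass (u : Fin (Units.rank K) → (𝓞 K)ˣ) (e : Fin (Units.rank K) → Fin 3) : Kˣ :=
  unitMonomial u fun i => ((e i : ℕ) : ℤ)

theorem cubeClass_mem (u : Fin (Units.rank K) → (𝓞 K)ˣ) (e : Fin (Units.rank K) → Fin 3) :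
    cubeClass u e ∈ generated u := (mem_generated_iff u).2 ⟨_, rfl⟩

/-- Representatives modulo the cubes of the generated group. -/
def cubeReps (u : Fin (Units.rank K) → (𝓞 K)ˣ) (D : Set Kˣ) : Set Kˣ :=
  {y | ∃ e : Fin (Units.rank K) → Fin 3, ∃ d ∈ D, y = cubeClass u e * d}

theorem unitMonomial_pow (u : Fin (Units.rank K) → (𝓞 K)ˣ) (e : Fin (Units.rank K) → ℤ) (n : ℕ) :
    unitMonomial u e ^ n = unitMonomial u fun i => n * e i := by
  induction n with
  | zero =>
    rw [pow_zero, ← unitMonomial_zero u]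
    congr 1; ext i; simp
  | succ n ih =>
    rw [pow_succ, ih, ← unitMonomial_add]
    congr 1; ext i; simp; ring

theorem IsCosetTransversal.eq_one {G : Type*} [Group G] {F : Subgroup G} {D : Set G} (hD : IsCosetTransversal F D)
    {ζ y : G} (hζ : ζ ∈ F) (hy : y ∈ D) (h : ζ * y ∈ D) : ζ = 1 :=
  (hD y).unique ⟨hζ, h⟩ ⟨F.one_mem, by rwa [one_mul]⟩

theorem cubeClass_mul_injective (hu : IsFundamentalSystem u) (hD : IsCosetTransversal (generated u) D)
    {e e' : Fin (Units.rank K) → Fin 3} {f f' : Fin (Units.rank K) → ℤ} {d d' : Kˣ} (hd : d ∈ D) (hd' : d' ∈ D)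
    (h : unitMonomial u f * (cubeClass u e * d) = unitMonomial u f' * (cubeClass u e' * d')) :
    d = d' ∧ ∀ i, f i + (e i : ℕ) = f' i + (e' i : ℕ) := by
  rw [cubeClass, cubeClass, ← mul_assoc, ← mul_assoc, ← unitMonomial_add, ← unitMonomial_add] at h
  have h2 : d' = (unitMonomial u (f' + fun i => ((e' i : ℕ) : ℤ)))⁻¹ * unitMonomial u (f + fun i => ((e i : ℕ) : ℤ)) * d := by
    rw [mul_assoc, h, inv_mul_cancel_left]
  have h3 := hD.eq_one ((generated u).mul_mem ((generated u).inv_mem ((mem_generated_iff u).2 ⟨_, rfl⟩))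
    ((mem_generated_iff u).2 ⟨_, rfl⟩)) hd (h2 ▸ hd')
  refine ⟨by rw [h2, h3, one_mul], fun i => ?_⟩
  have h4 := hu.unitMonomial_injective (inv_mul_eq_one.1 h3)
  exact (congrFun h4 i).symm

/-- If `u^m g ∈ D`, then `ζ = u^f` qualifies exactly when `3 f = m + e` with all entries of `e` in
`{0, 1, 2}`; this determines `e` and `f`. -/
theorem existsUnique_cube_mul_mem (hu : IsFundamentalSystem u) (hD : IsCosetTransversal (generated u) D) (g : Kˣ) :
    ∃! ζ : Kˣ, ζ ∈ generated u ∧ ζ ^ 3 * g ∈ cubeReps u D := by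
  obtain ⟨ξ, ⟨hξ, hd⟩, -⟩ := hD g
  obtain ⟨m, rfl⟩ := (mem_generated_iff u).1 hξ
  have he : ∀ k : ℤ, ∃ (e : Fin 3) (f : ℤ), 3 * f = k + (e : ℕ) := by
    intro k
    have h3 : k % 3 = 0 ∨ k % 3 = 1 ∨ k % 3 = 2 := by omega
    rcases h3 with h | h | h
    · exact ⟨0, k / 3, by simp; omega⟩
    · exact ⟨2, k / 3 + 1, by simp; omega⟩
    · exact ⟨1, k / 3 + 1, by simp; omega⟩
  choose e f hef using fun i => he (m i)
  refine ⟨unitMonomial u f, ⟨(mem_generated_iff u).2 ⟨f, rfl⟩, e, _, hd, ?_⟩, ?_⟩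
  · rw [← mul_assoc, unitMonomial_pow, cubeClass, ← unitMonomial_add]
    congr 2; ext i
    simp only [Nat.cast_ofNat, Pi.add_apply]
    rw [hef]; ring
  · rintro ζ ⟨hζ, e', d', hd', h'⟩
    obtain ⟨f', rfl⟩ := (mem_generated_iff u).1 hζ
    have h1 : unitMonomial u m * (unitMonomial u f' ^ 3 * g) = unitMonomial u m * (cubeClass u e' * d') := by rw [h']
    have h2 : unitMonomial u (fun i => 3 * f' i) * (cubeClass u 0 * (unitMonomial u m * g)) =
        unitMonomial u m * (cubeClass u e' * d') := by
      rw [← h1, unitMonomial_pow, cubeClass]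
      have : (fun i => (((0 : Fin (Units.rank K) → Fin 3) i : ℕ) : ℤ)) = 0 := by ext i; simp
      rw [this, unitMonomial_zero, one_mul, mul_left_comm]
      norm_num
    have h3 := (cubeClass_mul_injective hu hD hd hd' h2).2
    congr 1
    ext i
    have h4 := h3 i
    have h5 := hef i
    have h6 := (e i).2
    have h7 := (e' i).2
    simp at h4
    omega

/-- A system of orbit representatives adapted to a coset transversal. -/
def standardReps (u : Fin (Units.rank K) → (𝓞 K)ˣ) (D : Set Kˣ) : Set (TorsorIndex → Kˣ) :=
  {y | y .v1 ∈ D ∧ y .v12 ∈ D ∧ y .v13 ∈ D ∧ y .v21 ∈ D ∧ y .v23 ∈ D ∧ y .v31 ∈ cubeReps u D ∧ y .v32 ∈ D}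

/-- The coordinates `1, 13, 21, 32` fix their own units. Then `12` and `23` express `ζ₂` and `ζ` as
constants times `ω²` and `ω⁴`, where `ω = ζ₃`. The coordinate `31` is thereby multiplied by a
constant times `ω⁴ ω⁻¹ = ω³`, and representatives modulo cubes fix `ω`. -/
theorem act_mem_standardReps_unique (hu : IsFundamentalSystem u) (hD : IsCosetTransversal (generated u) D)
    {y : TorsorIndex → Kˣ} {ζ ξ : UnitIndex → Kˣ} (hζ : ∀ i, ζ i ∈ generated u) (hξ : ∀ i, ξ i ∈ generated u)
    (h : act ζ y ∈ standardReps u D) (h' : act ξ y ∈ standardReps u D) : ζ = ξ := by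
  set F := generated u
  have hi : ∀ {a}, a ∈ F → a⁻¹ ∈ F := F.inv_mem
  have hm : ∀ {a b}, a ∈ F → b ∈ F → a * b ∈ F := F.mul_mem
  have hp : ∀ {a} (n : ℕ), a ∈ F → a ^ n ∈ F := fun n ha => F.pow_mem ha n
  have e1 : ζ .z1 = ξ .z1 := (hD _).unique ⟨hζ _, h.1⟩ ⟨hξ _, h'.1⟩
  have e13 : ζ .z13 = ξ .z13 := (hD _).unique ⟨hζ _, h.2.2.1⟩ ⟨hξ _, h'.2.2.1⟩
  have e21 : ζ .z21 = ξ .z21 := (hD _).unique ⟨hζ _, h.2.2.2.1⟩ ⟨hξ _, h'.2.2.2.1⟩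
  have e32 : ζ .z32 = ξ .z32 := (hD _).unique ⟨hζ _, h.2.2.2.2.2.2⟩ ⟨hξ _, h'.2.2.2.2.2.2⟩
  have m : ∀ {ζ : UnitIndex → Kˣ}, (∀ i, ζ i ∈ F) → ∀ a b c d e : UnitIndex,
      ζ a * (ζ b ^ 2)⁻¹ * (ζ c)⁻¹ * (ζ d)⁻¹ * (ζ e)⁻¹ ∈ F := fun h a b c d e =>
    hm (hm (hm (hm (h _) (hi (hp 2 (h _)))) (hi (h _))) (hi (h _))) (hi (h _))
  have e12 := (hD (y .v12)).unique ⟨m hζ .z .z2 .z32 .z1 .z21, h.2.1⟩ ⟨m hξ .z .z2 .z32 .z1 .z21, h'.2.1⟩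
  have e23 := (hD (y .v23)).unique ⟨m hζ .z .z3 .z13 .z2 .z32, h.2.2.2.2.1⟩ ⟨m hξ .z .z3 .z13 .z2 .z32, h'.2.2.2.2.1⟩
  rw [e1, e21, e32] at e12
  rw [e13, e32] at e23
  have a1 : ζ .z * (ζ .z2 ^ 2)⁻¹ = ξ .z * (ξ .z2 ^ 2)⁻¹ :=
    mul_right_cancel (mul_right_cancel (mul_right_cancel e12))
  have a2 : ζ .z * (ζ .z3 ^ 2)⁻¹ * (ζ .z2)⁻¹ = ξ .z * (ξ .z3 ^ 2)⁻¹ * (ξ .z2)⁻¹ := by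
    have := mul_right_cancel e23
    have k : ∀ a b c d : Kˣ, a * b * c * d = a * b * d * c := fun a b c d => by ac_rfl
    rw [k, k (ξ .z)] at this
    exact mul_right_cancel this
  have q2 : ζ .z2 = ξ .z2 * (ξ .z3 ^ 2)⁻¹ * ζ .z3 ^ 2 := by
    have : ζ .z2 * (ζ .z3 ^ 2)⁻¹ = ξ .z2 * (ξ .z3 ^ 2)⁻¹ := by
      have t : ∀ a b c : Kˣ, b * c⁻¹ = (a * c⁻¹ * b⁻¹) * (a * (b ^ 2)⁻¹)⁻¹ := fun a b c => by
        ext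
        have := a.ne_zero; have := b.ne_zero; have := c.ne_zero
        simp only [Units.val_inv_eq_inv_val, Units.val_mul, Units.val_pow_eq_pow_val]
        field_simp
      rw [t (ζ .z) (ζ .z2), t (ξ .z) (ξ .z2), a1, a2]
    rw [← this, inv_mul_cancel_right]
  have q0 : ζ .z = ξ .z * (ξ .z3 ^ 4)⁻¹ * ζ .z3 ^ 4 := by
    have : ζ .z = ξ .z * (ξ .z2 ^ 2)⁻¹ * ζ .z2 ^ 2 := by rw [← a1, inv_mul_cancel_right]
    rw [this, q2]
    ext
    have := (ξ .z2).ne_zero; have := (ξ .z3).ne_zero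
    simp only [Units.val_inv_eq_inv_val, Units.val_mul, Units.val_pow_eq_pow_val]
    field_simp
  have c1 := h.2.2.2.2.2.1
  have c2 := h'.2.2.2.2.2.1
  simp only [act] at c1 c2
  rw [e1, e13, e21] at c1
  have key : ∀ ω : Kˣ, ξ .z * (ξ .z3 ^ 4)⁻¹ * ω ^ 4 * (ξ .z1 ^ 2)⁻¹ * (ξ .z21)⁻¹ * ω⁻¹ * (ξ .z13)⁻¹ * y .v31 =
      ω ^ 3 * (ξ .z * (ξ .z3 ^ 4)⁻¹ * (ξ .z1 ^ 2)⁻¹ * (ξ .z21)⁻¹ * (ξ .z13)⁻¹ * y .v31) := fun ω => by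
    ext
    have := ω.ne_zero; have := (ξ .z3).ne_zero; have := (ξ .z1).ne_zero
    have := (ξ .z21).ne_zero; have := (ξ .z13).ne_zero
    simp only [Units.val_inv_eq_inv_val, Units.val_mul, Units.val_pow_eq_pow_val]
    field_simp
  have e3 : ζ .z3 = ξ .z3 := by
    refine (existsUnique_cube_mul_mem hu hD (ξ .z * (ξ .z3 ^ 4)⁻¹ * (ξ .z1 ^ 2)⁻¹ * (ξ .z21)⁻¹ * (ξ .z13)⁻¹ * y .v31)).unique
      ⟨hζ _, ?_⟩ ⟨hξ _, ?_⟩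
    · rw [← key, ← q0]; exact c1
    · rw [← key, inv_mul_cancel_right]; exact c2
  have e2 : ζ .z2 = ξ .z2 := by rw [q2, e3, inv_mul_cancel_right]
  have e0 : ζ .z = ξ .z := by rw [q0, e3, inv_mul_cancel_right]
  funext i
  cases i
  · exact e0
  · exact e1
  · exact e2
  · exact e3
  · exact e21
  · exact e32
  · exact e13

theorem exists_act_mem_standardReps (hu : IsFundamentalSystem u) (hD : IsCosetTransversal (generated u) D)
    (y : TorsorIndex → Kˣ) : ∃ ζ : UnitIndex → Kˣ, (∀ i, ζ i ∈ generated u) ∧ act ζ y ∈ standardReps u D := by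
  set F := generated u
  have hi : ∀ {a}, a ∈ F → a⁻¹ ∈ F := F.inv_mem
  have hm : ∀ {a b}, a ∈ F → b ∈ F → a * b ∈ F := F.mul_mem
  have hp : ∀ {a} (n : ℕ), a ∈ F → a ^ n ∈ F := fun n ha => F.pow_mem ha n
  obtain ⟨ζ1, ⟨h1, d1⟩, -⟩ := hD (y .v1)
  obtain ⟨ζ13, ⟨h13, d13⟩, -⟩ := hD (y .v13)
  obtain ⟨ζ21, ⟨h21, d21⟩, -⟩ := hD (y .v21)
  obtain ⟨ζ32, ⟨h32, d32⟩, -⟩ := hD (y .v32)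
  obtain ⟨α, ⟨hα, dα⟩, -⟩ := hD (y .v12)
  obtain ⟨β, ⟨hβ, dβ⟩, -⟩ := hD (y .v23)
  -- `a` and `b` are the values forced on `ζ ζ₂⁻²` and `ζ ζ₃⁻² ζ₂⁻¹`. With `ζ₃ = ω` these equations
  -- have the solution `ζ₂ = b a⁻¹ ω²`, `ζ = b² a⁻¹ ω⁴`.
  set a := α * ζ32 * ζ1 * ζ21 with ha
  set b := β * ζ13 * ζ32 with hb
  have haF : a ∈ F := hm (hm (hm hα h32) h1) h21
  have hbF : b ∈ F := hm (hm hβ h13) h32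
  obtain ⟨ω, ⟨hω, dω⟩, -⟩ := existsUnique_cube_mul_mem hu hD
    (b ^ 2 * a⁻¹ * (ζ1 ^ 2)⁻¹ * ζ21⁻¹ * ζ13⁻¹ * y .v31)
  have hz2 : b * a⁻¹ * ω ^ 2 ∈ F := hm (hm hbF (hi haF)) (hp 2 hω)
  have hz : b ^ 2 * a⁻¹ * ω ^ 4 ∈ F := hm (hm (hp 2 hbF) (hi haF)) (hp 4 hω)
  let ζ : UnitIndex → Kˣ
    | .z => b ^ 2 * a⁻¹ * ω ^ 4
    | .z1 => ζ1
    | .z2 => b * a⁻¹ * ω ^ 2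
    | .z3 => ω
    | .z21 => ζ21
    | .z32 => ζ32
    | .z13 => ζ13
  refine ⟨ζ, fun i => ?_, d1, ?_, d13, d21, ?_, ?_, d32⟩
  · cases i
    · exact hz
    · exact h1
    · exact hz2
    · exact hω
    · exact h21
    · exact h32
    · exact h13
  · convert! dα using 1
    simp only [act, ζ]
    congr 1
    have : α = a * ζ32⁻¹ * ζ1⁻¹ * ζ21⁻¹ := by
      rw [ha]; ext
      have := ζ1.ne_zero; have := ζ32.ne_zero; have := ζ21.ne_zero
      simp only [Units.val_inv_eq_inv_val, Units.val_mul]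
      field_simp
    rw [this]
    congr 3
    ext
    have := a.ne_zero; have := b.ne_zero; have := ω.ne_zero
    simp only [Units.val_inv_eq_inv_val, Units.val_mul, Units.val_pow_eq_pow_val]
    field_simp
  · convert! dβ using 1
    simp only [act, ζ]
    congr 1
    have : β = b * ζ13⁻¹ * ζ32⁻¹ := by
      rw [hb]; ext
      have := ζ13.ne_zero; have := ζ32.ne_zero
      simp only [Units.val_inv_eq_inv_val, Units.val_mul]
      field_simp
    rw [this]
    ext
    have := a.ne_zero; have := b.ne_zero; have := ω.ne_zero
    have := ζ13.ne_zero; have := ζ32.ne_zero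
    simp only [Units.val_inv_eq_inv_val, Units.val_mul, Units.val_pow_eq_pow_val]
    field_simp
  · convert! dω using 1
    simp only [act, ζ]
    ext
    have := a.ne_zero; have := b.ne_zero; have := ω.ne_zero
    have := ζ13.ne_zero; have := ζ1.ne_zero; have := ζ21.ne_zero
    simp only [Units.val_inv_eq_inv_val, Units.val_mul, Units.val_pow_eq_pow_val]
    field_simp

theorem isOrbitRepresentatives_standardReps (hu : IsFundamentalSystem u)
    (hD : IsCosetTransversal (generated u) D) : IsOrbitRepresentatives (generated u) (standardReps u D) := by
  intro y
  obtain ⟨ζ, hζ, h⟩ := exists_act_mem_standardReps hu hD y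
  refine ⟨act ζ y, ⟨h, ζ, hζ, rfl⟩, ?_⟩
  rintro _ ⟨hx, ξ, hξ, rfl⟩
  rw [act_mem_standardReps_unique hu hD hξ hζ hx h]

end StandardRepresentatives
end CubicTorsor

namespace CubicTorsor

/-! ### Fibration over the coordinates with two indices. -/

section Decomposition

open InfinitePlace Module

variable {K : Type*} [Field K]

/-- The torsor point with given coordinates with one index (`t`) and with two indices (`z`). -/
def assemble (t : Fin 3 → Kˣ) (z : Fin 6 → Kˣ) : TorsorIndex → Kˣ
  | .v1 => t 0
  | .v2 => t 1
  | .v3 => t 2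
  | .v12 => z 0
  | .v13 => z 1
  | .v21 => z 2
  | .v23 => z 3
  | .v31 => z 4
  | .v32 => z 5

/-- The indices `1, 2, 3`. -/
def singleIndex : Fin 3 → TorsorIndex := ![.v1, .v2, .v3]

/-- The indices `12, 13, 21, 23, 31, 32`. -/
def doubleIndex : Fin 6 → TorsorIndex := ![.v12, .v13, .v21, .v23, .v31, .v32]

theorem assemble_singleIndex (t : Fin 3 → Kˣ) (z : Fin 6 → Kˣ) (j : Fin 3) :
    assemble t z (singleIndex j) = t j := by
  fin_cases j <;> rfl

theorem assemble_doubleIndex (t : Fin 3 → Kˣ) (z : Fin 6 → Kˣ) (i : Fin 6) :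
    assemble t z (doubleIndex i) = z i := by
  fin_cases i <;> rfl

theorem assemble_index (y : TorsorIndex → Kˣ) :
    assemble (fun j => y (singleIndex j)) (fun i => y (doubleIndex i)) = y := by
  funext v; cases v <;> rfl

theorem forall_torsorIndex {p : TorsorIndex → Prop} :
    (∀ v, p v) ↔ (∀ j, p (singleIndex j)) ∧ ∀ i, p (doubleIndex i) := by
  refine ⟨fun h => ⟨fun j => h _, fun i => h _⟩, fun ⟨h1, h2⟩ v => ?_⟩
  cases v
  · exact h1 0
  · exact h1 1
  · exact h1 2
  · exact h2 0
  · exact h2 2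
  · exact h2 3
  · exact h2 5
  · exact h2 4
  · exact h2 1

/-- The cofactors of the cubes in `psi`. -/
def cofactor (z : Fin 6 → Kˣ) : Fin 3 → Kˣ :=
  ![z 0 * z 1 * z 2 ^ 2 * z 4 ^ 2, z 3 * z 2 * z 5 ^ 2 * z 0 ^ 2, z 4 * z 5 * z 1 ^ 2 * z 3 ^ 2]

theorem psi_assemble (t : Fin 3 → Kˣ) (z : Fin 6 → Kˣ) (j : Fin 3) :
    psi (assemble t z) j = (t j : K) ^ 3 * cofactor z j := by
  fin_cases j <;> simp [psi, assemble, cofactor] <;> ring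

variable [NumberField K]

/-- The weights for which the height is the cube of a weighted height. -/
noncomputable def cubeWeights (z : Fin 6 → Kˣ) (j : Fin 3) (w : InfinitePlace K) : ℝ :=
  w (cofactor z j : K) ^ (1 / 3 : ℝ)

theorem cubeWeights_pos (z : Fin 6 → Kˣ) (j : Fin 3) (w : InfinitePlace K) : 0 < cubeWeights z j w :=
  Real.rpow_pos_of_pos (place_pos w _) _

theorem height_assemble (t : Fin 3 → Kˣ) (z : Fin 6 → Kˣ) :
    height (assemble t z) = weightedHeight (cubeWeights z) t ^ 3 := by
  have h1 : ∀ w : InfinitePlace K, (Finset.univ.sup' Finset.univ_nonempty fun j : Fin 3 => w (psi (assemble t z) j)) =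
      gauge (cubeWeights z) t w ^ 3 := by
    intro w
    have h2 : ∀ j, w (psi (assemble t z) j) = (cubeWeights z j w * w (t j : K)) ^ 3 := by
      intro j
      rw [psi_assemble, map_mul, map_pow, mul_pow, cubeWeights, ← Real.rpow_natCast (_ ^ (1 / 3 : ℝ)),
        ← Real.rpow_mul (place_pos w _).le]
      norm_num
      ring
    have hg := gauge_pos (cubeWeights_pos z) t w
    have h0 : ∀ j, 0 < cubeWeights z j w * w (t j : K) := fun j => mul_pos (cubeWeights_pos z j w) (place_pos w _)
    simp_rw [h2]
    refine le_antisymm (Finset.sup'_le _ _ fun j _ => pow_le_pow_left₀ (h0 j).le (gauge_le_iff.1 le_rfl j) 3) ?_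
    obtain ⟨j, -, hj⟩ := Finset.exists_mem_eq_sup' Finset.univ_nonempty fun j => cubeWeights z j w * w (t j : K)
    rw [gauge, hj]
    exact Finset.le_sup' (fun j => (cubeWeights z j w * w (t j : K)) ^ 3) (Finset.mem_univ j)
  simp only [height, h1, weightedHeight, ← Finset.prod_pow]
  exact Finset.prod_congr rfl fun w _ => by rw [← pow_mul, ← pow_mul, mul_comm]

theorem height_assemble_le_iff (t : Fin 3 → Kˣ) (z : Fin 6 → Kˣ) {B : ℝ} (hB : 0 < B) :
    height (assemble t z) ≤ B ↔ weightedHeight (cubeWeights z) t ≤ B ^ (1 / 3 : ℝ) := by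
  have h := weightedHeight_pos (cubeWeights_pos z) t
  have h3 : (B ^ (1 / 3 : ℝ)) ^ 3 = B := by
    rw [← Real.rpow_natCast, ← Real.rpow_mul hB.le]; norm_num
  rw [height_assemble]
  nth_rewrite 1 [← h3]
  exact pow_le_pow_iff_left₀ h.le (by positivity) (by norm_num)

theorem log_absNorm_cofactor (z : Fin 6 → Kˣ) (j : Fin 3) :
    Real.log (absNorm (cofactor z j)) = cyclicForm (fun i => Real.log (absNorm (z i))) j := by
  have h : ∀ i, absNorm (z i) ≠ 0 := fun i => (absNorm_pos _).ne'
  have key : ∀ a b c d : Kˣ, Real.log (absNorm (a * b * c ^ 2 * d ^ 2)) = Real.log (absNorm a) + Real.log (absNorm b) +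
      2 * Real.log (absNorm c) + 2 * Real.log (absNorm d) := by
    intro a b c d
    have ha := (absNorm_pos a).ne'; have hb := (absNorm_pos b).ne'
    have hc := (absNorm_pos c).ne'; have hd := (absNorm_pos d).ne'
    simp only [absNorm_mul, absNorm_pow]
    rw [Real.log_mul (by positivity) (by positivity), Real.log_mul (by positivity) (by positivity),
      Real.log_mul ha hb, Real.log_pow, Real.log_pow]
    norm_num
  fin_cases j
  · exact (key _ _ _ _).trans (cyclicForm_zero fun i => Real.log (absNorm (z i))).symm
  · refine (key _ _ _ _).trans (Eq.trans ?_ (cyclicForm_one fun i => Real.log (absNorm (z i))).symm)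
    ring
  · exact (key _ _ _ _).trans (cyclicForm_two fun i => Real.log (absNorm (z i))).symm

theorem prod_cubeWeights (z : Fin 6 → Kˣ) (j : Fin 3) :
    ∏ w, cubeWeights z j w ^ mult w = absNorm (cofactor z j) ^ (1 / 3 : ℝ) := by
  rw [absNorm, ← Real.finsetProd_rpow _ _ fun w _ => (pow_pos (place_pos w _) _).le]
  refine Finset.prod_congr rfl fun w _ => ?_
  rw [cubeWeights, ← Real.rpow_natCast, ← Real.rpow_natCast, ← Real.rpow_mul (place_pos w _).le,
    ← Real.rpow_mul (place_pos w _).le, mul_comm]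

/-- Multiply the fifth coordinate. -/
def twist (ε : Kˣ) (z : Fin 6 → Kˣ) : Fin 6 → Kˣ := Function.update z 4 (ε * z 4)

theorem absNorm_twist {ε : Kˣ} (hε : absNorm ε = 1) (z : Fin 6 → Kˣ) (i : Fin 6) :
    absNorm (twist ε z i) = absNorm (z i) := by
  by_cases h : i = 4
  · subst h; rw [twist, Function.update_self, absNorm_mul, hε, one_mul]
  · rw [twist, Function.update_of_ne h]

/-- The bounds for the linear forms that correspond to the height bound. -/
noncomputable def level (𝔟 : TorsorIndex → (FractionalIdeal (𝓞 K)⁰ K)ˣ) (B : ℝ) (j : Fin 3) : ℝ :=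
  Real.log B - 3 * Real.log (idealNorm (𝔟 (singleIndex j) : FractionalIdeal (𝓞 K)⁰ K)) -
    cyclicForm (fun i => Real.log (idealNorm (𝔟 (doubleIndex i) : FractionalIdeal (𝓞 K)⁰ K))) j

/-- The weights multiply up to the cube root of the norm of a cofactor, so the logarithm of the
density is a third of the slack in the `j`-th inequality of the polytope. Twisting by a unit leaves
all norms unchanged. -/
theorem density_cubeWeights (𝔟 : TorsorIndex → (FractionalIdeal (𝓞 K)⁰ K)ˣ) {B : ℝ} (hB : 0 < B) {ε : Kˣ}
    (hε : absNorm ε = 1) (z : Fin 6 → Kˣ) (j : Fin 3) :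
    density (fun j => 𝔟 (singleIndex j)) (cubeWeights (twist ε z)) (B ^ (1 / 3 : ℝ)) j =
      Real.exp ((level 𝔟 B j - cyclicForm (fun i => logRatio (𝔟 (doubleIndex i)) (z i)) j) / 3) := by
  have hN := idealNorm_pos (𝔟 (singleIndex j))
  have hc := absNorm_pos (cofactor (twist ε z) j)
  rw [density, prod_cubeWeights, ← Real.exp_log (show 0 < B ^ (1 / 3 : ℝ) /
    (absNorm (cofactor (twist ε z) j) ^ (1 / 3 : ℝ) * idealNorm (𝔟 (singleIndex j) : FractionalIdeal (𝓞 K)⁰ K)) by positivity),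
    Real.log_div (by positivity) (by positivity), Real.log_mul (by positivity) hN.ne', Real.log_rpow hB,
    Real.log_rpow hc, log_absNorm_cofactor]
  simp_rw [absNorm_twist hε]
  have h1 : cyclicForm (fun i => Real.log (absNorm (z i))) j = cyclicForm (fun i => logRatio (𝔟 (doubleIndex i)) (z i)) j +
      cyclicForm (fun i => Real.log (idealNorm (𝔟 (doubleIndex i) : FractionalIdeal (𝓞 K)⁰ K))) j := by
    simp only [cyclicForm, ← Finset.sum_add_distrib]
    refine Finset.sum_congr rfl fun i _ => ?_
    rw [logRatio, Real.log_div (absNorm_pos _).ne' (idealNorm_pos _).ne']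
    ring
  rw [h1, level]
  congr 1
  ring

theorem weightedPoints_finite {J : Type*} [Fintype J] [Nonempty J] {F : Subgroup Kˣ} (hF : IsUnitComplement F)
    {Y : Set (J → Kˣ)} (hY : IsTransversal F Y)
    (I : J → (FractionalIdeal (𝓞 K)⁰ K)ˣ) {c : J → InfinitePlace K → ℝ} (hc : ∀ j w, 0 < c j w) {X : ℝ} (hX : 0 < X) :
    (weightedPoints I c Y X).Finite := by
  by_cases h : ∀ j, 1 ≤ density I c X j
  · obtain ⟨C, _, hC⟩ := exists_weightedPoints_estimate K J
    exact (hC F hF Y hY I c hc X hX 1 le_rfl h).1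
  · push Not at h
    obtain ⟨j, hj⟩ := h
    rw [weightedPoints_eq_empty hc hj]
    exact Set.finite_empty

variable {u : Fin (Units.rank K) → (𝓞 K)ˣ} {D : Set Kˣ}

/-- The fibre of the points of the standard system over the coordinates with two indices. -/
def fibre (u : Fin (Units.rank K) → (𝓞 K)ˣ) (D : Set Kˣ) (𝔟 : TorsorIndex → (FractionalIdeal (𝓞 K)⁰ K)ˣ) (B : ℝ)
    (z : Fin 6 → Kˣ) (e : Fin (Units.rank K) → Fin 3) : Set (Fin 3 → Kˣ) :=
  weightedPoints (fun j => 𝔟 (singleIndex j)) (cubeWeights (twist (cubeClass u e) z)) {t | t 0 ∈ D} (B ^ (1 / 3 : ℝ))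

theorem absNorm_cubeClass (hu : IsFundamentalSystem u) (e : Fin (Units.rank K) → Fin 3) :
    absNorm (cubeClass u e) = 1 := hu.isUnitComplement.prod_eq_one (cubeClass_mem u e)

theorem isTransversal_first (hD : IsCosetTransversal (generated u) D) :
    IsTransversal (generated u) {t : Fin 3 → Kˣ | t 0 ∈ D} := fun y => hD (y 0)

theorem fibre_finite (hu : IsFundamentalSystem u) (hD : IsCosetTransversal (generated u) D)
    (𝔟 : TorsorIndex → (FractionalIdeal (𝓞 K)⁰ K)ˣ) {B : ℝ} (hB : 0 < B)
    (z : Fin 6 → Kˣ) (e : Fin (Units.rank K) → Fin 3) : (fibre u D 𝔟 B z e).Finite :=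
  weightedPoints_finite hu.isUnitComplement (isTransversal_first hD) _ (cubeWeights_pos _) (by positivity)

theorem twist_mem_iff (hu : IsFundamentalSystem u) (A : FractionalIdeal (𝓞 K)⁰ K) (e : Fin (Units.rank K) → Fin 3)
    (z : Fin 6 → Kˣ) (i : Fin 6) : (twist (cubeClass u e) z i : K) ∈ A ↔ (z i : K) ∈ A := by
  by_cases h : i = 4
  · subst h; rw [twist, Function.update_self]
    exact hu.isUnitComplement.mul_mem_iff (cubeClass_mem u e) A (z 4)
  · rw [twist, Function.update_of_ne h]

theorem mem_standardReps_assemble (t : Fin 3 → Kˣ) (z : Fin 6 → Kˣ) :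
    assemble t z ∈ standardReps u D ↔ t 0 ∈ D ∧ (∀ i ≠ 4, z i ∈ D) ∧ z 4 ∈ cubeReps u D := by
  have : (∀ i : Fin 6, i ≠ 4 → z i ∈ D) ↔ z 0 ∈ D ∧ z 1 ∈ D ∧ z 2 ∈ D ∧ z 3 ∈ D ∧ z 5 ∈ D := by
    simp [Fin.forall_fin_succ]
  rw [this]
  simp only [standardReps, assemble, Set.mem_ofPred_eq]
  tauto

theorem assemble_mem_points_iff (hu : IsFundamentalSystem u)
    (𝔟 : TorsorIndex → (FractionalIdeal (𝓞 K)⁰ K)ˣ) {B : ℝ} (hB : 0 < B)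
    {z : Fin 6 → Kˣ} (hz : ∀ i, z i ∈ D) (e : Fin (Units.rank K) → Fin 3) (t : Fin 3 → Kˣ) :
    assemble t (twist (cubeClass u e) z) ∈ points (standardReps u D) (fun v => 𝔟 v) B ↔
      (∀ i, (z i : K) ∈ (𝔟 (doubleIndex i) : FractionalIdeal (𝓞 K)⁰ K)) ∧ t ∈ fibre u D 𝔟 B z e := by
  have h1 : (∀ i ≠ 4, twist (cubeClass u e) z i ∈ D) ∧ twist (cubeClass u e) z 4 ∈ cubeReps u D := by
    refine ⟨fun i hi => ?_, e, z 4, hz 4, ?_⟩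
    · rw [twist, Function.update_of_ne hi]; exact hz i
    · rw [twist, Function.update_self]
  simp only [points, bounded, fibre, weightedPoints, Set.mem_ofPred_eq, mem_standardReps_assemble,
    height_assemble_le_iff _ _ hB, forall_torsorIndex, assemble_singleIndex, assemble_doubleIndex,
    twist_mem_iff hu]
  tauto

/-- A violated inequality means a density below one, and then the fibre is empty. -/
theorem logRatio_mem_cyclicPolytope (hu : IsFundamentalSystem u)
    (𝔟 : TorsorIndex → (FractionalIdeal (𝓞 K)⁰ K)ˣ) {B : ℝ} (hB : 0 < B)
    {z : Fin 6 → Kˣ} (hz : ∀ i, (z i : K) ∈ (𝔟 (doubleIndex i) : FractionalIdeal (𝓞 K)⁰ K))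
    {e : Fin (Units.rank K) → Fin 3} (h : (fibre u D 𝔟 B z e).Nonempty) :
    (fun i => logRatio (𝔟 (doubleIndex i)) (z i)) ∈ cyclicPolytope (level 𝔟 B) := by
  refine ⟨fun i => logRatio_nonneg _ (hz i), fun j => ?_⟩
  by_contra hlt
  push Not at hlt
  have hd : density (fun j => 𝔟 (singleIndex j)) (cubeWeights (twist (cubeClass u e) z)) (B ^ (1 / 3 : ℝ)) j < 1 := by
    rw [density_cubeWeights 𝔟 hB (absNorm_cubeClass hu e), Real.exp_lt_one_iff]
    linarith
  rw [fibre, weightedPoints_eq_empty (cubeWeights_pos _) hd] at h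
  exact Set.not_nonempty_empty h

/-- A point corresponds to `z`, the cube class `e` of its coordinate `31`, and `t`. Nonempty fibres
lie over the polytope, whose coordinates are at most `L₀`; so the index sets may be truncated there.
-/
theorem points_standardReps (hu : IsFundamentalSystem u) (hD : IsCosetTransversal (generated u) D)
    (𝔟 : TorsorIndex → (FractionalIdeal (𝓞 K)⁰ K)ˣ) {B L₀ : ℝ} (hB : 0 < B) (hL₀ : ∀ j, level 𝔟 B j ≤ L₀)
    [∀ i, Fintype (boundedReps D (𝔟 (doubleIndex i)) L₀)] :
    (points (standardReps u D) (fun v => (𝔟 v : FractionalIdeal (𝓞 K)⁰ K)) B).Finite ∧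
    (points (standardReps u D) (fun v => (𝔟 v : FractionalIdeal (𝓞 K)⁰ K)) B).ncard =
      ∑ z : ∀ i, boundedReps D (𝔟 (doubleIndex i)) L₀, ∑ e, (fibre u D 𝔟 B (fun i => z i) e).ncard := by
  let S := Σ p : (∀ i, boundedReps D (𝔟 (doubleIndex i)) L₀) × (Fin (Units.rank K) → Fin 3),
    fibre u D 𝔟 B (fun i => p.1 i) p.2
  have : ∀ p : (∀ i, boundedReps D (𝔟 (doubleIndex i)) L₀) × (Fin (Units.rank K) → Fin 3),
      Finite (fibre u D 𝔟 B (fun i => p.1 i) p.2) := fun p => (fibre_finite hu hD 𝔟 hB _ _).to_subtype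
  let f : S → points (standardReps u D) (fun v => (𝔟 v : FractionalIdeal (𝓞 K)⁰ K)) B := fun s =>
    ⟨assemble s.2.1 (twist (cubeClass u s.1.2) fun i => s.1.1 i),
      (assemble_mem_points_iff hu 𝔟 hB (fun i => (s.1.1 i).2.1) _ _).2 ⟨fun i => (s.1.1 i).2.2.1, s.2.2⟩⟩
  have hf : Function.Bijective f := by
    constructor
    · rintro ⟨⟨z, e⟩, t, ht⟩ ⟨⟨z', e'⟩, t', ht'⟩ h
      have h := congrArg Subtype.val h
      simp only [f] at h
      have htt : t = t' := funext fun j => by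
        have := congrFun h (singleIndex j)
        rwa [assemble_singleIndex, assemble_singleIndex] at this
      have hzz : ∀ i, twist (cubeClass u e) (fun i => (z i : Kˣ)) i = twist (cubeClass u e') (fun i => (z' i : Kˣ)) i := fun i => by
        have := congrFun h (doubleIndex i)
        rwa [assemble_doubleIndex, assemble_doubleIndex] at this
      have h4 := hzz 4
      rw [twist, twist, Function.update_self, Function.update_self] at h4
      obtain ⟨hz4, he⟩ := cubeClass_mul_injective hu hD (f := 0) (f' := 0) (z 4).2.1 (z' 4).2.1 (by rw [h4])
      have hee : e = e' := funext fun i => by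
        have := he i
        simp at this
        exact Fin.ext (by exact_mod_cast this)
      have hz : z = z' := funext fun i => by
        refine Subtype.ext ?_
        by_cases hi : i = 4
        · subst hi; exact hz4
        · have := hzz i
          rwa [twist, twist, Function.update_of_ne hi, Function.update_of_ne hi] at this
      subst htt hee hz
      rfl
    · rintro ⟨y, hy⟩
      rw [← assemble_index y] at hy
      obtain ⟨-, h1, e, d, hd, h4⟩ := (mem_standardReps_assemble _ _).1 hy.1.1
      let z : Fin 6 → Kˣ := Function.update (fun i => y (doubleIndex i)) 4 d
      have hyz : (fun i => y (doubleIndex i)) = twist (cubeClass u e) z := by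
        funext i
        by_cases hi : i = 4
        · subst hi
          rw [twist, Function.update_self]
          simp only [z, Function.update_self]
          exact h4
        · rw [twist, Function.update_of_ne hi]
          simp only [z]
          rw [Function.update_of_ne hi]
      have hzD : ∀ i, z i ∈ D := fun i => by
        by_cases hi : i = 4
        · subst hi; simpa [z] using hd
        · simp only [z]; rw [Function.update_of_ne hi]; exact h1 i hi
      rw [hyz] at hy
      obtain ⟨hI, ht⟩ := (assemble_mem_points_iff hu 𝔟 hB hzD e _).1 hy
      have hP := logRatio_mem_cyclicPolytope hu 𝔟 hB hI ⟨_, ht⟩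
      refine ⟨⟨(fun i => ⟨z i, hzD i, hI i, le_of_mem_cyclicPolytope hL₀ hP i⟩, e), ⟨_, ht⟩⟩, ?_⟩
      refine Subtype.ext ?_
      simp only [f]
      rw [← hyz]
      exact assemble_index y
  constructor
  · exact Set.finite_coe_iff.1 (Finite.of_surjective f hf.2)
  · rw [← Nat.card_coe_set_eq, ← Nat.card_eq_of_bijective f hf, Nat.card_sigma, Fintype.sum_prod_type]
    rfl

end Decomposition
end CubicTorsor

namespace CubicTorsor

/-! ### Summation of the fibres and the final error term. -/

section Assembly

open InfinitePlace Module

variable {K : Type*} [Field K] [NumberField K]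

theorem prod_torsorIndex {M : Type*} [CommMonoid M] (f : TorsorIndex → M) :
    ∏ v, f v = (∏ j, f (singleIndex j)) * ∏ i, f (doubleIndex i) := by
  have : (Finset.univ : Finset TorsorIndex) = {.v1, .v2, .v3, .v12, .v21, .v23, .v32, .v31, .v13} := rfl
  rw [this]
  repeat rw [Finset.prod_insert (by decide)]
  simp only [Finset.prod_singleton, Fin.prod_univ_three, Fin.prod_univ_six, singleIndex, doubleIndex,
    Matrix.cons_val]
  ac_rfl

theorem sum_torsorIndex {M : Type*} [AddCommMonoid M] (f : TorsorIndex → M) :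
    ∑ v, f v = (∑ j, f (singleIndex j)) + ∑ i, f (doubleIndex i) :=
  prod_torsorIndex (M := Multiplicative M) f

theorem sum_cyclicForm (x : Fin 6 → ℝ) : ∑ j, cyclicForm x j = 3 * ∑ i, x i := by
  rw [Fin.sum_univ_three, cyclicForm_zero, cyclicForm_one, cyclicForm_two, Fin.sum_univ_six]
  ring

/-- The height bound relative to the norms of the ideals. -/
noncomputable def relativeBound (𝔟 : TorsorIndex → (FractionalIdeal (𝓞 K)⁰ K)ˣ) (B : ℝ) : ℝ :=
  B / ∏ v, idealNorm (𝔟 v : FractionalIdeal (𝓞 K)⁰ K)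

theorem relativeBound_pos (𝔟 : TorsorIndex → (FractionalIdeal (𝓞 K)⁰ K)ˣ) {B : ℝ} (hB : 0 < B) :
    0 < relativeBound 𝔟 B :=
  div_pos hB (Finset.prod_pos fun v _ => idealNorm_pos (𝔟 v))

theorem prod_exp_level (𝔟 : TorsorIndex → (FractionalIdeal (𝓞 K)⁰ K)ˣ) {B : ℝ} (hB : 0 < B) (x : Fin 6 → ℝ) :
    ∏ j, Real.exp ((level 𝔟 B j - cyclicForm x j) / 3) = relativeBound 𝔟 B * Real.exp (-∑ i, x i) := by
  have hG := relativeBound_pos 𝔟 hB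
  rw [← Real.exp_sum, ← Real.exp_log hG, ← Real.exp_add]
  congr 1
  rw [relativeBound, Real.log_div hB.ne' (Finset.prod_pos fun v _ => idealNorm_pos (𝔟 v)).ne',
    Real.log_prod fun v _ => (idealNorm_pos (𝔟 v)).ne', sum_torsorIndex, ← Finset.sum_div, Finset.sum_sub_distrib,
    sum_cyclicForm]
  simp only [level, Finset.sum_sub_distrib, sum_cyclicForm, ← Finset.mul_sum, Finset.sum_const, Finset.card_univ,
    Fintype.card_fin, nsmul_eq_mul]
  push_cast
  ring

variable (K) in
-- Take `μ` to be the smallest density. The sum over `j` majorises `μ^(-saving K)` and lets each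
-- facet of the polytope be treated separately.
theorem exists_fibre_estimate :
    ∃ C : ℝ, 0 < C ∧ ∀ u : Fin (Units.rank K) → (𝓞 K)ˣ, IsFundamentalSystem u → ∀ D : Set Kˣ,
      IsCosetTransversal (generated u) D → ∀ (𝔟 : TorsorIndex → (FractionalIdeal (𝓞 K)⁰ K)ˣ) (B : ℝ), 0 < B →
      ∀ (z : Fin 6 → Kˣ) (x : Fin 6 → ℝ), (x = fun i => logRatio (𝔟 (doubleIndex i)) (z i)) →
      (∀ j, cyclicForm x j ≤ level 𝔟 B j) → ∀ e,
      |((fibre u D 𝔟 B z e).ncard : ℝ) - (3 : ℝ) ^ Units.rank K * Units.regulator K * boxConst K ^ 3 *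
        (relativeBound 𝔟 B * Real.exp (-∑ i, x i))| ≤
      C * (relativeBound 𝔟 B * Real.exp (-∑ i, x i) *
        ∑ j, Real.exp (-(saving K / 3) * (level 𝔟 B j - cyclicForm x j))) := by
  obtain ⟨C, hC, h⟩ := exists_weightedPoints_estimate K (Fin 3)
  refine ⟨C, hC, fun u hu D hD 𝔟 B hB z x hx hP e => ?_⟩
  have hdens : ∀ j, density (fun j => 𝔟 (singleIndex j)) (cubeWeights (twist (cubeClass u e) z)) (B ^ (1 / 3 : ℝ)) j =
      Real.exp ((level 𝔟 B j - cyclicForm x j) / 3) := fun j => by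
    rw [density_cubeWeights 𝔟 hB (absNorm_cubeClass hu e), hx]
  obtain ⟨j₀, hj₀⟩ := Finite.exists_min fun j => level 𝔟 B j - cyclicForm x j
  have h1 : 1 ≤ Real.exp ((level 𝔟 B j₀ - cyclicForm x j₀) / 3) :=
    Real.one_le_exp (by linarith [hP j₀])
  have := (h _ hu.isUnitComplement _ (isTransversal_first hD) (fun j => 𝔟 (singleIndex j))
    (cubeWeights (twist (cubeClass u e) z)) (cubeWeights_pos _) (B ^ (1 / 3 : ℝ)) (by positivity) _ h1
    (fun j => by
      rw [hdens]
      exact Real.exp_le_exp.2 (by linarith [hj₀ j]))).2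
  simp only [hdens, prod_exp_level 𝔟 hB, Fintype.card_fin, Nat.cast_ofNat] at this
  refine this.trans (mul_le_mul_of_nonneg_left ?_ hC.le)
  rw [mul_comm]
  have hG := relativeBound_pos 𝔟 hB
  refine mul_le_mul_of_nonneg_left ?_ (by positivity)
  rw [← Real.exp_mul]
  have e1 : (level 𝔟 B j₀ - cyclicForm x j₀) / 3 * -saving K = -(saving K / 3) * (level 𝔟 B j₀ - cyclicForm x j₀) := by ring
  rw [e1]
  exact Finset.single_le_sum (f := fun j => Real.exp (-(saving K / 3) * (level 𝔟 B j - cyclicForm x j)))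
    (fun j _ => (Real.exp_pos _).le) (Finset.mem_univ j₀)

variable (K) in
-- The `3^q` cube classes and the fibre constant `3^q R v³` meet the sum of `e^(-∑ xᵢ)` over the
-- polytope, which is `κ⁶` times its volume with `κ = R v`. Both the fibre errors and the
-- replacement of the sum by the volume cost a fifth power of `L₀ + A`.
theorem exists_points_estimate :
    ∃ C A : ℝ, 0 < C ∧ 0 < A ∧ ∀ u : Fin (Units.rank K) → (𝓞 K)ˣ, IsFundamentalSystem u → ∀ D : Set Kˣ,
      IsCosetTransversal (generated u) D → ∀ (𝔟 : TorsorIndex → (FractionalIdeal (𝓞 K)⁰ K)ˣ) (B : ℝ), 0 < B →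
      ∀ L₀ : ℝ, 0 ≤ L₀ → (∀ j, level 𝔟 B j ≤ L₀) →
      (points (standardReps u D) (fun v => (𝔟 v : FractionalIdeal (𝓞 K)⁰ K)) B).Finite ∧
      |((points (standardReps u D) (fun v => (𝔟 v : FractionalIdeal (𝓞 K)⁰ K)) B).ncard : ℝ) -
        (9 : ℝ) ^ Units.rank K * Units.regulator K ^ 7 * boxConst K ^ 9 * relativeBound 𝔟 B *
          (MeasureTheory.volume (cyclicPolytope (level 𝔟 B))).toReal| ≤
        C * (relativeBound 𝔟 B * (L₀ + A) ^ 5) := by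
  obtain ⟨C₁, hC₁, h₁⟩ := exists_fibre_estimate K
  obtain ⟨C₂, hC₂, h₂⟩ := exists_isExpDistributed K
  set κ := Units.regulator K * boxConst K with hκdef
  have hR := Units.regulator_pos K
  have hv := boxConst_pos (K := K)
  have hκ : 0 < κ := mul_pos hR hv
  have hθ := saving_pos (K := K)
  have hη : 0 < saving K / 3 := by positivity
  set A := (κ + C₂ + C₂ / saving K) / κ with hA
  have hA0 : 0 < A := by positivity
  set E := κ ^ 6 * ((κ + C₂) * (1 + 1 / (saving K / 3)) / κ) with hE
  set q := Units.rank K with hq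
  set M := (3 : ℝ) ^ q * Units.regulator K * boxConst K ^ 3 with hM
  have hM0 : 0 < M := by positivity
  have hE0 : 0 < E := by positivity
  refine ⟨3 ^ q * C₁ * 3 * E + 3 ^ q * M * (κ ^ 6 * (6 * A)), A, by positivity, hA0,
    fun u hu D hD 𝔟 B hB L₀ hL₀ hL => ?_⟩
  have hG := relativeBound_pos 𝔟 hB
  set G := relativeBound 𝔟 B with hGdef
  let _ : ∀ i, Fintype (boundedReps D (𝔟 (doubleIndex i)) L₀) := fun i =>
    (h₂ _ hu.isUnitComplement D hD (𝔟 (doubleIndex i)) L₀).1.fintype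
  obtain ⟨hfin, hcard⟩ := points_standardReps hu hD 𝔟 hB hL
  refine ⟨hfin, ?_⟩
  let x : ∀ i, boundedReps D (𝔟 (doubleIndex i)) L₀ → ℝ := fun i y => logRatio (𝔟 (doubleIndex i)) y
  have hdist : ∀ i, IsExpDistributed (x i) κ C₂ (saving K) L₀ := fun i =>
    (h₂ _ hu.isUnitComplement D hD (𝔟 (doubleIndex i)) L₀).2
  have hT := sum_cyclicPolytope_sub hκ hC₂.le hθ hL₀ hdist hL
  have hS := fun j => sum_cyclicPolytope_exp_le hκ hC₂.le hθ hη hL₀ hdist hL j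
  simp only [← hA] at hT hS
  set V := (MeasureTheory.volume (cyclicPolytope (level 𝔟 B))).toReal with hV
  set T := ∑ z : ∀ i, boundedReps D (𝔟 (doubleIndex i)) L₀, Real.exp (-∑ i, x i (z i)) *
    (cyclicPolytope (level 𝔟 B)).indicator (fun _ => 1) (fun i => x i (z i)) with hTdef
  have key : ∀ (z : ∀ i, boundedReps D (𝔟 (doubleIndex i)) L₀) (e : Fin q → Fin 3),
      |((fibre u D 𝔟 B (fun i => z i) e).ncard : ℝ) - M * G * (Real.exp (-∑ i, x i (z i)) *
        (cyclicPolytope (level 𝔟 B)).indicator (fun _ => 1) (fun i => x i (z i)))| ≤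
      C₁ * G * ∑ j, Real.exp (-∑ i, x i (z i)) * (cyclicPolytope (level 𝔟 B)).indicator
        (fun t => Real.exp (-(saving K / 3) * (level 𝔟 B j - cyclicForm t j))) (fun i => x i (z i)) := by
    intro z e
    by_cases hz : (fun i => x i (z i)) ∈ cyclicPolytope (level 𝔟 B)
    · simp only [Set.indicator_of_mem hz, mul_one, ← Finset.mul_sum]
      have := h₁ u hu D hD 𝔟 B hB (fun i => z i) (fun i => x i (z i)) rfl hz.2 e
      convert! this using 1
      · congr 2; ring
      · ring
    · have : fibre u D 𝔟 B (fun i => z i) e = ∅ := by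
        by_contra hne
        exact hz (logRatio_mem_cyclicPolytope hu 𝔟 hB (fun i => (z i).2.2.1) (Set.nonempty_iff_ne_empty.2 hne))
      simp [Set.indicator_of_notMem hz, this]
  have hsum : |((points (standardReps u D) (fun v => (𝔟 v : FractionalIdeal (𝓞 K)⁰ K)) B).ncard : ℝ) -
      3 ^ q * (M * G * T)| ≤ 3 ^ q * (C₁ * G * (3 * (E * (L₀ + A) ^ 5))) := by
    have e1 : (3 : ℝ) ^ q * (M * G * T) = ∑ z : ∀ i, boundedReps D (𝔟 (doubleIndex i)) L₀, ∑ _e : Fin q → Fin 3,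
        M * G * (Real.exp (-∑ i, x i (z i)) *
        (cyclicPolytope (level 𝔟 B)).indicator (fun _ => 1) (fun i => x i (z i))) := by
      simp only [Finset.sum_const, Finset.card_univ, Fintype.card_pi, Fintype.card_fin, Finset.prod_const, nsmul_eq_mul,
        ← Finset.mul_sum, hTdef]
      push_cast
      ring
    rw [hcard, e1]
    push_cast
    rw [← Finset.sum_sub_distrib]
    refine (Finset.abs_sum_le_sum_abs _ _).trans ?_
    refine (Finset.sum_le_sum fun z _ => ?_).trans (le_trans (Finset.sum_le_sum fun z _ =>
      Finset.sum_le_sum fun e (_ : e ∈ Finset.univ) => key z e) ?_)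
    · rw [← Finset.sum_sub_distrib]
      exact Finset.abs_sum_le_sum_abs _ _
    simp only [Finset.sum_const, Finset.card_univ, Fintype.card_pi, Fintype.card_fin, Finset.prod_const, nsmul_eq_mul,
        ← Finset.mul_sum]
    push_cast
    have e2 := Finset.sum_le_sum fun j (_ : j ∈ (Finset.univ : Finset (Fin 3))) => hS j
    have e3 : ∑ _j : Fin 3, κ ^ 6 * ((κ + C₂) * (1 + 1 / (saving K / 3)) / κ * (L₀ + A) ^ 5) = 3 * (E * (L₀ + A) ^ 5) := by
      simp [hE]; ring
    rw [e3, Finset.sum_comm] at e2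
    simp only [← Finset.mul_sum] at e2
    gcongr
  have hmain : (9 : ℝ) ^ q * Units.regulator K ^ 7 * boxConst K ^ 9 * G * V = 3 ^ q * (M * G * (κ ^ 6 * V)) := by
    have : (9 : ℝ) ^ q = 3 ^ q * 3 ^ q := by rw [← mul_pow]; norm_num
    rw [this, hM, hκdef]; ring
  rw [hmain]
  have hT2 : |3 ^ q * (M * G * T) - 3 ^ q * (M * G * (κ ^ 6 * V))| ≤ 3 ^ q * (M * G * (κ ^ 6 * (6 * (A * (L₀ + A) ^ 5)))) := by
    rw [← mul_sub, ← mul_sub, abs_mul, abs_mul, abs_of_pos (by positivity : (0 : ℝ) < 3 ^ q),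
      abs_of_pos (by positivity : 0 < M * G)]
    gcongr
  refine (abs_sub_le _ _ _).trans ((add_le_add hsum hT2).trans (le_of_eq ?_))
  ring

theorem pow_six_sub_le {a b : ℝ} (hb : 0 ≤ b) (hab : b ≤ a) : a ^ 6 - b ^ 6 ≤ 6 * (a - b) * a ^ 5 := by
  have ha : 0 ≤ a := hb.trans hab
  have h := abs_pow_sub_pow_le a b 6
  rw [abs_of_nonneg ha, abs_of_nonneg hb, max_eq_left hab, abs_of_nonneg (sub_nonneg.2 hab)] at h
  have := (le_abs_self _).trans h
  norm_num at this
  linarith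

/-- The polytope lies between those with all bounds equal to `l - Λ` and to `l + Λ`, whose volumes
are known. -/
theorem volume_cyclicPolytope_sub {L : Fin 3 → ℝ} {l Λ : ℝ} (hl : 0 < l) (hΛ : 0 ≤ Λ) (h : ∀ j, |L j - l| ≤ Λ) :
    |(MeasureTheory.volume (cyclicPolytope L)).toReal - l ^ 6 / 2880| ≤ Λ * (l + Λ) ^ 5 := by
  have hmono : ∀ {L L' : Fin 3 → ℝ}, (∀ j, L j ≤ L' j) → cyclicPolytope L ⊆ cyclicPolytope L' :=
    fun h x hx => ⟨hx.1, fun j => (hx.2 j).trans (h j)⟩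
  have hup : MeasureTheory.volume (cyclicPolytope L) ≤ ENNReal.ofReal ((l + Λ) ^ 6 / 2880) := by
    rw [← volume_cyclicPolytope_const (by positivity)]
    exact MeasureTheory.measure_mono (hmono fun j => by linarith [(abs_le.1 (h j)).2])
  have hup' := ENNReal.toReal_mono ENNReal.ofReal_ne_top hup
  rw [ENNReal.toReal_ofReal (by positivity)] at hup'
  have h1 := pow_six_sub_le hl.le (a := l + Λ) (by linarith)
  have h2 : 0 ≤ Λ * (l + Λ) ^ 5 := by positivity
  have h3 : Λ * l ^ 5 ≤ Λ * (l + Λ) ^ 5 := by gcongr; linarith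
  rw [abs_le]
  refine ⟨?_, by linarith⟩
  rcases lt_or_ge Λ l with hlt | hge
  · have hlow : ENNReal.ofReal ((l - Λ) ^ 6 / 2880) ≤ MeasureTheory.volume (cyclicPolytope L) := by
      rw [← volume_cyclicPolytope_const (by linarith)]
      exact MeasureTheory.measure_mono (hmono fun j => by linarith [(abs_le.1 (h j)).1])
    have hlow' := ENNReal.toReal_mono (ne_top_of_le_ne_top ENNReal.ofReal_ne_top hup) hlow
    rw [ENNReal.toReal_ofReal (by have : 0 ≤ l - Λ := by linarith
                                  positivity)] at hlow'
    have h4 := pow_six_sub_le (b := l - Λ) (a := l) (by linarith) (by linarith)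
    linarith
  -- For `Λ ≥ l` the inner polytope is of no use, but `l ^ 6` itself is within the error.
  · have h5 : l ^ 6 ≤ Λ * l ^ 5 := by
      rw [pow_succ']; gcongr
    have := ENNReal.toReal_nonneg (a := MeasureTheory.volume (cyclicPolytope L))
    linarith

theorem cyclicCoeff_le_two (j : Fin 3) (i : Fin 6) : cyclicCoeff j i ≤ 2 := by
  fin_cases j <;> fin_cases i <;> norm_num [cyclicCoeff]

theorem abs_level_sub_le (𝔟 : TorsorIndex → (FractionalIdeal (𝓞 K)⁰ K)ˣ) (B : ℝ) (j : Fin 3) :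
    |level 𝔟 B j - Real.log B| ≤ 3 * ∑ v, |Real.log (idealNorm (𝔟 v : FractionalIdeal (𝓞 K)⁰ K))| := by
  have e : level 𝔟 B j - Real.log B = -(3 * Real.log (idealNorm (𝔟 (singleIndex j) : FractionalIdeal (𝓞 K)⁰ K)) +
    cyclicForm (fun i => Real.log (idealNorm (𝔟 (doubleIndex i) : FractionalIdeal (𝓞 K)⁰ K))) j) := by
    rw [level]; ring
  rw [e, abs_neg, sum_torsorIndex, mul_add]
  refine (abs_add_le _ _).trans (add_le_add ?_ ?_)
  · rw [abs_mul, abs_of_pos (by norm_num : (0 : ℝ) < 3)]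
    gcongr
    exact Finset.single_le_sum (f := fun j => |Real.log (idealNorm (𝔟 (singleIndex j) : FractionalIdeal (𝓞 K)⁰ K))|)
      (fun _ _ => abs_nonneg _) (Finset.mem_univ j)
  · rw [cyclicForm, Finset.mul_sum]
    refine (Finset.abs_sum_le_sum_abs _ _).trans (Finset.sum_le_sum fun i _ => ?_)
    rw [abs_mul, abs_of_nonneg (cyclicCoeff_nonneg j i)]
    gcongr
    linarith [cyclicCoeff_le_two j i]

/-- A power of the logarithms of numbers bounded below is at most a power of the numbers. -/
theorem exists_log_absorb {c A τ : ℝ} (hA : 0 < A) (hτ : 0 < τ) :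
    ∃ C : ℝ, 0 < C ∧ ∀ N : TorsorIndex → ℝ, (∀ v, 0 < N v) → (∀ v, c ≤ Real.log (N v)) → ∀ m, (∀ j, Real.log (N (singleIndex j)) ≤ m) →
      (1 + 3 * ∑ v, |Real.log (N v)| + A) ^ 6 ≤
        C * Real.exp (3 * τ * m + 2 * τ * ∑ i, Real.log (N (doubleIndex i))) := by
  -- Each of the nine `|log (N v)|` exceeds `log (N v)` by at most `2 |c|`, and `3 * 9 * 2 = 54`.
  set A' := 1 + 54 * |c| + A with hA'
  refine ⟨720 * (3 / τ) ^ 6 * Real.exp (τ * A' / 3 + 6 * τ * |c|), by positivity, fun N hN hc m hm => ?_⟩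
  set s := ∑ v, Real.log (N v) with hs
  have h1 : ∑ v, |Real.log (N v)| ≤ s + 18 * |c| := by
    have h : ∀ v, |Real.log (N v)| ≤ Real.log (N v) + 2 * |c| := fun v => by
      have h1 := hc v
      have h2 := neg_abs_le c
      rw [abs_le]
      constructor <;> linarith [abs_nonneg c]
    refine (Finset.sum_le_sum fun v _ => h v).trans (le_of_eq ?_)
    rw [Finset.sum_add_distrib, Finset.sum_const, Finset.card_univ, hs]
    have : Fintype.card TorsorIndex = 9 := rfl
    rw [this, nsmul_eq_mul]; push_cast; ring
  have h0 : 0 ≤ ∑ v, |Real.log (N v)| := Finset.sum_nonneg fun v _ => abs_nonneg _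
  set t := 3 * s + A' with ht
  have ht1 : 1 + 3 * ∑ v, |Real.log (N v)| + A ≤ t := by rw [ht, hA']; linarith
  have ht0 : 0 ≤ t := le_trans (by positivity) ht1
  have h2 : t ^ 6 ≤ 720 * (3 / τ) ^ 6 * Real.exp (τ * t / 3) := by
    have := Real.pow_div_factorial_le_exp (τ * t / 3) (by positivity) 6
    have h5 : (Nat.factorial 6 : ℝ) = 720 := by norm_num [Nat.factorial]
    rw [h5, div_le_iff₀ (by norm_num)] at this
    have e : t ^ 6 = (3 / τ) ^ 6 * (τ * t / 3) ^ 6 := by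
      rw [← mul_pow]; congr 1; field_simp
    rw [e]
    calc _ ≤ (3 / τ) ^ 6 * (Real.exp (τ * t / 3) * 720) := by gcongr
      _ = _ := by ring
  -- Doubling the sum over the six double indices costs at most `6 |c|`, as its terms are at least
  -- `-|c|`. The coefficients `3` and `2` are those of the required exponent.
  have h3 : s ≤ 3 * m + 2 * ∑ i, Real.log (N (doubleIndex i)) + 6 * |c| := by
    rw [hs, sum_torsorIndex]
    have h4 : ∑ j, Real.log (N (singleIndex j)) ≤ 3 * m := by
      refine (Finset.sum_le_sum fun j _ => hm j).trans (le_of_eq ?_)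
      simp
    have h5 : 6 * -|c| ≤ ∑ i, Real.log (N (doubleIndex i)) := by
      refine le_trans (le_of_eq ?_) (Finset.sum_le_sum fun i (_ : i ∈ (Finset.univ : Finset (Fin 6))) =>
        (neg_abs_le c).trans (hc (doubleIndex i)))
      simp
    linarith
  calc _ ≤ t ^ 6 := pow_le_pow_left₀ (by positivity) ht1 6
    _ ≤ 720 * (3 / τ) ^ 6 * Real.exp (τ * t / 3) := h2
    _ ≤ 720 * (3 / τ) ^ 6 * Real.exp (τ * A' / 3 + 6 * τ * |c| + (3 * τ * m + 2 * τ * ∑ i, Real.log (N (doubleIndex i)))) := by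
        gcongr
        rw [ht]
        nlinarith
    _ = _ := by rw [Real.exp_add (τ * A' / 3 + 6 * τ * |c|)]; ring

theorem rank_eq : InfinitePlace.nrRealPlaces K + InfinitePlace.nrComplexPlaces K - 1 = Units.rank K := by
  rw [Units.rank, InfinitePlace.card_eq_nrRealPlaces_add_nrComplexPlaces]

theorem mainTerm_eq (𝔟 : TorsorIndex → (FractionalIdeal (𝓞 K)⁰ K)ˣ) (B : ℝ) :
    mainTerm (fun v => (𝔟 v : FractionalIdeal (𝓞 K)⁰ K)) B = (9 : ℝ) ^ Units.rank K * Units.regulator K ^ 7 *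
      boxConst K ^ 9 * relativeBound 𝔟 B * (Real.log B ^ 6 / 2880) := by
  have h5 : (Nat.factorial 6 : ℝ) = 720 := by norm_num [Nat.factorial]
  rw [mainTerm, rank_eq, h5, relativeBound, boxConst]
  ring

/-- With `τ = 1/(3d)` the exponents `1/d` and `2/(3d)` of the norms become `3τ` and `2τ`, the form
in which `exists_log_absorb` applies. -/
theorem errorTerm_eq (𝔟 : TorsorIndex → (FractionalIdeal (𝓞 K)⁰ K)ˣ) (B : ℝ) :
    errorTerm (fun v => (𝔟 v : FractionalIdeal (𝓞 K)⁰ K)) B = relativeBound 𝔟 B * Real.log B ^ 5 *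
      Real.exp (3 * (1 / (3 * (finrank ℚ K : ℝ))) * Real.log (max (idealNorm (𝔟 .v1 : FractionalIdeal (𝓞 K)⁰ K))
        (max (idealNorm (𝔟 .v2 : FractionalIdeal (𝓞 K)⁰ K)) (idealNorm (𝔟 .v3 : FractionalIdeal (𝓞 K)⁰ K)))) +
        2 * (1 / (3 * (finrank ℚ K : ℝ))) * ∑ i, Real.log (idealNorm (𝔟 (doubleIndex i) : FractionalIdeal (𝓞 K)⁰ K))) := by
  have hN := fun v => idealNorm_pos (𝔟 v)
  have hd : (0 : ℝ) < finrank ℚ K := by exact_mod_cast finrank_pos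
  set m := max (idealNorm (𝔟 .v1 : FractionalIdeal (𝓞 K)⁰ K))
    (max (idealNorm (𝔟 .v2 : FractionalIdeal (𝓞 K)⁰ K)) (idealNorm (𝔟 .v3 : FractionalIdeal (𝓞 K)⁰ K))) with hm
  have hm0 : 0 < m := lt_max_of_lt_left (hN _)
  set P := ∏ i, idealNorm (𝔟 (doubleIndex i) : FractionalIdeal (𝓞 K)⁰ K) with hP
  have hP0 : 0 < P := Finset.prod_pos fun i _ => hN _
  have e1 : idealNorm (𝔟 .v12 : FractionalIdeal (𝓞 K)⁰ K) * idealNorm (𝔟 .v21 : FractionalIdeal (𝓞 K)⁰ K) *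
      idealNorm (𝔟 .v23 : FractionalIdeal (𝓞 K)⁰ K) * idealNorm (𝔟 .v32 : FractionalIdeal (𝓞 K)⁰ K) *
      idealNorm (𝔟 .v31 : FractionalIdeal (𝓞 K)⁰ K) * idealNorm (𝔟 .v13 : FractionalIdeal (𝓞 K)⁰ K) = P := by
    simp only [hP, Fin.prod_univ_six, doubleIndex, Matrix.cons_val]
    ring
  have e2 : idealNorm (𝔟 .v1 : FractionalIdeal (𝓞 K)⁰ K) * idealNorm (𝔟 .v2 : FractionalIdeal (𝓞 K)⁰ K) *
      idealNorm (𝔟 .v3 : FractionalIdeal (𝓞 K)⁰ K) = ∏ j, idealNorm (𝔟 (singleIndex j) : FractionalIdeal (𝓞 K)⁰ K) := by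
    simp only [Fin.prod_univ_three, singleIndex, Matrix.cons_val]
  rw [errorTerm, relativeBound, prod_torsorIndex, ← hm, e1, e2, ← hP, Real.exp_add,
    ← Real.log_prod fun i _ => (hN _).ne', ← hP, Real.rpow_sub hP0, Real.rpow_one,
    Real.rpow_def_of_pos hm0, Real.rpow_def_of_pos hP0]
  have e3 : Real.log m * (1 / (finrank ℚ K : ℝ)) = 3 * (1 / (3 * (finrank ℚ K : ℝ))) * Real.log m := by field_simp
  have e4 : Real.log P * (2 / (3 * (finrank ℚ K : ℝ))) = 2 * (1 / (3 * (finrank ℚ K : ℝ))) * Real.log P := by ring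
  rw [e3, e4]
  have := Finset.prod_pos fun j (_ : j ∈ (Finset.univ : Finset (Fin 3))) => hN (singleIndex j)
  field_simp

variable (K) in
theorem exists_points_sub_mainTerm_le {c : ℝ} (hc : 0 < c) :
    ∃ C : ℝ, ∀ u : Fin (Units.rank K) → (𝓞 K)ˣ, IsFundamentalSystem u → ∀ D : Set Kˣ,
      IsCosetTransversal (generated u) D → ∀ 𝔟 : TorsorIndex → (FractionalIdeal (𝓞 K)⁰ K)ˣ,
      (∀ v, c ≤ idealNorm (𝔟 v : FractionalIdeal (𝓞 K)⁰ K)) → ∀ B : ℝ, Real.exp 1 ≤ B →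
      (points (standardReps u D) (fun v => (𝔟 v : FractionalIdeal (𝓞 K)⁰ K)) B).Finite ∧
      |((points (standardReps u D) (fun v => (𝔟 v : FractionalIdeal (𝓞 K)⁰ K)) B).ncard : ℝ) -
        mainTerm (fun v => (𝔟 v : FractionalIdeal (𝓞 K)⁰ K)) B| ≤
        C * errorTerm (fun v => (𝔟 v : FractionalIdeal (𝓞 K)⁰ K)) B := by
  obtain ⟨C₁, A, hC₁, hA, h₁⟩ := exists_points_estimate K
  have hd : (0 : ℝ) < finrank ℚ K := by exact_mod_cast finrank_pos
  obtain ⟨C₂, hC₂, h₂⟩ := exists_log_absorb (c := Real.log c) hA (show 0 < 1 / (3 * (finrank ℚ K : ℝ)) by positivity)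
  have hR := Units.regulator_pos K
  have hv := boxConst_pos (K := K)
  set M := (9 : ℝ) ^ Units.rank K * Units.regulator K ^ 7 * boxConst K ^ 9 with hM
  have hM0 : 0 < M := by positivity
  refine ⟨(C₁ + M) * C₂, fun u hu D hD 𝔟 h𝔟 B hB => ?_⟩
  have hB0 : 0 < B := (Real.exp_pos 1).trans_le hB
  have hl : 1 ≤ Real.log B := (Real.le_log_iff_exp_le hB0).2 hB
  set l := Real.log B with hldef
  have hG := relativeBound_pos 𝔟 hB0
  set Λ := 3 * ∑ v, |Real.log (idealNorm (𝔟 v : FractionalIdeal (𝓞 K)⁰ K))| with hΛ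
  have hΛ0 : 0 ≤ Λ := by positivity
  have hlev := abs_level_sub_le 𝔟 B
  obtain ⟨hfin, hest⟩ := h₁ u hu D hD 𝔟 B hB0 (l + Λ) (by positivity) fun j => by
    linarith [(abs_le.1 (hlev j)).2]
  refine ⟨hfin, ?_⟩
  have hvol := volume_cyclicPolytope_sub (L := level 𝔟 B) (by linarith) hΛ0 hlev
  rw [mainTerm_eq, errorTerm_eq, ← hldef]
  set V := (MeasureTheory.volume (cyclicPolytope (level 𝔟 B))).toReal with hV
  set G := relativeBound 𝔟 B with hGdef
  have hmax : ∀ j, Real.log (idealNorm (𝔟 (singleIndex j) : FractionalIdeal (𝓞 K)⁰ K)) ≤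
      Real.log (max (idealNorm (𝔟 .v1 : FractionalIdeal (𝓞 K)⁰ K))
        (max (idealNorm (𝔟 .v2 : FractionalIdeal (𝓞 K)⁰ K)) (idealNorm (𝔟 .v3 : FractionalIdeal (𝓞 K)⁰ K)))) := by
    intro j
    refine Real.log_le_log (idealNorm_pos _) ?_
    fin_cases j
    · exact le_max_left _ _
    · exact le_max_of_le_right (le_max_left _ _)
    · exact le_max_of_le_right (le_max_right _ _)
  have habs := h₂ (fun v => idealNorm (𝔟 v : FractionalIdeal (𝓞 K)⁰ K)) (fun v => idealNorm_pos _)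
    (fun v => Real.log_le_log hc (h𝔟 v)) _ hmax
  simp only [← hΛ] at habs
  set X := Real.exp (3 * (1 / (3 * (finrank ℚ K : ℝ))) * Real.log (max (idealNorm (𝔟 .v1 : FractionalIdeal (𝓞 K)⁰ K))
        (max (idealNorm (𝔟 .v2 : FractionalIdeal (𝓞 K)⁰ K)) (idealNorm (𝔟 .v3 : FractionalIdeal (𝓞 K)⁰ K)))) +
        2 * (1 / (3 * (finrank ℚ K : ℝ))) * ∑ i, Real.log (idealNorm (𝔟 (doubleIndex i) : FractionalIdeal (𝓞 K)⁰ K)))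
  have hvol2 : |M * G * V - M * G * (l ^ 6 / 2880)| ≤ M * G * (Λ * (l + Λ) ^ 5) := by
    rw [← mul_sub, abs_mul, abs_of_pos (by positivity : 0 < M * G)]
    gcongr
  -- Because `1 ≤ l`, every `l + Λ + A` is at most `l * W`. This separates `log B` from the ideals,
  -- and `W ^ 6` is what `exists_log_absorb` bounds.
  set W := 1 + Λ + A with hW
  have hW1 : 1 ≤ W := by rw [hW]; linarith
  have hlW : l + Λ + A ≤ l * W := by rw [hW]; nlinarith
  have hlW' : l + Λ ≤ l * W := by linarith
  have hb1 : (l + Λ + A) ^ 5 ≤ l ^ 5 * W ^ 6 := by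
    calc _ ≤ (l * W) ^ 5 := by gcongr
      _ = l ^ 5 * W ^ 5 := mul_pow _ _ _
      _ ≤ _ := by gcongr <;> norm_num
  have hb2 : Λ * (l + Λ) ^ 5 ≤ l ^ 5 * W ^ 6 := by
    calc _ ≤ W * (l * W) ^ 5 := by gcongr; rw [hW]; linarith
      _ = _ := by ring
  refine (abs_sub_le _ (M * G * V) _).trans ((add_le_add hest hvol2).trans ?_)
  calc C₁ * (G * (l + Λ + A) ^ 5) + M * G * (Λ * (l + Λ) ^ 5) ≤
      C₁ * (G * (l ^ 5 * W ^ 6)) + M * G * (l ^ 5 * W ^ 6) := by gcongr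
    _ = (C₁ + M) * (G * l ^ 5) * W ^ 6 := by ring
    _ ≤ (C₁ + M) * (G * l ^ 5) * (C₂ * X) := by gcongr
    _ = _ := by ring

end Assembly
end CubicTorsor

theorem lemma3p1 (K : Type*) [Field K] [NumberField K] (hd : 2 ≤ Module.finrank ℚ K)
    (c : ℝ) (hc : 0 < c) :
    ∃ C : ℝ, ∀ u : Fin (Units.rank K) → (𝓞 K)ˣ, CubicTorsor.IsFundamentalSystem u →
      ∀ R : Set (TorsorIndex → Kˣ),
        CubicTorsor.IsOrbitRepresentatives (CubicTorsor.generated u) R →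
      ∀ 𝔞 : TorsorIndex → FractionalIdeal (𝓞 K)⁰ K, (∀ v, c ≤ CubicTorsor.idealNorm (𝔞 v)) →
      ∀ B : ℝ, Real.exp 1 ≤ B →
        (CubicTorsor.points R 𝔞 B).Finite ∧
        |((CubicTorsor.points R 𝔞 B).ncard : ℝ) - CubicTorsor.mainTerm 𝔞 B|
          ≤ C * CubicTorsor.errorTerm 𝔞 B := by
  obtain ⟨C, h⟩ := CubicTorsor.exists_points_sub_mainTerm_le K hc
  refine ⟨C, fun u hu R hR 𝔞 h𝔞 B hB => ?_⟩
  -- Norms bounded below by `c > 0` exclude the zero ideal, so all nine ideals are invertible.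
  have hne : ∀ v, 𝔞 v ≠ 0 := fun v h0 => by
    have := h𝔞 v
    rw [h0, CubicTorsor.idealNorm] at this
    simp at this
    linarith
  lift 𝔞 to TorsorIndex → (FractionalIdeal (𝓞 K)⁰ K)ˣ using fun v => (hne v).isUnit
  obtain ⟨D, hD⟩ := CubicTorsor.exists_isCosetTransversal (CubicTorsor.generated u)
  obtain ⟨hfin, hest⟩ := h u hu D hD 𝔞 h𝔞 B hB
  have hcard := CubicTorsor.encard_points_eq hu.isUnitComplement hR
    (CubicTorsor.isOrbitRepresentatives_standardReps hu hD) (fun v => (𝔞 v : FractionalIdeal (𝓞 K)⁰ K)) B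
  refine ⟨?_, ?_⟩
  · rw [← Set.encard_lt_top_iff, hcard, Set.encard_lt_top_iff]
    exact hfin
  · rw [Set.ncard, hcard, ← Set.ncard]
    exact hest
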